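/- Let $d\ge 1$ and let $X=(X_t)_{t\ge0}$ be a Lévy process in $\mathbb{R}^d$, $X_0=0$. Assumptions (A) are the following three conditions. (H0) $X$ is a pure-jump isotropic Lévy process with infinite Lévy measure $\nu(|x|)\,dx$; that is, $\nu\ge0$, $\int_{\mathbb{R}^d}(1\wedge|x|^2)\nu(|x|)\,dx<\infty$, $\int_{\mathbb{R}^d}\nu(|x|)\,dx=\infty$, and $E e^{i\langle\xi,X_t\rangle}=e^{-t\psi(\xi)}$ with $\psi(\xi)=\int_{\mathbb{R}^d}(1-\cos\langle\xi,x\rangle)\,\nu(|x|)\,dx$. (H1) On $(0,\infty)$ the function $\nu$ is nonincreasing and absolutely continuous, $\nu(r)=-\int_r^\infty\nu'(\rho)\,d\rho$, where (for a suitable version of $\nu'$) $-\nu'(r)/r$ is nonincreasing; and there is a constant $a_1>0$ with $\nu(r)\le a_1\nu(r+1)$ for $r\ge1$ and $\nu(r)\le a_1\nu(2r)$ for $0<r\le1$. (H2) (Scale invariant Harnack inequality) There is a constant $a_2>0$ such that $h(x)\le a_2h(y)$ for all $x_0\in\mathbb{R}^d$, $r\in(0,1]$, $x,y\in B(x_0,r/2)$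 and all Borel $h:\mathbb{R}^d\to[0,\infty)$ harmonic in $B(x_0,r)$. Here $h$ is harmonic in $D$ if $h(x)=E\,h(x+X_{\tau})$, with $\tau=\inf\{t>0:x+X_t\notin B\}$ and an absolutely convergent expectation, for every bounded nonempty open $B$ with $\overline B\subset D$ and every $x\in B$. The function $\psi$ is radial, and we write $\psi(r)=\psi(\xi)$ if $|\xi|=r$. For $r,u\ge0$ put $\psi^*(r)=\sup_{0\le s\le r}\psi(s)$ and $\psi^-(u)=\inf\{s\ge0:\psi^*(s)\ge u\}$. For $\theta_0\ge0$ and $C>0$, $\psi$ satisfies WLSC$(\alpha,\theta_0,C)$, where $\alpha>0$, if $\psi(\lambda\theta)\ge C\lambda^{\alpha}\psi(\theta)$ for all $\lambda\ge1$, $\theta\ge\theta_0$; and it satisfies WUSC$(\alpha,\theta_0,C)$, where $\alpha\in(0,2)$, if $\psi(\lambda\theta)\le C\lambda^{\alpha}\psi(\theta)$ for all $\lambda\ge1$, $\theta\ge\theta_0$. **Corollary.** Let $X$ satisfy (A). Then for every $t>0$ the law of $X_t$ has a density $p_t(|x|)$ with $p_t$ nonnegative and nonincreasing on $(0,\infty)$.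 Each such $p_t$ is differentiable on $(0,\infty)$, and the following holds. 1. There is a constant $c=c(d)>0$ such that $$\left|\frac{d}{dr}p_t(r)\right|\le c\,\frac{1\wedge t\psi^*(1/r)}{r^{d+1}},\qquad t,r>0.$$ 2. If $\psi$ satisfies WLSC$(\underline\alpha,\theta_0,\underline C)$, then with a constant $c=c(d,\underline\alpha)>0$ $$\left|\frac{d}{dr}p_t(r)\right|\le c\,\frac{r}{\underline C^{(d+2)/\underline\alpha+1}}\left([\psi^-(1/t)]^{d+2}\wedge\frac{t\psi^*(1/r)}{r^{d+2}}\right),\qquad t,r>0,\ t\psi^*(\theta_0)\le 1/\pi^2.$$ 3. If $\psi$ satisfies WLSC$(\underline\alpha,\theta_0,\underline C)$ and WUSC$(\overline\alpha,\theta_0,\overline C)$, then with constants $c^*>0$ and $r_0>0$ depending only on $d,\underline\alpha,\overline\alpha,\underline C,\overline C$ $$\left|\frac{d}{dr}p_t(r)\right|\ge c^*\,r\left([\psi^-(1/t)]^{d+2}\wedge\frac{t\psi^*(1/r)}{r^{d+2}}\right),\qquad t>0,\ t\psi^*(\theta_0/r_0)\le1,\ 0<r<r_0/\theta_0.$$ If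 $\theta_0=0$, the estimates in 2 and 3 hold for all $t,r>0$. -/

import Mathlib

open MeasureTheory ProbabilityTheory Set Filter Topology
open scoped NNReal ENNReal

universe u

namespace LevyGradient

/-- Euclidean space of dimension `d`. -/
abbrev E (d : ℕ) : Type := EuclideanSpace ℝ (Fin d)

/-! ### Lévy processes -/

/-- A Lévy process on `(Ω, P)` with values in `ℝ^d`, started at the origin: independent and
stationary increments, almost surely càdlàg paths. The process started at `x` is `x + X`. -/
structure IsLevyProcess {d : ℕ} {Ω : Type u} [MeasurableSpace Ω] (X : ℝ≥0 → Ω → E d)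
    (P : Measure Ω) : Prop where
  measurable : ∀ t, Measurable (X t)
  start : ∀ᵐ ω ∂P, X 0 ω = 0
  indep : HasIndepIncrements X P
  stationary : ∀ s t : ℝ≥0, P.map (fun ω => X (s + t) ω - X s ω) = P.map (X t)
  cadlag : ∀ᵐ ω ∂P, ∀ t : ℝ≥0,
    Tendsto (fun s => X s ω) (𝓝[>] t) (𝓝 (X t ω)) ∧
      ∃ l, Tendsto (fun s => X s ω) (𝓝[<] t) (𝓝 l)

/-- The measure `ν(|x|) dx` on `ℝ^d` with the radial density given by the profile `ν`. -/
noncomputable def levyMeasure (d : ℕ) (ν : ℝ → ℝ) : Measure (E d) :=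
  volume.withDensity fun x => ENNReal.ofReal (ν ‖x‖)

/-- The exponent `ξ ↦ ∫ (1 - cos ⟨ξ, x⟩) ν(|x|) dx` of the pure-jump isotropic process with
Lévy measure `ν(|x|) dx`. -/
noncomputable def levyExponent (d : ℕ) (ν : ℝ → ℝ) (ξ : E d) : ℝ :=
  ∫ x, (1 - Real.cos (inner ℝ ξ x)) ∂(levyMeasure d ν)

/-- (H0): `X` is a pure-jump isotropic Lévy process in `ℝ^d` whose Lévy measure is infinite and
has the density `ν(|x|)`; its law is given by the Lévy-Khintchine formula
`E exp(i⟨ξ, X_t⟩) = exp(-t ψ(ξ))`, `ψ(ξ) = ∫ (1 - cos ⟨ξ, x⟩) ν(|x|) dx`. -/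
structure H0 {d : ℕ} {Ω : Type u} [MeasurableSpace Ω] (X : ℝ≥0 → Ω → E d)
    (P : Measure Ω) (ν : ℝ → ℝ) : Prop where
  levy : IsLevyProcess X P
  nonneg : ∀ r, 0 < r → 0 ≤ ν r
  finite_moment : ∫⁻ x, ENNReal.ofReal (min 1 (‖x‖ ^ 2)) ∂(levyMeasure d ν) < ∞
  infinite : levyMeasure d ν univ = ∞
  charFun_eq : ∀ (t : ℝ≥0) (ξ : E d),
    charFun (P.map (X t)) ξ = Complex.exp (-((t : ℝ) * levyExponent d ν ξ : ℝ))

/-- (H1): the profile `ν` is nonincreasing and absolutely continuous on `(0, ∞)`, its derivative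
`ν'`, normalised by `ν(r) = -∫_r^∞ ν'`, has a version for which `-ν'(r)/r` is nonincreasing on
`(0, ∞)`, and `ν` has the two doubling properties. -/
structure H1 (ν : ℝ → ℝ) : Prop where
  antitone : AntitoneOn ν (Ioi 0)
  derivative : ∃ ν' : ℝ → ℝ,
    (∀ r, 0 < r → IntegrableOn ν' (Ioi r) ∧ ν r = -∫ ρ in Ioi r, ν' ρ) ∧
      AntitoneOn (fun r => -ν' r / r) (Ioi 0)
  doubling : ∃ a₁ : ℝ, 0 < a₁ ∧ (∀ r, 1 ≤ r → ν r ≤ a₁ * ν (r + 1)) ∧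
    ∀ r, 0 < r → r ≤ 1 → ν r ≤ a₁ * ν (2 * r)

/-! ### Harmonic functions and the Harnack inequality -/

/-- The first exit time `inf {t > 0 : x + X_t ∉ B}` of the process started at `x`. -/
noncomputable def exitTime {d : ℕ} {Ω : Type u} (X : ℝ≥0 → Ω → E d) (B : Set (E d)) (x : E d)
    (ω : Ω) : ℝ≥0 :=
  sInf {t : ℝ≥0 | 0 < t ∧ x + X t ω ∉ B}

/-- The random variable `f(X(τ_B))` for the process started at `x`, with value `0` on the event
that the process never leaves `B`. -/
noncomputable def exitValue {d : ℕ} {Ω : Type u} (X : ℝ≥0 → Ω → E d) (B : Set (E d))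
    (f : E d → ℝ) (x : E d) : Ω → ℝ :=
  indicator {ω | ∃ t : ℝ≥0, 0 < t ∧ x + X t ω ∉ B} fun ω => f (x + X (exitTime X B x ω) ω)

/-- `f` is harmonic in `D` with respect to `X`: `f(x) = E^x f(X(τ_B))`, the expectation being
absolutely convergent, for all nonempty bounded open `B` with closure in `D` and all `x ∈ B`. -/
def IsHarmonic {d : ℕ} {Ω : Type u} [MeasurableSpace Ω] (X : ℝ≥0 → Ω → E d) (P : Measure Ω)
    (f : E d → ℝ) (D : Set (E d)) : Prop :=
  Measurable f ∧ ∀ B : Set (E d), Bornology.IsBounded B → IsOpen B → B.Nonempty →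
    closure B ⊆ D → ∀ x ∈ B,
      Integrable (exitValue X B f x) P ∧ f x = ∫ ω, exitValue X B f x ω ∂P

/-- (H2): the scale invariant Harnack inequality. -/
def H2 {d : ℕ} {Ω : Type u} [MeasurableSpace Ω] (X : ℝ≥0 → Ω → E d) (P : Measure Ω) : Prop :=
  ∃ a₂ : ℝ, 0 < a₂ ∧ ∀ (x₀ : E d) (r : ℝ), 0 < r → r ≤ 1 → ∀ h : E d → ℝ, (∀ x, 0 ≤ h x) →
    IsHarmonic X P h (Metric.ball x₀ r) →
      ∀ x ∈ Metric.ball x₀ (r / 2), ∀ y ∈ Metric.ball x₀ (r / 2), h x ≤ a₂ * h y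

/-- Assumptions (A). -/
structure AssumptionsA {d : ℕ} {Ω : Type u} [MeasurableSpace Ω] (X : ℝ≥0 → Ω → E d)
    (P : Measure Ω) (ν : ℝ → ℝ) : Prop where
  h0 : H0 X P ν
  h1 : H1 ν
  h2 : H2 X P

/-! ### The transition density and the characteristic exponent -/

/-- `p t r` is the radial profile of the transition density of `X`: for every `t > 0` the law of
`X t` is `p_t(|x|) dx`, and `p_t` is nonnegative and nonincreasing on `(0, ∞)`. -/
def IsTransitionDensity {d : ℕ} {Ω : Type u} [MeasurableSpace Ω] (X : ℝ≥0 → Ω → E d)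
    (P : Measure Ω) (p : ℝ≥0 → ℝ → ℝ) : Prop :=
  ∀ t : ℝ≥0, 0 < t → (∀ r, 0 < r → 0 ≤ p t r) ∧ AntitoneOn (p t) (Ioi 0) ∧
    P.map (X t) = volume.withDensity fun x => ENNReal.ofReal (p t ‖x‖)

/-- The radial profile `ψ(r)`, `r ≥ 0`, of the characteristic exponent: the value of the (radial)
exponent at `(r, 0, …, 0)`. -/
noncomputable def psi (d : ℕ) [NeZero d] (ν : ℝ → ℝ) (r : ℝ) : ℝ :=
  levyExponent d ν (EuclideanSpace.single 0 r)

/-- `ψ*(r) = sup_{0 ≤ s ≤ r} ψ(s)`. -/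
noncomputable def psiStar (d : ℕ) [NeZero d] (ν : ℝ → ℝ) (r : ℝ) : ℝ :=
  sSup (psi d ν '' Icc 0 r)

/-- `ψ⁻(u) = inf {s ≥ 0 : ψ*(s) ≥ u}`, the generalized inverse of `ψ*`. -/
noncomputable def psiInv (d : ℕ) [NeZero d] (ν : ℝ → ℝ) (u : ℝ) : ℝ :=
  sInf {s | 0 ≤ s ∧ u ≤ psiStar d ν s}

/-! ### Scaling conditions -/

/-- Weak lower scaling condition `WLSC(α, θ₀, C)`. -/
structure WLSC (φ : ℝ → ℝ) (α θ₀ C : ℝ) : Prop where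
  nonneg : ∀ θ, 0 ≤ θ → 0 ≤ φ θ
  nonzero : ∃ θ, 0 ≤ θ ∧ φ θ ≠ 0
  alpha_pos : 0 < α
  theta_nonneg : 0 ≤ θ₀
  const_pos : 0 < C
  scaling : ∀ l θ : ℝ, 1 ≤ l → θ₀ ≤ θ → C * l ^ α * φ θ ≤ φ (l * θ)

/-- Weak upper scaling condition `WUSC(α, θ₀, C)`. -/
structure WUSC (φ : ℝ → ℝ) (α θ₀ C : ℝ) : Prop where
  nonneg : ∀ θ, 0 ≤ θ → 0 ≤ φ θ
  nonzero : ∃ θ, 0 ≤ θ ∧ φ θ ≠ 0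
  alpha_pos : 0 < α
  alpha_lt : α < 2
  theta_nonneg : 0 ≤ θ₀
  const_pos : 0 < C
  scaling : ∀ l θ : ℝ, 1 ≤ l → θ₀ ≤ θ → φ (l * θ) ≤ C * l ^ α * φ θ

end LevyGradient

open LevyGradient

/-!
The derivative of the transition density in dimension `d` is, up to the factor `-2πr`, a transition
density in dimension `d + 2`.

By (H1) the function `k(r) = -ν'(r) / (2πr)` is nonincreasing, and integrating `k(|·|)` over the
affine planes `{x} × ℂ` in `ℝ^d × ℂ` gives back `ν(|x|)`, because
`2π ∫_r^∞ ρ k(ρ) dρ = ν(r)` (`planeIntegral_liftedProfile`). Hence `k` is the profile of an infinite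
isotropic unimodal Lévy measure in dimension `d + 2`, and its exponent has the same radial profile
`ψ` as the exponent of `X` (`isLevyProfile_liftedProfile`, `exponent_liftedProfile_eq_psi`). The
corresponding infinitely divisible law at time `t` is a weak limit of compound Poisson laws, which
are built from convolutions of unimodal measures. It is therefore unimodal, and it has no atom since
its characteristic function tends to zero; so it has a radially nonincreasing density with profile
`q_t` (`IsLevyProfile.exists_density`). Being a convolution square, `q_t` is continuous on `(0, ∞)`
(`IsLevyProfile.exists_continuous_density`). Projecting to `ℝ^d` and comparing characteristic
functions gives `p_t(r) = 2π ∫_r^∞ ρ q_t(ρ) dρ`, so that `p_t'(r) = -2πr q_t(r)`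
(`AssumptionsA.exists_abs_deriv_eq`).

What remains are estimates of a radially nonincreasing density in dimension `n = d + 2` with
characteristic function `exp(-tψ)`. For a nonincreasing profile, averaging over dilations removes
the oscillation of the cosine, so that truncated second moments are bounded by the exponent
(`lintegral_min_one_sq_le`). This gives the almost monotonicity of `ψ` and the tail bound
`P(|X_t| ≥ r) ≤ C t ψ(1 / r)`, and monotonicity of `q_t` turns the latter into the first upper bound
(`density_le`). Fourier inversion and the lower scaling of `ψ` give the bound near the origin
(`density_le_of_wlsc`). For the lower bound, the scaling conditions ensure that a fixed part of
`t ψ(1 / r)` is the mass of an annulus of radii comparable with `r`, and monotonicity converts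
it into a pointwise bound (`le_density`).
-/

set_option linter.unusedSectionVars false

namespace LevyGradient

/-! ### Unimodal measures -/

section Unimodal

variable {V : Type*} [NormedAddCommGroup V] [InnerProductSpace ℝ V] [FiniteDimensional ℝ V]
  [MeasurableSpace V] [BorelSpace V]

/-- A measure is unimodal if a ball of fixed radius loses mass as its centre moves away from the
origin. For absolutely continuous measures this says that the density is radially nonincreasing,
but the formulation through balls also admits an atom at `0` and passes to weak limits. -/
def Unimodal (μ : Measure V) : Prop :=
  ∀ (x y : V) (r : ℝ), ‖y‖ ≤ ‖x‖ → μ (Metric.ball x r) ≤ μ (Metric.ball y r)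

/-- The reflection in the bisecting hyperplane of `x` and `y`, where `y` is not farther from the
origin than `x`. It sends points on the side of `x` closer to the origin. -/
theorem exists_bisector_reflection (x y : V) (h : ‖y‖ ≤ ‖x‖) :
    ∃ σ : V → V, MeasurePreserving σ ∧ (∀ z, σ (σ z) = z) ∧ (∀ z, dist (σ z) y = dist z x) ∧
      (∀ z, dist (σ z) x = dist z y) ∧ ∀ z, dist z x ≤ dist z y → ‖σ z‖ ≤ ‖z‖ := by
  set u : V := x - y with hu
  set m : V := (2⁻¹ : ℝ) • (x + y) with hm
  let R : V ≃ₗᵢ[ℝ] V := (Submodule.span ℝ {u})ᗮ.reflection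
  have hR : ∀ z, R z = z - (2 * (inner ℝ u z / ‖u‖ ^ 2)) • u := by
    intro z
    simp only [R, Submodule.reflection_orthogonal_apply, Submodule.reflection_singleton_apply]
    simp only [RCLike.ofReal_real_eq_id, id_eq, neg_sub, mul_smul, two_smul]
  have hRu : R u = -u := Submodule.reflection_orthogonalComplement_singleton_eq_neg u
  have hRR : ∀ z, R (R z) = z := fun z => Submodule.reflection_reflection _ z
  have hy : y = R (x - m) + m := by
    have : x - m = (2⁻¹ : ℝ) • u := by
      rw [hm, hu]; module
    rw [this, map_smul, hRu, hm, hu]; module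
  have hx : x = R (y - m) + m := by
    have : y - m = -((2⁻¹ : ℝ) • u) := by
      rw [hm, hu]; module
    rw [this, map_neg, map_smul, hRu, hm, hu]; module
  refine ⟨fun z => R (z - m) + m, ?_, ?_, ?_, ?_, ?_⟩
  · exact (measurePreserving_add_right volume m).comp
      (R.measurePreserving.comp (measurePreserving_sub_right volume m))
  · intro z
    simp [hRR]
  · intro z
    conv_lhs => rw [hy]
    rw [dist_add_right, R.dist_map, dist_sub_right]
  · intro z
    conv_lhs => rw [hx]
    rw [dist_add_right, R.dist_map, dist_sub_right]
  · intro z hz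
    by_cases hu0 : u = 0
    · simp [hR, hu0]
    have hun : 0 < ‖u‖ ^ 2 := by positivity
    have h1 : 0 ≤ inner ℝ u (z - m) := by
      have h2 : dist z x ^ 2 ≤ dist z y ^ 2 := by gcongr
      have e1 : z - x = (z - m) - (2⁻¹ : ℝ) • u := by rw [hm, hu]; module
      have e2 : z - y = (z - m) + (2⁻¹ : ℝ) • u := by rw [hm, hu]; module
      rw [dist_eq_norm, dist_eq_norm, e1, e2, norm_sub_sq_real, norm_add_sq_real,
        inner_smul_right, real_inner_comm] at h2
      linarith
    have h3 : 0 ≤ inner ℝ u m := by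
      have h2 : ‖y‖ ^ 2 ≤ ‖x‖ ^ 2 := by gcongr
      have : inner ℝ u m = 2⁻¹ * (‖x‖ ^ 2 - ‖y‖ ^ 2) := by
        rw [hm, hu, inner_smul_right, inner_sub_left, inner_add_right, inner_add_right,
          real_inner_self_eq_norm_sq, real_inner_self_eq_norm_sq, real_inner_comm]
        ring
      rw [this]; linarith
    set c := inner ℝ u (z - m) / ‖u‖ ^ 2 with hc
    have hc0 : 0 ≤ c := by positivity
    have e : R (z - m) + m = z - (2 * c) • u := by rw [hR]; module
    have hcu : inner ℝ u (z - m) = c * ‖u‖ ^ 2 := by rw [hc]; field_simp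
    have : ‖z - (2 * c) • u‖ ^ 2 = ‖z‖ ^ 2 - 4 * c * inner ℝ u m := by
      rw [norm_sub_sq_real, inner_smul_right, norm_smul, mul_pow, Real.norm_eq_abs, sq_abs,
        real_inner_comm]
      have : inner ℝ u z = inner ℝ u (z - m) + inner ℝ u m := by rw [← inner_add_right]; simp
      rw [this, hcu]; ring
    dsimp only
    rw [e]
    refine le_of_sq_le_sq ?_ (norm_nonneg _)
    rw [this]
    have := mul_nonneg hc0 h3
    linarith

/-- A measure with radially nonincreasing density is unimodal: compare the two sides of the
bisecting hyperplane of the two centres. -/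
theorem unimodal_withDensity {f : V → ℝ≥0∞} (hf : Measurable f)
    (hmono : ∀ x y, ‖y‖ ≤ ‖x‖ → f x ≤ f y) : Unimodal (volume.withDensity f) := by
  intro x y r hxy
  obtain ⟨σ, hσ, hσσ, hy, hx, hnorm⟩ := exists_bisector_reflection x y hxy
  have mx : MeasurableSet (Metric.ball x r) := measurableSet_ball
  have my : MeasurableSet (Metric.ball y r) := measurableSet_ball
  rw [← measure_inter_add_sdiff (Metric.ball x r) my, ← measure_inter_add_sdiff (Metric.ball y r) mx,
    inter_comm]
  gcongr 1
  rw [withDensity_apply _ (mx.diff my), withDensity_apply _ (my.diff mx)]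
  have hpre : σ ⁻¹' (Metric.ball y r \ Metric.ball x r) = Metric.ball x r \ Metric.ball y r := by
    ext z
    simp [hy, hx]
  rw [← hσ.setLIntegral_comp_preimage (my.diff mx) hf, hpre]
  refine setLIntegral_mono' (mx.diff my) fun z hz => hmono _ _ (hnorm z ?_)
  have h1 := hz.1
  have h2 := hz.2
  rw [Metric.mem_ball] at h1 h2
  linarith

theorem unimodal_dirac_zero : Unimodal (Measure.dirac (0 : V)) := by
  intro x y r h
  rw [Measure.dirac_apply' _ measurableSet_ball, Measure.dirac_apply' _ measurableSet_ball]
  by_cases hx : (0 : V) ∈ Metric.ball x r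
  · have hy : (0 : V) ∈ Metric.ball y r := by
      simp only [Metric.mem_ball, dist_zero_left] at hx ⊢
      exact h.trans_lt hx
    simp [hx, hy]
  · simp [hx]

theorem Unimodal.add {μ ν : Measure V} (hμ : Unimodal μ) (hν : Unimodal ν) : Unimodal (μ + ν) := by
  intro x y r h
  simp only [Measure.add_apply]
  exact add_le_add (hμ x y r h) (hν x y r h)

theorem Unimodal.smul {μ : Measure V} (c : ℝ≥0∞) (hμ : Unimodal μ) : Unimodal (c • μ) := by
  intro x y r h
  simp only [Measure.smul_apply, smul_eq_mul]
  exact mul_le_mul_right (hμ x y r h) c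

theorem Unimodal.closedBall_le {μ : Measure V} [IsFiniteMeasure μ] (hμ : Unimodal μ) {x y : V}
    (r : ℝ) (h : ‖y‖ ≤ ‖x‖) : μ (Metric.closedBall x r) ≤ μ (Metric.closedBall y r) := by
  have key : ∀ z : V, Tendsto (fun n : ℕ => μ (Metric.ball z (r + 1 / (n + 1)))) atTop
      (𝓝 (μ (Metric.closedBall z r))) := by
    intro z
    have e : Metric.closedBall z r = ⋂ n : ℕ, Metric.ball z (r + 1 / ((n : ℝ) + 1)) := by
      ext w
      simp only [Metric.mem_closedBall, mem_iInter, Metric.mem_ball]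
      refine ⟨fun hw n => ?_, fun hw => ?_⟩
      · have : 0 < 1 / ((n : ℝ) + 1) := by positivity
        linarith
      · refine le_of_forall_pos_lt_add fun ε hε => ?_
        obtain ⟨n, hn⟩ := exists_nat_one_div_lt hε
        exact (hw n).trans (by linarith)
    rw [e]
    refine tendsto_measure_iInter_atTop (fun n => measurableSet_ball.nullMeasurableSet) ?_
      ⟨0, measure_ne_top _ _⟩
    intro n m hnm
    refine Metric.ball_subset_ball ?_
    have : 1 / ((m : ℝ) + 1) ≤ 1 / ((n : ℝ) + 1) := by gcongr
    linarith
  exact le_of_tendsto_of_tendsto' (key x) (key y) fun n => hμ x y _ h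

/-- Balls may be replaced by arbitrary sets that contain every point not farther from the origin
than one of their members. -/
theorem Unimodal.preimage_sub_le {μ : Measure V} [IsFiniteMeasure μ] (hμ : Unimodal μ) {D : Set V}
    (hD : ∀ w ∈ D, ∀ w', ‖w'‖ ≤ ‖w‖ → w' ∈ D) {x y : V} (h : ‖y‖ ≤ ‖x‖) :
    μ {z | x - z ∈ D} ≤ μ {z | y - z ∈ D} := by
  by_cases hb : BddAbove (norm '' D)
  swap
  · have : D = univ := by
      refine eq_univ_of_forall fun w => ?_
      rw [not_bddAbove_iff] at hb
      obtain ⟨_, ⟨v, hv, rfl⟩, hv2⟩ := hb ‖w‖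
      exact hD v hv w hv2.le
    simp [this]
  rcases D.eq_empty_or_nonempty with rfl | hne
  · simp
  have hne' : (norm '' D).Nonempty := hne.image _
  set a := sSup (norm '' D) with ha
  have hle : ∀ w ∈ D, ‖w‖ ≤ a := fun w hw => le_csSup hb (mem_image_of_mem _ hw)
  have hlt : ∀ w, ‖w‖ < a → w ∈ D := by
    intro w hw
    obtain ⟨_, ⟨v, hv, rfl⟩, hv2⟩ := exists_lt_of_lt_csSup hne' hw
    exact hD v hv w hv2.le
  by_cases hmem : a ∈ norm '' D
  · obtain ⟨v, hv, hva⟩ := hmem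
    have : ∀ p : V, {z | p - z ∈ D} = Metric.closedBall p a := by
      intro p
      ext z
      simp only [mem_ofPred_eq, Metric.mem_closedBall, dist_comm z p, dist_eq_norm]
      exact ⟨hle _, fun hz => hD v hv _ (by rw [hva]; exact hz)⟩
    rw [this, this]
    exact hμ.closedBall_le a h
  · have : ∀ p : V, {z | p - z ∈ D} = Metric.ball p a := by
      intro p
      ext z
      simp only [mem_ofPred_eq, Metric.mem_ball, dist_comm z p, dist_eq_norm]
      exact ⟨fun hz => lt_of_le_of_ne (hle _ hz) fun he => hmem ⟨_, hz, he⟩, hlt _⟩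
    rw [this, this]
    exact hμ x y a h

theorem measurable_measure_ball (ν : Measure V) [SFinite ν] (r : ℝ) :
    Measurable fun w => ν (Metric.ball w r) := by
  have : MeasurableSet {p : V × V | dist p.2 p.1 < r} :=
    measurableSet_lt (measurable_dist.comp measurable_swap) measurable_const
  exact measurable_measure_prodMk_left this

theorem Unimodal.conv {μ ν : Measure V} [IsFiniteMeasure μ] [IsFiniteMeasure ν] (hμ : Unimodal μ)
    (hν : Unimodal ν) : Unimodal (μ.conv ν) := by
  have key : ∀ (p : V) (r : ℝ), (μ.conv ν) (Metric.ball p r) =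
      ∫⁻ t in Ioi (0 : ℝ), μ {z | p - z ∈ {w | t < ν.real (Metric.ball w r)}} := by
    intro p r
    have h1 : Measurable fun z => ν.real (Metric.ball (p - z) r) :=
      ((measurable_measure_ball ν r).comp (by fun_prop : Measurable fun z : V => p - z)).ennreal_toReal
    rw [← lintegral_indicator_one measurableSet_ball,
      Measure.lintegral_conv (measurable_one.indicator measurableSet_ball)]
    simp only [mem_ofPred_eq]
    rw [← lintegral_eq_lintegral_meas_lt μ (ae_of_all _ fun z => measureReal_nonneg)
      h1.aemeasurable]
    refine lintegral_congr fun z => ?_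
    rw [ofReal_measureReal, ← lintegral_indicator_one measurableSet_ball]
    refine lintegral_congr fun w => ?_
    simp only [indicator, Metric.mem_ball, dist_eq_norm]
    congr 2
    rw [sub_sub_eq_add_sub, add_comm]
  intro x y r h
  rw [key, key]
  refine lintegral_mono fun t => hμ.preimage_sub_le ?_ h
  intro w hw w' hw'
  simp only [mem_ofPred_eq] at hw ⊢
  exact hw.trans_le (ENNReal.toReal_mono (measure_ne_top _ _) (hν w w' r hw'))

/-- Unimodality passes to weak limits. -/
theorem unimodal_of_tendsto {ι : Type*} {L : Filter ι} [L.NeBot] {μs : ι → ProbabilityMeasure V}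
    {μ : ProbabilityMeasure V} (hlim : Tendsto μs L (𝓝 μ))
    (hμ : ∀ i, Unimodal (μs i : Measure V)) : Unimodal (μ : Measure V) := by
  intro x y r h
  have step : ∀ s, (μ : Measure V) (Metric.ball x s) ≤ (μ : Measure V) (Metric.closedBall y s) := by
    intro s
    calc (μ : Measure V) (Metric.ball x s)
        ≤ L.liminf fun i => (μs i : Measure V) (Metric.ball x s) :=
          ProbabilityMeasure.le_liminf_measure_open_of_tendsto hlim Metric.isOpen_ball
      _ ≤ L.liminf fun i => (μs i : Measure V) (Metric.closedBall y s) :=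
          liminf_le_liminf (Eventually.of_forall fun i =>
            (hμ i x y s h).trans (measure_mono Metric.ball_subset_closedBall))
      _ ≤ L.limsup fun i => (μs i : Measure V) (Metric.closedBall y s) := liminf_le_limsup
      _ ≤ _ := ProbabilityMeasure.limsup_measure_closed_le_of_tendsto hlim
          Metric.isClosed_closedBall
  have e : Metric.ball x r = ⋃ n : ℕ, Metric.ball x (r - 1 / ((n : ℝ) + 1)) := by
    ext w
    simp only [Metric.mem_ball, mem_iUnion]
    refine ⟨fun hw => ?_, fun ⟨n, hn⟩ => ?_⟩
    · obtain ⟨n, hn⟩ := exists_nat_one_div_lt (sub_pos.2 hw)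
      exact ⟨n, by linarith⟩
    · have : 0 < 1 / ((n : ℝ) + 1) := by positivity
      linarith
  have hmono : Monotone fun n : ℕ => Metric.ball x (r - 1 / ((n : ℝ) + 1)) := by
    intro n m hnm
    refine Metric.ball_subset_ball ?_
    have : 1 / ((m : ℝ) + 1) ≤ 1 / ((n : ℝ) + 1) := by gcongr
    linarith
  rw [e, hmono.measure_iUnion]
  refine iSup_le fun n => (step _).trans (measure_mono (Metric.closedBall_subset_ball ?_))
  have : 0 < 1 / ((n : ℝ) + 1) := by positivity
  linarith

/-- If the characteristic functions of unimodal laws converge to a function continuous at `0`, the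
limit is the characteristic function of a unimodal law. -/
theorem exists_unimodal_of_tendsto_charFun {μs : ℕ → Measure V}
    (hp : ∀ n, IsProbabilityMeasure (μs n)) (hμ : ∀ n, Unimodal (μs n)) {φ : V → ℂ}
    (hφ : ContinuousAt φ 0) (hlim : ∀ ξ, Tendsto (fun n => charFun (μs n) ξ) atTop (𝓝 (φ ξ))) :
    ∃ μ : Measure V, IsProbabilityMeasure μ ∧ Unimodal μ ∧ ∀ ξ, charFun μ ξ = φ ξ := by
  have htight := isTightMeasureSet_of_tendsto_charFun hφ hlim
  let P : ℕ → ProbabilityMeasure V := fun n => ⟨μs n, hp n⟩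
  have hS : IsTightMeasureSet {((μ : ProbabilityMeasure V) : Measure V) | μ ∈ range P} := by
    convert htight using 1
    ext ν
    constructor
    · rintro ⟨_, ⟨n, rfl⟩, rfl⟩
      exact ⟨n, rfl⟩
    · rintro ⟨n, rfl⟩
      exact ⟨P n, ⟨n, rfl⟩, rfl⟩
  have hc := isCompact_closure_of_isTightMeasureSet hS
  obtain ⟨μ, -, hμc⟩ := hc (f := map P atTop) (by
    rw [le_principal_iff, mem_map]
    exact univ_mem' fun n => subset_closure (mem_range_self n))
  rw [ClusterPt] at hμc
  obtain ⟨U, hU1, hU2⟩ := mapClusterPt_iff_ultrafilter.1 (show MapClusterPt μ atTop P from hμc)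
  refine ⟨μ, inferInstance, unimodal_of_tendsto hU2 hμ, fun ξ => ?_⟩
  refine tendsto_nhds_unique ?_ ((hlim ξ).mono_left hU1)
  rw [ProbabilityMeasure.tendsto_iff_forall_integral_rclike_tendsto ℂ] at hU2
  simp_rw [charFun_eq_integral_innerProbChar]
  exact hU2 (BoundedContinuousFunction.innerProbChar ξ)

theorem setLIntegral_measure_ball (μ : Measure V) [IsFiniteMeasure μ] (U : Set V) (r : ℝ) :
    ∫⁻ x in U, μ (Metric.ball x r) = ∫⁻ z, volume.restrict U (Metric.ball z r) ∂μ := by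
  have hm : MeasurableSet {p : V × V | dist p.2 p.1 < r} :=
    measurableSet_lt (measurable_dist.comp measurable_swap) measurable_const
  have h1 := Measure.prod_apply (μ := volume.restrict U) (ν := μ) hm
  have h2 := Measure.prod_apply_symm (μ := volume.restrict U) (ν := μ) hm
  rw [h1] at h2
  convert! h2 using 4 with z
  ext w
  simp [dist_comm]

/-- Away from the origin a unimodal measure gives a ball at most a multiple of its volume: average
`μ (ball y r)` over `y` in the ball of radius `ε`. -/
theorem Unimodal.volume_mul_measure_ball_le {μ : Measure V} [IsFiniteMeasure μ] (hμ : Unimodal μ)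
    {ε : ℝ} {x : V} (hx : ε ≤ ‖x‖) (r : ℝ) :
    volume (Metric.ball (0 : V) ε) * μ (Metric.ball x r) ≤
      volume (Metric.ball (0 : V) r) * μ univ := by
  calc volume (Metric.ball (0 : V) ε) * μ (Metric.ball x r)
      = ∫⁻ _ in Metric.ball (0 : V) ε, μ (Metric.ball x r) := by
        rw [setLIntegral_const, mul_comm]
    _ ≤ ∫⁻ y in Metric.ball (0 : V) ε, μ (Metric.ball y r) := by
        refine setLIntegral_mono' measurableSet_ball fun y hy => hμ x y r ?_
        rw [mem_ball_zero_iff] at hy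
        exact hy.le.trans hx
    _ = ∫⁻ z, volume.restrict (Metric.ball (0 : V) ε) (Metric.ball z r) ∂μ :=
        setLIntegral_measure_ball μ _ r
    _ ≤ ∫⁻ _, volume (Metric.ball (0 : V) r) ∂μ := by
        refine lintegral_mono fun z => (Measure.restrict_apply_le _ _).trans ?_
        rw [Measure.addHaar_ball_center]
    _ = _ := by rw [lintegral_const]

theorem Unimodal.volume_mul_measure_isOpen_le {μ : Measure V} [IsFiniteMeasure μ]
    (hμ : Unimodal μ) {ε : ℝ} {U : Set V} (hU : IsOpen U) (hUε : ∀ x ∈ U, ε ≤ ‖x‖) :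
    volume (Metric.ball (0 : V) ε) * μ U ≤ volume U * μ univ := by
  let S : ℕ → Set V := fun n => {z | Metric.ball z (1 / ((n : ℝ) + 1)) ⊆ U}
  have hS : U = ⋃ n, S n := by
    ext z
    simp only [mem_iUnion, S, mem_ofPred_eq]
    refine ⟨fun hz => ?_, fun ⟨n, hn⟩ => hn (Metric.mem_ball_self (by positivity))⟩
    obtain ⟨δ, hδ, hδU⟩ := Metric.isOpen_iff.1 hU z hz
    obtain ⟨n, hn⟩ := exists_nat_one_div_lt hδ
    exact ⟨n, (Metric.ball_subset_ball hn.le).trans hδU⟩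
  have hmono : Monotone S := by
    intro n m hnm z hz
    refine (Metric.ball_subset_ball ?_).trans hz
    have : 1 / ((m : ℝ) + 1) ≤ 1 / ((n : ℝ) + 1) := by gcongr
    exact this
  conv_lhs => rw [hS, hmono.measure_iUnion, ENNReal.mul_iSup]
  refine iSup_le fun n => ?_
  set r : ℝ := 1 / ((n : ℝ) + 1) with hr
  have hr0 : 0 < r := by positivity
  set b := volume (Metric.ball (0 : V) r) with hb
  have hb0 : b ≠ 0 := (Metric.measure_ball_pos volume _ hr0).ne'
  have hbt : b ≠ ∞ := measure_ball_lt_top.ne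
  refine (ENNReal.mul_le_mul_iff_right hb0 hbt).1 ?_
  calc b * (volume (Metric.ball (0 : V) ε) * μ (S n))
      = volume (Metric.ball (0 : V) ε) * (b * μ (S n)) := by ring
    _ ≤ volume (Metric.ball (0 : V) ε) * ∫⁻ z, volume.restrict U (Metric.ball z r) ∂μ := by
        gcongr
        refine le_trans ?_ (mul_meas_ge_le_lintegral (measurable_measure_ball _ r) b)
        gcongr
        intro z hz
        have hz' : Metric.ball z r ⊆ U := hz
        rw [mem_ofPred_eq, Measure.restrict_apply measurableSet_ball, inter_eq_left.2 hz',
          Measure.addHaar_ball_center]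
    _ = ∫⁻ x in U, volume (Metric.ball (0 : V) ε) * μ (Metric.ball x r) := by
        rw [← setLIntegral_measure_ball, lintegral_const_mul _ (measurable_measure_ball μ r)]
    _ ≤ ∫⁻ x in U, b * μ univ :=
        setLIntegral_mono' hU.measurableSet fun x hx =>
          hμ.volume_mul_measure_ball_le (hUε x hx) r
    _ = b * (volume U * μ univ) := by rw [setLIntegral_const]; ring

theorem Unimodal.measure_eq_zero {μ : Measure V} [IsFiniteMeasure μ] (hμ : Unimodal μ) {S : Set V}
    (hS : volume S = 0) (h0 : (0 : V) ∉ S) : μ S = 0 := by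
  have key : ∀ n : ℕ, μ (S ∩ {x | 1 / ((n : ℝ) + 1) < ‖x‖}) = 0 := by
    intro n
    set ε : ℝ := 1 / ((n : ℝ) + 1) with hε
    have hε0 : 0 < ε := by positivity
    set b := volume (Metric.ball (0 : V) ε) with hb
    have hb0 : b ≠ 0 := (Metric.measure_ball_pos volume _ hε0).ne'
    have hO : IsOpen {x : V | ε < ‖x‖} := isOpen_lt continuous_const continuous_norm
    have h1 : ∀ η : ℝ≥0∞, 0 < η → b * μ (S ∩ {x | ε < ‖x‖}) ≤ η * μ univ := by
      intro η hη
      obtain ⟨U, hSU, hU, hUη⟩ := S.exists_isOpen_lt_of_lt η (by rw [hS]; exact hη)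
      calc b * μ (S ∩ {x | ε < ‖x‖}) ≤ b * μ (U ∩ {x | ε < ‖x‖}) := by gcongr
        _ ≤ volume (U ∩ {x | ε < ‖x‖}) * μ univ :=
            hμ.volume_mul_measure_isOpen_le (hU.inter hO) fun x hx => hx.2.le
        _ ≤ η * μ univ := by
            gcongr
            exact (measure_mono inter_subset_left).trans hUη.le
    have h2 : b * μ (S ∩ {x | ε < ‖x‖}) = 0 := by
      have ht : Tendsto (fun η : ℝ≥0∞ => η * μ univ) (𝓝[>] 0) (𝓝 (0 * μ univ)) :=
        (ENNReal.Tendsto.mul_const tendsto_id (Or.inr (measure_ne_top _ _))).mono_left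
          nhdsWithin_le_nhds
      rw [zero_mul] at ht
      refine le_antisymm (ge_of_tendsto ht ?_) zero_le
      filter_upwards [self_mem_nhdsWithin] with η hη using h1 η hη
    exact (mul_eq_zero.1 h2).resolve_left hb0
  have hcov : S ⊆ ⋃ n : ℕ, S ∩ {x | 1 / ((n : ℝ) + 1) < ‖x‖} := by
    intro x hx
    have : 0 < ‖x‖ := norm_pos_iff.2 fun h => h0 (h ▸ hx)
    obtain ⟨n, hn⟩ := exists_nat_one_div_lt this
    exact mem_iUnion.2 ⟨n, hx, hn⟩
  exact measure_mono_null hcov (measure_iUnion_null key)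

/-- A unimodal measure is the sum of an atom at the origin and a measure with radially
nonincreasing density. The density is the derivative of the measure along closed balls; taking the
upper derivative makes it nonincreasing everywhere. The value `∞` of the profile on `(-∞, 0]`
makes the profile monotone on the whole line. -/
theorem Unimodal.exists_density [Nontrivial V] {μ : Measure V} [IsFiniteMeasure μ]
    (hμ : Unimodal μ) : ∃ k : ℝ → ℝ≥0∞, Antitone k ∧
      μ = μ {0} • Measure.dirac 0 + volume.withDensity fun x => k ‖x‖ := by
  obtain ⟨e, he⟩ := exists_norm_eq V (zero_le_one (α := ℝ))
  let D : V → ℝ≥0∞ := fun x =>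
    limsup (fun r => μ (Metric.closedBall x r) / volume (Metric.closedBall x r)) (𝓝[>] 0)
  have hD : ∀ x y, ‖y‖ ≤ ‖x‖ → D x ≤ D y := by
    intro x y h
    refine limsup_le_limsup (Eventually.of_forall fun r => ?_)
    simp only [Measure.addHaar_closedBall_center volume x, Measure.addHaar_closedBall_center volume y]
    exact ENNReal.div_le_div_right (hμ.closedBall_le r h) _
  let k : ℝ → ℝ≥0∞ := fun r => if r ≤ 0 then ∞ else D (r • e)
  have hk : Antitone k := by
    intro r s hrs
    by_cases hr : r ≤ 0
    · simp [k, hr]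
    · have hs : ¬ s ≤ 0 := by linarith
      simp only [k, hr, hs, if_false]
      refine hD _ _ ?_
      rw [norm_smul, norm_smul, he, Real.norm_of_nonneg (by linarith), Real.norm_of_nonneg (by linarith)]
      linarith
  have hkD : ∀ x : V, x ≠ 0 → k ‖x‖ = D x := by
    intro x hx
    have : ¬ ‖x‖ ≤ 0 := by simpa using hx
    simp only [k, this, if_false]
    exact le_antisymm (hD _ _ (by simp [norm_smul, he])) (hD _ _ (by simp [norm_smul, he]))
  refine ⟨k, hk, ?_⟩
  set ν := μ.restrict {0}ᶜ with hν
  have hac : ν ≪ volume := by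
    intro S hS
    rw [hν, Measure.restrict_apply' (measurableSet_singleton 0).compl]
    exact hμ.measure_eq_zero (measure_mono_null inter_subset_left hS) (by simp)
  have hsum : μ = μ.restrict {0} + ν := (Measure.restrict_add_restrict_compl (measurableSet_singleton 0)).symm
  conv_lhs => rw [hsum, Measure.restrict_singleton]
  congr 1
  rw [← Measure.withDensity_rnDeriv_eq ν volume hac]
  refine withDensity_congr_ae ?_
  have h0 : ∀ᵐ x : V, x ≠ 0 := by simp [ae_iff]
  filter_upwards [Besicovitch.ae_tendsto_rnDeriv ν volume, h0] with x hx hx0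
  rw [hkD x hx0, ← hx.limsup_eq]
  refine limsup_congr ?_
  have hpos : 0 < ‖x‖ := norm_pos_iff.2 hx0
  filter_upwards [Ioo_mem_nhdsGT hpos] with r hr
  congr 1
  rw [hν, Measure.restrict_apply measurableSet_closedBall, inter_eq_left.2]
  intro z hz hz0
  rw [mem_singleton_iff.1 hz0, Metric.mem_closedBall, dist_zero_left] at hz
  exact absurd hr.2 (not_lt.2 hz)

end Unimodal

/-! ### Exponents of isotropic unimodal Lévy measures -/

section Exponent

variable {V : Type*} [NormedAddCommGroup V] [InnerProductSpace ℝ V] [FiniteDimensional ℝ V]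
  [MeasurableSpace V] [BorelSpace V]

/-- The rotation invariant measure `k(‖x‖) dx` on `V`. -/
noncomputable def radialMeasure (V : Type*) [NormedAddCommGroup V] [InnerProductSpace ℝ V]
    [FiniteDimensional ℝ V] [MeasurableSpace V] [BorelSpace V] (k : ℝ → ℝ≥0∞) : Measure V :=
  volume.withDensity fun x => k ‖x‖

instance (k : ℝ → ℝ≥0∞) : SFinite (radialMeasure V k) := by
  unfold radialMeasure; infer_instance

/-- The exponent `∫ (1 - cos ⟨ξ, x⟩) k(‖x‖) dx`, with values in `[0, ∞]`. -/
noncomputable def exponent (k : ℝ → ℝ≥0∞) (ξ : V) : ℝ≥0∞ :=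
  ∫⁻ x, ENNReal.ofReal (1 - Real.cos (inner ℝ ξ x)) ∂(radialMeasure V k)

theorem measurable_comp_norm {k : ℝ → ℝ≥0∞} (hk : Measurable k) :
    Measurable fun x : V => k ‖x‖ := hk.comp measurable_norm

theorem radialMeasure_map_isometry {k : ℝ → ℝ≥0∞} (hk : Measurable k) (L : V ≃ₗᵢ[ℝ] V) :
    MeasurePreserving L (radialMeasure V k) (radialMeasure V k) := by
  refine ⟨L.continuous.measurable, ?_⟩
  ext S hS
  rw [Measure.map_apply L.continuous.measurable hS, radialMeasure, withDensity_apply _ hS,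
    withDensity_apply _ (L.continuous.measurable hS),
    ← L.measurePreserving.setLIntegral_comp_preimage hS (measurable_comp_norm hk)]
  simp

theorem lintegral_inner_eq {k : ℝ → ℝ≥0∞} (hk : Measurable k) {g : ℝ → ℝ≥0∞} (hg : Measurable g)
    {ξ η : V} (h : ‖ξ‖ = ‖η‖) :
    ∫⁻ x, g (inner ℝ ξ x) ∂(radialMeasure V k) = ∫⁻ x, g (inner ℝ η x) ∂(radialMeasure V k) := by
  let L : V ≃ₗᵢ[ℝ] V := (Submodule.span ℝ {ξ - η})ᗮ.reflection
  have hL : L ξ = η := Submodule.reflection_sub h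
  rw [← (radialMeasure_map_isometry hk L).lintegral_comp (f := fun x => g (inner ℝ η x))
    (by fun_prop)]
  simp_rw [← hL, L.inner_map_map]

theorem exponent_congr {k : ℝ → ℝ≥0∞} (hk : Measurable k) {ξ η : V} (h : ‖ξ‖ = ‖η‖) :
    exponent k ξ = exponent k η :=
  lintegral_inner_eq hk (g := fun s => ENNReal.ofReal (1 - Real.cos s)) (by fun_prop) h

theorem lintegral_radialMeasure {k : ℝ → ℝ≥0∞} (hk : Measurable k) {g : V → ℝ≥0∞}
    (hg : Measurable g) : ∫⁻ x, g x ∂(radialMeasure V k) = ∫⁻ x, k ‖x‖ * g x := by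
  rw [radialMeasure, lintegral_withDensity_eq_lintegral_mul _ (measurable_comp_norm hk) hg]
  rfl

/-- Since the profile is nonincreasing, shrinking the argument increases the exponent at most by
the Jacobian of the dilation. -/
theorem exponent_smul_le {k : ℝ → ℝ≥0∞} (hk : Antitone k) {u : ℝ} (hu0 : 0 < u) (hu1 : u ≤ 1)
    (ξ : V) : exponent k (u • ξ) ≤
      ENNReal.ofReal ((u ^ Module.finrank ℝ V)⁻¹) * exponent k ξ := by
  have hg : ∀ η : V, Measurable fun x : V => ENNReal.ofReal (1 - Real.cos (inner ℝ η x)) := by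
    intro η; fun_prop
  rw [exponent, exponent, lintegral_radialMeasure hk.measurable (hg _),
    lintegral_radialMeasure hk.measurable (hg _)]
  set G : V → ℝ≥0∞ := fun y => k ‖y‖ * ENNReal.ofReal (1 - Real.cos (inner ℝ ξ y)) with hG
  have hGm : Measurable G := (measurable_comp_norm hk.measurable).mul (hg ξ)
  calc ∫⁻ x, k ‖x‖ * ENNReal.ofReal (1 - Real.cos (inner ℝ (u • ξ) x))
      ≤ ∫⁻ x, G (u • x) := by
        refine lintegral_mono fun x => ?_
        simp only [hG, inner_smul_left, inner_smul_right, RCLike.conj_to_real]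
        gcongr
        refine hk ?_
        rw [norm_smul, Real.norm_of_nonneg hu0.le]
        exact mul_le_of_le_one_left (norm_nonneg _) hu1
    _ = ∫⁻ y, G y ∂(Measure.map (u • ·) (volume : Measure V)) :=
        (lintegral_map hGm (measurable_const_smul u)).symm
    _ = _ := by
        rw [Measure.map_addHaar_smul _ hu0.ne', lintegral_smul_measure, smul_eq_mul,
          abs_of_nonneg (by positivity)]

/-- The average over dilations is bounded below although `1 - cos θ` itself vanishes at multiples of
`2π`: for small `θ` by the quadratic lower bound, for large `θ` because the cosine integral is
`O(1 / |θ|)`. -/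
theorem min_one_sq_le_integral_one_sub_cos (θ : ℝ) :
    1 / 200 * min 1 (θ ^ 2) ≤ ∫ u in (1 / 4 : ℝ)..1, (1 - Real.cos (u * θ)) := by
  have hint : ∀ a b : ℝ, IntervalIntegrable (fun u => 1 - Real.cos (u * θ)) volume a b := fun a b =>
    (by fun_prop : Continuous fun u => 1 - Real.cos (u * θ)).intervalIntegrable _ _
  have hpi := Real.pi_gt_three
  have hpi4 := Real.pi_lt_d2
  by_cases h : |θ| ≤ Real.pi
  · have h1 : ∀ u ∈ Icc (1 / 4 : ℝ) 1, θ ^ 2 / 80 ≤ 1 - Real.cos (u * θ) := by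
      intro u hu
      have h2 : |u * θ| ≤ Real.pi := by
        rw [abs_mul, abs_of_nonneg (by linarith [hu.1])]
        exact (mul_le_of_le_one_left (abs_nonneg _) hu.2).trans h
      have h3 := Real.cos_le_one_sub_mul_cos_sq h2
      have h4 : θ ^ 2 / 16 ≤ (u * θ) ^ 2 := by
        rw [mul_pow]
        have : (1 / 16 : ℝ) ≤ u ^ 2 := by nlinarith [hu.1]
        nlinarith [sq_nonneg θ]
      have h5 : (1 / 5 : ℝ) ≤ 2 / Real.pi ^ 2 := by
        rw [div_le_div_iff₀ (by norm_num) (by positivity)]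
        nlinarith
      have h6 : 1 / 5 * (θ ^ 2 / 16) ≤ 2 / Real.pi ^ 2 * (u * θ) ^ 2 := by gcongr
      linarith
    have h2 := intervalIntegral.integral_mono_on (by norm_num : (1 / 4 : ℝ) ≤ 1)
      intervalIntegrable_const (hint _ _) h1
    rw [intervalIntegral.integral_const, smul_eq_mul] at h2
    have h3 : min 1 (θ ^ 2) ≤ θ ^ 2 := min_le_right _ _
    have := sq_nonneg θ
    linarith
  · push Not at h
    have hθ : θ ≠ 0 := by
      rintro rfl
      simp at h; linarith
    rw [intervalIntegral.integral_sub intervalIntegrable_const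
      ((by fun_prop : Continuous fun u => Real.cos (u * θ)).intervalIntegrable _ _),
      intervalIntegral.integral_const, intervalIntegral.integral_comp_mul_right _ hθ, integral_cos,
      smul_eq_mul, smul_eq_mul]
    have h1 : |θ⁻¹ * (Real.sin (1 * θ) - Real.sin (1 / 4 * θ))| ≤ 2 / 3 := by
      rw [abs_mul, abs_inv]
      have h2 : |Real.sin (1 * θ) - Real.sin (1 / 4 * θ)| ≤ 2 := by
        have := Real.abs_sin_le_one (1 * θ)
        have := Real.abs_sin_le_one (1 / 4 * θ)
        refine (abs_sub _ _).trans (by linarith)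
      have h3 : |θ|⁻¹ ≤ 3⁻¹ := by
        gcongr; linarith
      calc |θ|⁻¹ * |Real.sin (1 * θ) - Real.sin (1 / 4 * θ)| ≤ 3⁻¹ * 2 := by gcongr
        _ = 2 / 3 := by norm_num
    have h4 := le_abs_self (θ⁻¹ * (Real.sin (1 * θ) - Real.sin (1 / 4 * θ)))
    have h5 : min 1 (θ ^ 2) ≤ 1 := min_le_left _ _
    linarith

/-- For a nonincreasing profile the oscillation of the cosine can be averaged out: the exponent
dominates the integral of `1 ∧ ⟨ξ, x⟩²`. -/
theorem lintegral_min_one_sq_le {k : ℝ → ℝ≥0∞} (hk : Antitone k) (ξ : V) :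
    ∫⁻ x, ENNReal.ofReal (min 1 (inner ℝ ξ x ^ 2)) ∂(radialMeasure V k) ≤
      ENNReal.ofReal (200 * 4 ^ Module.finrank ℝ V) * exponent k ξ := by
  have h1 : ∫⁻ u in Ioc (1 / 4 : ℝ) 1, exponent k (u • ξ) ≤
      ENNReal.ofReal (4 ^ Module.finrank ℝ V) * exponent k ξ := by
    calc ∫⁻ u in Ioc (1 / 4 : ℝ) 1, exponent k (u • ξ)
        ≤ ∫⁻ _ in Ioc (1 / 4 : ℝ) 1, ENNReal.ofReal (4 ^ Module.finrank ℝ V) * exponent k ξ := by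
          refine setLIntegral_mono' measurableSet_Ioc fun u hu => ?_
          have hu0 : 0 < u := by linarith [hu.1]
          refine (exponent_smul_le hk hu0 hu.2 ξ).trans ?_
          gcongr
          rw [← inv_pow]
          gcongr
          rw [inv_le_comm₀ hu0 (by norm_num)]
          linarith [hu.1]
      _ ≤ _ := by
          rw [setLIntegral_const, Real.volume_Ioc]
          refine mul_le_of_le_one_right' ?_
          rw [ENNReal.ofReal_le_one]; norm_num
  have h2 : ∫⁻ u in Ioc (1 / 4 : ℝ) 1, exponent k (u • ξ) =
      ∫⁻ x, (∫⁻ u in Ioc (1 / 4 : ℝ) 1, ENNReal.ofReal (1 - Real.cos (u * inner ℝ ξ x)))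
        ∂(radialMeasure V k) := by
    simp only [exponent, inner_smul_left, RCLike.conj_to_real]
    refine lintegral_lintegral_swap (Measurable.aemeasurable ?_)
    unfold Function.uncurry
    fun_prop
  have h3 : ∀ θ : ℝ, ENNReal.ofReal (1 / 200) * ENNReal.ofReal (min 1 (θ ^ 2)) ≤
      ∫⁻ u in Ioc (1 / 4 : ℝ) 1, ENNReal.ofReal (1 - Real.cos (u * θ)) := by
    intro θ
    have hc : Continuous fun u => 1 - Real.cos (u * θ) := by fun_prop
    rw [← ofReal_integral_eq_lintegral_ofReal (hc.integrableOn_Ioc)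
      (ae_of_all _ fun u => sub_nonneg.2 (Real.cos_le_one _)), ← ENNReal.ofReal_mul (by norm_num),
      ← intervalIntegral.integral_of_le (by norm_num)]
    exact ENNReal.ofReal_le_ofReal (min_one_sq_le_integral_one_sub_cos θ)
  have h4 : ENNReal.ofReal (1 / 200) *
      ∫⁻ x, ENNReal.ofReal (min 1 (inner ℝ ξ x ^ 2)) ∂(radialMeasure V k) ≤
        ENNReal.ofReal (4 ^ Module.finrank ℝ V) * exponent k ξ := by
    rw [← lintegral_const_mul _ (by fun_prop)]
    exact ((lintegral_mono fun x => h3 _).trans h2.ge).trans h1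
  calc ∫⁻ x, ENNReal.ofReal (min 1 (inner ℝ ξ x ^ 2)) ∂(radialMeasure V k)
      = ENNReal.ofReal 200 * (ENNReal.ofReal (1 / 200) *
        ∫⁻ x, ENNReal.ofReal (min 1 (inner ℝ ξ x ^ 2)) ∂(radialMeasure V k)) := by
        rw [← mul_assoc, ← ENNReal.ofReal_mul (by norm_num)]; norm_num
    _ ≤ ENNReal.ofReal 200 * (ENNReal.ofReal (4 ^ Module.finrank ℝ V) * exponent k ξ) := by gcongr
    _ = _ := by rw [← mul_assoc, ← ENNReal.ofReal_mul (by norm_num)]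

theorem one_sub_cos_le_two_mul_min (θ : ℝ) : 1 - Real.cos θ ≤ 2 * min 1 (θ ^ 2) := by
  have h1 := Real.one_sub_sq_div_two_le_cos (x := θ)
  have h2 := Real.neg_one_le_cos θ
  have h3 := sq_nonneg θ
  rcases min_cases 1 (θ ^ 2) with h | h <;> rw [h.1] <;> linarith

/-- The exponent of a nonincreasing profile is almost increasing in the norm of its argument. -/
theorem exponent_le_of_norm_le {k : ℝ → ℝ≥0∞} (hk : Antitone k) {ξ η : V} (h : ‖η‖ ≤ ‖ξ‖) :
    exponent k η ≤ ENNReal.ofReal (400 * 4 ^ Module.finrank ℝ V) * exponent k ξ := by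
  by_cases hξ : ξ = 0
  · have : η = 0 := by simpa [hξ] using h
    rw [this, hξ]
    simp [exponent]
  have hn : 0 < ‖ξ‖ := norm_pos_iff.2 hξ
  set s := ‖η‖ / ‖ξ‖ with hs
  have hs0 : 0 ≤ s := by positivity
  have hs1 : s ≤ 1 := (div_le_one hn).2 h
  have hnorm : ‖η‖ = ‖s • ξ‖ := by
    rw [norm_smul, Real.norm_of_nonneg hs0, hs]; field_simp
  rw [exponent_congr hk.measurable hnorm]
  calc exponent k (s • ξ) ≤ ∫⁻ x, ENNReal.ofReal 2 * ENNReal.ofReal (min 1 (inner ℝ ξ x ^ 2))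
        ∂(radialMeasure V k) := by
        refine lintegral_mono fun x => ?_
        dsimp only
        rw [← ENNReal.ofReal_mul (by norm_num), inner_smul_left, RCLike.conj_to_real]
        refine ENNReal.ofReal_le_ofReal ((one_sub_cos_le_two_mul_min _).trans ?_)
        refine mul_le_mul_of_nonneg_left (min_le_min_left _ ?_) (by norm_num)
        rw [mul_pow]
        exact mul_le_of_le_one_left (sq_nonneg _) (pow_le_one₀ hs0 hs1)
    _ = ENNReal.ofReal 2 *
        ∫⁻ x, ENNReal.ofReal (min 1 (inner ℝ ξ x ^ 2)) ∂(radialMeasure V k) :=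
        lintegral_const_mul _ (by fun_prop)
    _ ≤ ENNReal.ofReal 2 * (ENNReal.ofReal (200 * 4 ^ Module.finrank ℝ V) * exponent k ξ) := by
        gcongr
        exact lintegral_min_one_sq_le hk ξ
    _ = _ := by
        rw [← mul_assoc, ← ENNReal.ofReal_mul (by norm_num)]
        congr 2; ring

/-- Doubling the argument increases the exponent at most four times. -/
theorem exponent_two_smul_le (k : ℝ → ℝ≥0∞) (ξ : V) :
    exponent k ((2 : ℝ) • ξ) ≤ 4 * exponent k ξ := by
  rw [exponent, exponent, ← lintegral_const_mul _ (by fun_prop)]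
  refine lintegral_mono fun x => ?_
  rw [show (4 : ℝ≥0∞) = ENNReal.ofReal 4 by norm_num]
  dsimp only
  rw [← ENNReal.ofReal_mul (by norm_num), inner_smul_left, RCLike.conj_to_real, Real.cos_two_mul]
  refine ENNReal.ofReal_le_ofReal ?_
  nlinarith [sq_nonneg (1 - Real.cos (inner ℝ ξ x))]

/-- The profile of an isotropic unimodal infinite Lévy measure on `V`. -/
structure IsLevyProfile (V : Type*) [NormedAddCommGroup V] [InnerProductSpace ℝ V]
    [FiniteDimensional ℝ V] [MeasurableSpace V] [BorelSpace V] (k : ℝ → ℝ≥0∞) : Prop where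
  antitone : Antitone k
  moment : ∫⁻ x, ENNReal.ofReal (min 1 (‖x‖ ^ 2)) ∂(radialMeasure V k) < ∞
  infinite : radialMeasure V k univ = ∞

theorem one_sub_cos_inner_le (ξ x : V) :
    1 - Real.cos (inner ℝ ξ x) ≤ 2 * max 1 (‖ξ‖ ^ 2) * min 1 (‖x‖ ^ 2) := by
  refine (one_sub_cos_le_two_mul_min _).trans ?_
  rw [mul_assoc]
  gcongr
  have h : inner ℝ ξ x ^ 2 ≤ ‖ξ‖ ^ 2 * ‖x‖ ^ 2 := by
    rw [← mul_pow, ← sq_abs]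
    gcongr
    exact abs_real_inner_le_norm ξ x
  have h1 : 1 ≤ max 1 (‖ξ‖ ^ 2) := le_max_left _ _
  have h2 : ‖ξ‖ ^ 2 ≤ max 1 (‖ξ‖ ^ 2) := le_max_right _ _
  rcases min_cases 1 (‖x‖ ^ 2) with hc | hc <;> rw [hc.1]
  · rw [mul_one]; exact (min_le_left _ _).trans h1
  · exact (min_le_right _ _).trans (h.trans (by gcongr))

theorem IsLevyProfile.integrable_min {k : ℝ → ℝ≥0∞} (hk : IsLevyProfile V k) :
    Integrable (fun x : V => min 1 (‖x‖ ^ 2)) (radialMeasure V k) := by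
  refine ⟨by fun_prop, ?_⟩
  rw [hasFiniteIntegral_iff_ofReal (ae_of_all _ fun x => by positivity)]
  exact hk.moment

theorem IsLevyProfile.integrable {k : ℝ → ℝ≥0∞} (hk : IsLevyProfile V k) (ξ : V) :
    Integrable (fun x : V => 1 - Real.cos (inner ℝ ξ x)) (radialMeasure V k) := by
  refine (hk.integrable_min.const_mul (2 * max 1 (‖ξ‖ ^ 2))).mono' (by fun_prop)
    (ae_of_all _ fun x => ?_)
  rw [Real.norm_of_nonneg (sub_nonneg.2 (Real.cos_le_one _))]
  exact one_sub_cos_inner_le ξ x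

theorem IsLevyProfile.exponent_lt_top {k : ℝ → ℝ≥0∞} (hk : IsLevyProfile V k) (ξ : V) :
    exponent k ξ < ∞ := by
  have := (hk.integrable ξ).2
  rwa [hasFiniteIntegral_iff_ofReal (ae_of_all _ fun x => sub_nonneg.2 (Real.cos_le_one _))] at this

theorem integral_one_sub_cos_eq (k : ℝ → ℝ≥0∞) (ξ : V) :
    ∫ x, (1 - Real.cos (inner ℝ ξ x)) ∂(radialMeasure V k) = (exponent k ξ).toReal :=
  integral_eq_lintegral_of_nonneg_ae (ae_of_all _ fun x => sub_nonneg.2 (Real.cos_le_one _))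
    (by fun_prop)

theorem IsLevyProfile.continuous_exponent {k : ℝ → ℝ≥0∞} (hk : IsLevyProfile V k) :
    Continuous fun ξ : V => (exponent k ξ).toReal := by
  simp_rw [← integral_one_sub_cos_eq]
  refine continuous_iff_continuousAt.2 fun ξ₀ => ?_
  refine continuousAt_of_dominated
    (bound := fun x => 2 * max 1 ((‖ξ₀‖ + 1) ^ 2) * min 1 (‖x‖ ^ 2)) ?_ ?_
    (hk.integrable_min.const_mul _) ?_
  · exact Eventually.of_forall fun ξ => by fun_prop
  · filter_upwards [Metric.ball_mem_nhds ξ₀ one_pos] with ξ hξ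
    refine ae_of_all _ fun x => ?_
    rw [Real.norm_of_nonneg (sub_nonneg.2 (Real.cos_le_one _))]
    refine (one_sub_cos_inner_le ξ x).trans ?_
    have : ‖ξ‖ ≤ ‖ξ₀‖ + 1 := by
      have h1 := norm_le_norm_add_norm_sub' ξ ξ₀
      rw [Metric.mem_ball, dist_eq_norm] at hξ
      linarith
    gcongr
  · exact ae_of_all _ fun x => by fun_prop

theorem ae_inner_ne_zero (k : ℝ → ℝ≥0∞) {ξ : V} (hξ : ξ ≠ 0) :
    ∀ᵐ x ∂(radialMeasure V k), inner ℝ ξ x ≠ 0 := by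
  refine (withDensity_absolutelyContinuous _ _ : radialMeasure V k ≪ volume).ae_le ?_
  have h := Measure.addHaar_submodule (volume : Measure V) (LinearMap.ker (innerₗ V ξ)) (by
    intro h
    have : ξ ∈ LinearMap.ker (innerₗ V ξ) := by rw [h]; trivial
    simp [hξ] at this)
  change volume _ = 0
  convert h using 2
  ext x
  simp

theorem IsLevyProfile.exponent_pos {k : ℝ → ℝ≥0∞} (hk : IsLevyProfile V k) {ξ : V} (hξ : ξ ≠ 0) :
    0 < exponent k ξ := by
  rw [pos_iff_ne_zero]
  intro h0
  have h := lintegral_min_one_sq_le hk.antitone ξ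
  rw [h0, mul_zero, nonpos_iff_eq_zero, lintegral_eq_zero_iff (by fun_prop)] at h
  have : radialMeasure V k univ = 0 := by
    rw [Measure.measure_univ_eq_zero, ← ae_eq_bot, ← empty_mem_iff_bot]
    filter_upwards [h, ae_inner_ne_zero k hξ] with x hx hx0
    have : 0 < min 1 (inner ℝ ξ x ^ 2) := by positivity
    simp only [Pi.zero_apply, ENNReal.ofReal_eq_zero] at hx
    linarith
  rw [hk.infinite] at this
  exact ENNReal.top_ne_zero this

/-- The exponent of an infinite unimodal Lévy measure is unbounded. -/
theorem IsLevyProfile.tendsto_exponent {k : ℝ → ℝ≥0∞} (hk : IsLevyProfile V k) {ξ : V}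
    (hξ : ξ ≠ 0) : Tendsto (fun n : ℕ => exponent k ((n : ℝ) • ξ)) atTop (𝓝 ∞) := by
  have h1 : Tendsto (fun n : ℕ => ∫⁻ x, ENNReal.ofReal (min 1 (inner ℝ ((n : ℝ) • ξ) x ^ 2))
      ∂(radialMeasure V k)) atTop (𝓝 (∫⁻ _, 1 ∂(radialMeasure V k))) := by
    refine lintegral_tendsto_of_tendsto_of_monotone (fun n => by fun_prop) ?_ ?_
    · refine ae_of_all _ fun x n m hnm => ?_
      refine ENNReal.ofReal_le_ofReal ?_
      simp only [inner_smul_left, RCLike.conj_to_real, mul_pow]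
      gcongr
    · filter_upwards [ae_inner_ne_zero k hξ] with x hx
      refine tendsto_const_nhds.congr' ?_
      obtain ⟨N, hN⟩ := exists_nat_ge (1 / |inner ℝ ξ x|)
      filter_upwards [eventually_ge_atTop N] with n hn
      have hpos : 0 < |inner ℝ ξ x| := abs_pos.2 hx
      have : (1 : ℝ) ≤ inner ℝ ((n : ℝ) • ξ) x ^ 2 := by
        rw [inner_smul_left, RCLike.conj_to_real, ← sq_abs, abs_mul, Nat.abs_cast]
        refine one_le_pow₀ ?_
        have : (N : ℝ) ≤ n := by exact_mod_cast hn
        rw [div_le_iff₀ hpos] at hN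
        exact hN.trans (by gcongr)
      rw [min_eq_left this, ENNReal.ofReal_one]
  rw [lintegral_one, hk.infinite] at h1
  have h2 : Tendsto (fun n : ℕ => ENNReal.ofReal (200 * 4 ^ Module.finrank ℝ V) *
      exponent k ((n : ℝ) • ξ)) atTop (𝓝 ∞) :=
    tendsto_of_tendsto_of_tendsto_of_le_of_le h1 tendsto_const_nhds
      (fun n => lintegral_min_one_sq_le hk.antitone _) fun n => le_top
  set c := ENNReal.ofReal (200 * 4 ^ Module.finrank ℝ V)
  have hc0 : c ≠ 0 := by simp [c]
  have hct : c ≠ ∞ := ENNReal.ofReal_ne_top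
  have h3 := ENNReal.Tendsto.const_mul (a := c⁻¹) h2 (Or.inr (ENNReal.inv_ne_top.2 hc0))
  rw [ENNReal.mul_top (ENNReal.inv_ne_zero.2 hct)] at h3
  refine h3.congr fun n => ?_
  rw [← mul_assoc, ENNReal.inv_mul_cancel hc0 hct, one_mul]

end Exponent

/-! ### Isotropic unimodal infinitely divisible laws and their densities -/

section Law

variable {V : Type*} [NormedAddCommGroup V] [InnerProductSpace ℝ V] [FiniteDimensional ℝ V]
  [MeasurableSpace V] [BorelSpace V]

theorem integrable_charFun_integrand (μ : Measure V) [IsFiniteMeasure μ] (ξ : V) :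
    Integrable (fun x : V => Complex.exp (inner ℝ x ξ * Complex.I)) μ := by
  refine (integrable_const (1 : ℝ)).mono' (by fun_prop) (ae_of_all _ fun x => ?_)
  rw [Complex.norm_exp_ofReal_mul_I]

theorem charFun_add_measure (μ ν : Measure V) [IsFiniteMeasure μ] [IsFiniteMeasure ν] (ξ : V) :
    charFun (μ + ν) ξ = charFun μ ξ + charFun ν ξ := by
  simp only [charFun_apply]
  exact integral_add_measure (integrable_charFun_integrand μ ξ) (integrable_charFun_integrand ν ξ)

theorem charFun_smul_measure (c : ℝ≥0∞) (μ : Measure V) (ξ : V) :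
    charFun (c • μ) ξ = c.toReal * charFun μ ξ := by
  simp only [charFun_apply]
  rw [integral_smul_measure, Complex.real_smul]

/-- The characteristic function of a finite rotation invariant measure is real and determined by
the exponent of its profile. -/
theorem charFun_radialMeasure {k : ℝ → ℝ≥0∞} (hk : Measurable k)
    [IsFiniteMeasure (radialMeasure V k)] (ξ : V) :
    charFun (radialMeasure V k) ξ =
      (((radialMeasure V k).real univ - (exponent k ξ).toReal : ℝ) : ℂ) := by
  have hneg : charFun (radialMeasure V k) (-ξ) = charFun (radialMeasure V k) ξ := by
    have hmp := radialMeasure_map_isometry hk (LinearIsometryEquiv.neg ℝ (E := V))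
    simp only [charFun_apply]
    rw [← hmp.integral_comp (LinearIsometryEquiv.neg ℝ (E := V)).toHomeomorph.measurableEmbedding]
    simp
  rw [charFun_neg] at hneg
  have hre := Complex.conj_eq_iff_re.1 hneg
  rw [← hre]
  congr 1
  have h1 : (charFun (radialMeasure V k) ξ).re =
      ∫ x, Real.cos (inner ℝ ξ x) ∂(radialMeasure V k) := by
    rw [charFun_apply, ← Complex.reCLM_apply, ← Complex.reCLM.integral_comp_comm
      (integrable_charFun_integrand _ ξ)]
    refine integral_congr_ae (ae_of_all _ fun x => ?_)
    simp only [Complex.reCLM_apply, Complex.exp_ofReal_mul_I_re, real_inner_comm]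
  have hint : Integrable (fun x : V => Real.cos (inner ℝ ξ x)) (radialMeasure V k) :=
    (integrable_const (1 : ℝ)).mono' (by fun_prop) (ae_of_all _ fun x => Real.abs_cos_le_one _)
  rw [h1, ← integral_one_sub_cos_eq, integral_sub (integrable_const _) hint]
  simp

theorem exists_unimodal_charFun_pow {μ : Measure V} [IsProbabilityMeasure μ] (hμ : Unimodal μ)
    (m : ℕ) : ∃ ρ : Measure V, IsProbabilityMeasure ρ ∧ Unimodal ρ ∧
      ∀ ξ, charFun ρ ξ = charFun μ ξ ^ m := by
  induction m with
  | zero =>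
    exact ⟨Measure.dirac 0, inferInstance, unimodal_dirac_zero, fun ξ => by simp⟩
  | succ m ih =>
    obtain ⟨ρ, hρ, hρu, hρc⟩ := ih
    refine ⟨ρ.conv μ, inferInstance, hρu.conv hμ, fun ξ => ?_⟩
    rw [charFun_conv, hρc, pow_succ]

/-- The compound Poisson law with a finite unimodal jump measure is unimodal: it is the limit of
convolution powers of `(1 - tm/n) δ₀ + (t/n) ρ`, where `m` is the mass of `ρ`. -/
theorem exists_unimodal_compoundPoisson {ρ : Measure V} [IsFiniteMeasure ρ] (hρ : Unimodal ρ)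
    {t : ℝ} (ht : 0 ≤ t) : ∃ μ : Measure V, IsProbabilityMeasure μ ∧ Unimodal μ ∧
      ∀ ξ, charFun μ ξ = Complex.exp (t * (charFun ρ ξ - ρ.real univ)) := by
  set m := ρ.real univ with hm
  have hm0 : 0 ≤ m := measureReal_nonneg
  set N := ⌈t * m⌉₊ + 1 with hN
  have hstep : ∀ n : ℕ, ∃ μ : Measure V, IsProbabilityMeasure μ ∧ Unimodal μ ∧
      ∀ ξ, charFun μ ξ = (1 + t * (charFun ρ ξ - m) / ((n + N : ℕ) : ℂ)) ^ (n + N) := by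
    intro n
    set c : ℝ := ((n + N : ℕ) : ℝ) with hc
    have hc0 : 0 < c := by rw [hc, hN]; positivity
    have htm : t * m ≤ c := by
      refine (Nat.le_ceil _).trans ?_
      rw [hc]
      exact_mod_cast (by omega : ⌈t * m⌉₊ ≤ n + N)
    have h1 : 0 ≤ 1 - t * m / c := by
      rw [sub_nonneg, div_le_one hc0]; exact htm
    have htc : 0 ≤ t / c := by positivity
    let μ : Measure V := ENNReal.ofReal (1 - t * m / c) • Measure.dirac 0 + ENNReal.ofReal (t / c) • ρ
    have hμp : IsProbabilityMeasure μ := by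
      refine ⟨?_⟩
      simp only [μ, Measure.add_apply, Measure.smul_apply, measure_univ, smul_eq_mul, mul_one]
      rw [← ofReal_measureReal (μ := ρ) (s := univ), ← hm, ← ENNReal.ofReal_mul htc,
        ← ENNReal.ofReal_add h1 (by positivity)]
      rw [ENNReal.ofReal_eq_one]
      ring
    have hμu : Unimodal μ := (unimodal_dirac_zero.smul _).add (hρ.smul _)
    have hμc : ∀ ξ, charFun μ ξ = 1 + t * (charFun ρ ξ - m) / (c : ℂ) := by
      intro ξ
      have : IsFiniteMeasure (ENNReal.ofReal (t / c) • ρ) := ρ.smul_finite ENNReal.ofReal_ne_top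
      have : IsFiniteMeasure (ENNReal.ofReal (1 - t * m / c) • Measure.dirac (0 : V)) :=
        Measure.smul_finite _ ENNReal.ofReal_ne_top
      rw [charFun_add_measure, charFun_smul_measure, charFun_smul_measure, ENNReal.toReal_ofReal h1,
        ENNReal.toReal_ofReal htc]
      simp only [charFun_dirac, inner_zero_left, Complex.ofReal_zero, zero_mul, Complex.exp_zero]
      push_cast
      ring
    obtain ⟨σ, h1, h2, h3⟩ := exists_unimodal_charFun_pow hμu (n + N)
    refine ⟨σ, h1, h2, fun ξ => ?_⟩
    rw [h3, hμc, hc]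
    push_cast
    rfl
  choose μs hp hu hc using hstep
  refine exists_unimodal_of_tendsto_charFun hp hu (Continuous.continuousAt (by fun_prop))
    fun ξ => ?_
  have h := (Complex.tendsto_one_add_div_pow_exp (t * (charFun ρ ξ - m))).comp
    (tendsto_add_atTop_nat N)
  refine h.congr fun n => ?_
  rw [hc]
  rfl

theorem exponent_min_tendsto {k : ℝ → ℝ≥0∞} (hk : Antitone k) (ξ : V) :
    Tendsto (fun j : ℕ => exponent (fun r => min (k r) j) ξ) atTop (𝓝 (exponent k ξ)) := by
  have hm : ∀ j : ℕ, Antitone fun r => min (k r) (j : ℝ≥0∞) :=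
    fun j r s h => min_le_min_right _ (hk h)
  simp only [exponent]
  rw [lintegral_radialMeasure hk.measurable (by fun_prop)]
  simp_rw [fun j : ℕ => lintegral_radialMeasure (V := V) (hm j).measurable
    (g := fun x => ENNReal.ofReal (1 - Real.cos (inner ℝ ξ x))) (by fun_prop)]
  refine lintegral_tendsto_of_tendsto_of_monotone (fun j => ?_) ?_ ?_
  · exact ((measurable_comp_norm (hm j).measurable).mul (by fun_prop)).aemeasurable
  · refine ae_of_all _ fun x i j hij => ?_
    dsimp only
    gcongr
  · refine ae_of_all _ fun x => ?_
    refine ENNReal.Tendsto.mul_const ?_ (Or.inr ENNReal.ofReal_ne_top)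
    have h := (tendsto_const_nhds (x := k ‖x‖)).min ENNReal.tendsto_nat_nhds_top
    rwa [min_eq_left le_top] at h

theorem unimodal_radialMeasure {k : ℝ → ℝ≥0∞} (hk : Antitone k) : Unimodal (radialMeasure V k) :=
  unimodal_withDensity (measurable_comp_norm hk.measurable) fun _ _ h => hk h

theorem IsLevyProfile.isFiniteMeasure_min {k : ℝ → ℝ≥0∞} (hk : IsLevyProfile V k) (j : ℕ) :
    IsFiniteMeasure (radialMeasure V fun r => min (k r) j) := by
  refine ⟨?_⟩
  have hm : Antitone fun r => min (k r) (j : ℝ≥0∞) := fun r s h => min_le_min_right _ (hk.antitone h)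
  rw [← lintegral_one, lintegral_radialMeasure hm.measurable measurable_const]
  have hmom := hk.moment
  rw [lintegral_radialMeasure hk.antitone.measurable (by fun_prop)] at hmom
  calc ∫⁻ x : V, min (k ‖x‖) j * 1
      ≤ ∫⁻ x : V, ((Metric.ball (0 : V) 1).indicator (fun _ => (j : ℝ≥0∞)) x +
        k ‖x‖ * ENNReal.ofReal (min 1 (‖x‖ ^ 2))) := by
        refine lintegral_mono fun x => ?_
        dsimp only
        rw [mul_one]
        by_cases hx : x ∈ Metric.ball (0 : V) 1
        · rw [indicator_of_mem hx]
          exact (min_le_right _ _).trans le_self_add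
        · rw [indicator_of_notMem hx, zero_add]
          rw [mem_ball_zero_iff, not_lt] at hx
          rw [min_eq_left (one_le_pow₀ hx), ENNReal.ofReal_one, mul_one]
          exact min_le_left _ _
    _ = (∫⁻ x : V, (Metric.ball (0 : V) 1).indicator (fun _ => (j : ℝ≥0∞)) x) +
        ∫⁻ x : V, k ‖x‖ * ENNReal.ofReal (min 1 (‖x‖ ^ 2)) :=
        lintegral_add_left (measurable_const.indicator measurableSet_ball) _
    _ < ∞ := by
        rw [lintegral_indicator measurableSet_ball, setLIntegral_const]
        exact ENNReal.add_lt_top.2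
          ⟨ENNReal.mul_lt_top (ENNReal.natCast_lt_top j) measure_ball_lt_top, hmom⟩

/-- Truncating the profile gives compound Poisson laws, whose limit is the required law. -/
theorem IsLevyProfile.exists_unimodal_law {k : ℝ → ℝ≥0∞} (hk : IsLevyProfile V k) {t : ℝ}
    (ht : 0 ≤ t) : ∃ μ : Measure V, IsProbabilityMeasure μ ∧ Unimodal μ ∧
      ∀ ξ, charFun μ ξ = Complex.exp ((-(t * (exponent k ξ).toReal) : ℝ) : ℂ) := by
  have hm : ∀ j : ℕ, Antitone fun r => min (k r) (j : ℝ≥0∞) :=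
    fun j r s h => min_le_min_right _ (hk.antitone h)
  have hstep : ∀ j : ℕ, ∃ μ : Measure V, IsProbabilityMeasure μ ∧ Unimodal μ ∧ ∀ ξ, charFun μ ξ =
      Complex.exp ((-(t * (exponent (fun r => min (k r) j) ξ).toReal) : ℝ) : ℂ) := by
    intro j
    have := hk.isFiniteMeasure_min j
    obtain ⟨μ, h1, h2, h3⟩ :=
      exists_unimodal_compoundPoisson (unimodal_radialMeasure (V := V) (hm j)) ht
    refine ⟨μ, h1, h2, fun ξ => ?_⟩
    rw [h3, charFun_radialMeasure (hm j).measurable]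
    push_cast
    congr 1
    ring
  choose μs hp hu hc using hstep
  refine exists_unimodal_of_tendsto_charFun hp hu ?_ fun ξ => ?_
  · have := hk.continuous_exponent
    exact Continuous.continuousAt (by fun_prop)
  · simp_rw [hc]
    refine (Complex.continuous_exp.tendsto _).comp ((Complex.continuous_ofReal.tendsto _).comp ?_)
    refine (Tendsto.const_mul t ?_).neg
    exact (ENNReal.tendsto_toReal (hk.exponent_lt_top ξ).ne).comp
      (exponent_min_tendsto hk.antitone ξ)

theorem fourier_eq_charFun {q : ℝ → ℝ≥0∞} (hq : Measurable q)
    (hfin : ∀ᵐ x : V, q ‖x‖ < ∞) (w : V) :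
    (∫ v : V, Real.fourierChar (-inner ℝ v w) • ((q ‖v‖).toReal : ℂ)) =
      charFun (radialMeasure V q) (-((2 * Real.pi) • w)) := by
  rw [charFun_apply, radialMeasure, integral_withDensity_eq_integral_toReal_smul
    (measurable_comp_norm hq) hfin]
  refine integral_congr_ae (ae_of_all _ fun x => ?_)
  simp only [Circle.smul_def, Real.fourierChar_apply, inner_neg_right, inner_smul_right,
    Complex.real_smul, smul_eq_mul]
  rw [mul_comm]
  congr 3
  push_cast
  ring

theorem ae_lt_top_of_isFiniteMeasure {q : ℝ → ℝ≥0∞} (hq : Measurable q)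
    [IsFiniteMeasure (radialMeasure V q)] : ∀ᵐ x : V, q ‖x‖ < ∞ := by
  refine ae_lt_top (measurable_comp_norm hq) ?_
  have := measure_ne_top (radialMeasure V q) univ
  rwa [radialMeasure, withDensity_apply _ MeasurableSet.univ, setLIntegral_univ] at this

/-- The infinitely divisible law with an infinite isotropic unimodal Lévy measure has a radially
nonincreasing density. It has no atom because its characteristic function vanishes at infinity. -/
theorem IsLevyProfile.exists_density [Nontrivial V] {k : ℝ → ℝ≥0∞} (hk : IsLevyProfile V k) {t : ℝ}
    (ht : 0 < t) : ∃ q : ℝ → ℝ≥0∞, Antitone q ∧ IsProbabilityMeasure (radialMeasure V q) ∧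
      ∀ ξ : V, charFun (radialMeasure V q) ξ =
        Complex.exp ((-(t * (exponent k ξ).toReal) : ℝ) : ℂ) := by
  obtain ⟨μ, hp, hu, hc⟩ := hk.exists_unimodal_law ht.le
  obtain ⟨q, hq, hμ⟩ := hu.exists_density
  obtain ⟨e, he⟩ := exists_norm_eq V (zero_le_one (α := ℝ))
  have he0 : e ≠ 0 := by
    rintro rfl
    simp at he
  have hle : radialMeasure V q ≤ μ := by
    conv_rhs => rw [hμ]
    exact Measure.le_add_left le_rfl
  have hfin : IsFiniteMeasure (radialMeasure V q) := isFiniteMeasure_of_le μ hle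
  have hfin2 : IsFiniteMeasure (μ {0} • Measure.dirac (0 : V)) :=
    Measure.smul_finite _ (measure_ne_top _ _)
  have hcf : ∀ ξ, charFun μ ξ = (μ {0}).toReal + charFun (radialMeasure V q) ξ := by
    intro ξ
    conv_lhs => rw [hμ]
    rw [← radialMeasure, charFun_add_measure, charFun_smul_measure]
    simp
  have hRL : Tendsto (fun n : ℕ => charFun (radialMeasure V q) ((n : ℝ) • e)) atTop (𝓝 0) := by
    have h := tendsto_integral_exp_inner_smul_cocompact (V := V) fun v => ((q ‖v‖).toReal : ℂ)
    have h2 : Tendsto (fun n : ℕ => (-((2 * Real.pi)⁻¹ * (n : ℝ))) • e) atTop (cocompact V) := by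
      rw [← Metric.cobounded_eq_cocompact, ← tendsto_norm_atTop_iff_cobounded]
      have h3 : ∀ n : ℕ, ‖(-((2 * Real.pi)⁻¹ * (n : ℝ))) • e‖ = (2 * Real.pi)⁻¹ * (n : ℝ) := by
        intro n
        rw [norm_smul, he, mul_one, norm_neg, Real.norm_of_nonneg (by positivity)]
      simp_rw [h3]
      exact tendsto_natCast_atTop_atTop.const_mul_atTop (by positivity)
    refine (h.comp h2).congr fun n => ?_
    simp only [Function.comp]
    rw [fourier_eq_charFun hq.measurable (ae_lt_top_of_isFiniteMeasure hq.measurable)]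
    congr 1
    rw [smul_smul, ← neg_smul]
    congr 1
    field_simp
  have h0 : Tendsto (fun n : ℕ => charFun μ ((n : ℝ) • e)) atTop (𝓝 0) := by
    simp_rw [hc]
    rw [tendsto_zero_iff_norm_tendsto_zero]
    simp_rw [Complex.norm_exp_ofReal]
    refine Real.tendsto_exp_neg_atTop_nhds_zero.comp (Tendsto.const_mul_atTop ht ?_)
    rw [← ENNReal.tendsto_ofReal_nhds_top]
    refine (hk.tendsto_exponent he0).congr fun n => ?_
    rw [ENNReal.ofReal_toReal (hk.exponent_lt_top _).ne]
  have hatom : μ {0} = 0 := by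
    have h1 := hRL.const_add ((μ {0}).toReal : ℂ)
    simp_rw [← hcf] at h1
    have h2 := tendsto_nhds_unique h1 h0
    rw [add_zero, Complex.ofReal_eq_zero, ENNReal.toReal_eq_zero_iff] at h2
    exact h2.resolve_right (measure_ne_top _ _)
  rw [hatom, zero_smul, zero_add] at hμ
  change μ = radialMeasure V q at hμ
  exact ⟨q, hq, hμ ▸ hp, hμ ▸ hc⟩

theorem mul_volume_ball_le {q : ℝ → ℝ≥0∞} (hq : Antitone q) (r : ℝ) :
    q r * volume (Metric.ball (0 : V) r) ≤ radialMeasure V q (Metric.ball 0 r) := by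
  rw [radialMeasure, withDensity_apply _ measurableSet_ball, ← setLIntegral_const]
  refine setLIntegral_mono' measurableSet_ball fun x hx => hq ?_
  rw [mem_ball_zero_iff] at hx
  exact hx.le

theorem lt_top_of_isFiniteMeasure {q : ℝ → ℝ≥0∞} (hq : Antitone q)
    [IsFiniteMeasure (radialMeasure V q)] {r : ℝ} (hr : 0 < r) : q r < ∞ := by
  have h := (mul_volume_ball_le (V := V) hq r).trans_lt (measure_lt_top _ _)
  by_contra hcon
  rw [not_lt, top_le_iff] at hcon
  rw [hcon, ENNReal.top_mul (Metric.measure_ball_pos volume _ hr).ne'] at h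
  exact lt_irrefl _ h

/-- A monotone radial profile which agrees almost everywhere with a function `h` continuous at `x₀`
is continuous at `‖x₀‖`, with value `h x₀`. -/
theorem tendsto_of_ae_eq {q : ℝ → ℝ≥0∞} (hq : Antitone q) {h : V → ℝ≥0∞}
    (hqh : ∀ᵐ x : V, q ‖x‖ = h x) {x₀ : V} (hx₀ : x₀ ≠ 0) (hh : ContinuousAt h x₀) :
    Tendsto q (𝓝 ‖x₀‖) (𝓝 (h x₀)) := by
  have hn : 0 < ‖x₀‖ := norm_pos_iff.2 hx₀
  have key : ∀ U : Set V, IsOpen U → U.Nonempty → ∃ x ∈ U, q ‖x‖ = h x := by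
    intro U hU hne
    have := hU.measure_pos volume hne
    by_contra hcon
    push Not at hcon
    exact this.ne' (measure_mono_null (fun x hx => hcon x hx) (ae_iff.1 hqh))
  have hscale : ∀ s : ℝ, 0 ≤ s → ‖(s / ‖x₀‖) • x₀‖ = s ∧ ‖(s / ‖x₀‖) • x₀ - x₀‖ = |s - ‖x₀‖| := by
    intro s hs
    constructor
    · rw [norm_smul, Real.norm_of_nonneg (by positivity)]; field_simp
    · have : (s / ‖x₀‖) • x₀ - x₀ = ((s - ‖x₀‖) / ‖x₀‖) • x₀ := by
        rw [sub_div, div_self hn.ne', sub_smul, one_smul]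
      rw [this, norm_smul, Real.norm_eq_abs, abs_div, abs_norm]; field_simp
  have hbelow : ∀ a < h x₀, ∀ᶠ s in 𝓝 ‖x₀‖, a < q s := by
    intro a ha
    obtain ⟨δ, hδ, hball⟩ := Metric.eventually_nhds_iff_ball.1 (hh.eventually (lt_mem_nhds ha))
    filter_upwards [Iio_mem_nhds (show ‖x₀‖ < ‖x₀‖ + δ / 2 by linarith)] with s hs
    obtain ⟨x, hx, hqx⟩ := key (Metric.ball x₀ δ ∩ {x | s < ‖x‖})
      (Metric.isOpen_ball.inter (isOpen_lt continuous_const continuous_norm))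
      ⟨((‖x₀‖ + δ / 2) / ‖x₀‖) • x₀, by
        rw [Metric.mem_ball, dist_eq_norm, (hscale _ (by positivity)).2, add_sub_cancel_left,
          abs_of_pos (by positivity)]
        linarith, by
        rw [mem_ofPred_eq, (hscale _ (by positivity)).1]; exact hs⟩
    exact (hball x hx.1).trans_le (hqx ▸ hq hx.2.le)
  have habove : ∀ b > h x₀, ∀ᶠ s in 𝓝 ‖x₀‖, q s < b := by
    intro b hb
    obtain ⟨δ', hδ', hball'⟩ := Metric.eventually_nhds_iff_ball.1 (hh.eventually (gt_mem_nhds hb))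
    set δ := min δ' ‖x₀‖ with hδdef
    have hδ : 0 < δ := lt_min hδ' hn
    have hδ1 : δ ≤ δ' := min_le_left _ _
    have hδ2 : δ ≤ ‖x₀‖ := min_le_right _ _
    filter_upwards [Ioi_mem_nhds (show ‖x₀‖ - δ / 2 < ‖x₀‖ by linarith)] with s hs
    have h0 : 0 ≤ ‖x₀‖ - δ / 2 := by linarith
    obtain ⟨x, hx, hqx⟩ := key (Metric.ball x₀ δ' ∩ {x | ‖x‖ < s})
      (Metric.isOpen_ball.inter (isOpen_lt continuous_norm continuous_const))
      ⟨((‖x₀‖ - δ / 2) / ‖x₀‖) • x₀, by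
        rw [Metric.mem_ball, dist_eq_norm, (hscale _ h0).2, sub_sub_cancel_left, abs_neg,
          abs_of_pos (by positivity)]
        linarith, by
        rw [mem_ofPred_eq, (hscale _ h0).1]; exact hs⟩
    exact (hq (le_of_lt hx.2)).trans_lt (hqx ▸ hball' x hx.1)
  exact tendsto_order.2 ⟨hbelow, habove⟩

/-- The convolution square of a radially nonincreasing density agrees, near a point `x₀ ≠ 0`, with
the convolution of an integrable function and a bounded one whose discontinuities form a null set
of spheres. -/
theorem continuousAt_lintegral_mul_sub {f : ℝ → ℝ≥0∞} (hf : Antitone f)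
    [IsFiniteMeasure (radialMeasure V f)] {x₀ : V} (hx₀ : x₀ ≠ 0) :
    ContinuousAt (fun x : V => ∫⁻ y : V, f ‖y‖ * f ‖x - y‖) x₀ := by
  have : Nontrivial V := ⟨x₀, 0, hx₀⟩
  have hn : 0 < ‖x₀‖ := norm_pos_iff.2 hx₀
  set ε := ‖x₀‖ / 4 with hε
  have hε0 : 0 < ε := by positivity
  let f₁ : ℝ → ℝ≥0∞ := (Iio ε).indicator f
  let f₂ : ℝ → ℝ≥0∞ := (Ici ε).indicator f
  have hfm : Measurable fun y : V => f ‖y‖ := measurable_comp_norm hf.measurable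
  have hf₁ : Measurable fun y : V => f₁ ‖y‖ :=
    measurable_comp_norm (hf.measurable.indicator measurableSet_Iio)
  have hf₂ : Measurable fun y : V => f₂ ‖y‖ :=
    measurable_comp_norm (hf.measurable.indicator measurableSet_Ici)
  have hsplit : ∀ r, f r = f₁ r + f₂ r := by
    intro r
    by_cases h : r < ε
    · simp [f₁, f₂, h, not_le.2 h]
    · simp [f₁, f₂, h, not_lt.1 h]
  set M := f ε with hM
  have hMt : M < ∞ := lt_top_of_isFiniteMeasure (V := V) hf hε0
  have hf₂M : ∀ r, f₂ r ≤ M := by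
    intro r
    by_cases h : ε ≤ r
    · simp only [f₂, indicator, mem_Ici, h, if_true]; exact hf h
    · simp [f₂, h]
  have hfint : ∫⁻ y : V, f ‖y‖ ≠ ∞ := by
    have := measure_ne_top (radialMeasure V f) univ
    rwa [radialMeasure, withDensity_apply _ MeasurableSet.univ, setLIntegral_univ] at this
  have hf₁int : ∫⁻ y : V, f₁ ‖y‖ ≠ ∞ :=
    ne_top_of_le_ne_top hfint (lintegral_mono fun y => (le_self_add).trans (hsplit ‖y‖).ge)
  have hgint : ∫⁻ y : V, (f₁ ‖y‖ + f ‖y‖) ≠ ∞ := by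
    rw [lintegral_add_left hf₁]
    exact ENNReal.add_ne_top.2 ⟨hf₁int, hfint⟩
  have hg : ∀ᵐ y : V, f₁ ‖y‖ + f ‖y‖ < ∞ := ae_lt_top (hf₁.add hfm) hgint
  have hgi : Integrable fun y : V => (f₁ ‖y‖ + f ‖y‖).toReal :=
    integrable_toReal_of_lintegral_ne_top (hf₁.add hfm).aemeasurable hgint
  have hsub : ∀ x : V, Measurable fun y : V => f₂ ‖x - y‖ := fun x =>
    hf₂.comp (measurable_const.sub measurable_id)
  have hsubf : ∀ x : V, Measurable fun y : V => f ‖x - y‖ := fun x =>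
    hfm.comp (measurable_const.sub measurable_id)
  have heq : ∀ᶠ x in 𝓝 x₀, ∫⁻ y : V, f ‖y‖ * f ‖x - y‖ =
      ENNReal.ofReal (∫ y : V, (f₁ ‖y‖ + f ‖y‖).toReal * (f₂ ‖x - y‖).toReal) := by
    filter_upwards [Metric.ball_mem_nhds x₀ hε0] with x hx
    have hx2 : 2 * ε ≤ ‖x‖ := by
      rw [Metric.mem_ball, dist_eq_norm] at hx
      have := norm_le_norm_add_norm_sub x x₀
      linarith
    have h1 : ∀ y : V, f₁ ‖y‖ * f ‖x - y‖ = f₁ ‖y‖ * f₂ ‖x - y‖ := by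
      intro y
      by_cases hy : ‖y‖ < ε
      · have : ε ≤ ‖x - y‖ := by
          have := norm_sub_norm_le x y
          linarith
        congr 1
        simp [f₂, this]
      · simp [f₁, hy]
    have h2 : ∫⁻ y : V, f₂ ‖y‖ * f ‖x - y‖ = ∫⁻ y : V, f ‖y‖ * f₂ ‖x - y‖ := by
      rw [← lintegral_sub_left_eq_self _ x]
      simp [mul_comm]
    have h3 : ∫⁻ y : V, f ‖y‖ * f ‖x - y‖ = ∫⁻ y : V, (f₁ ‖y‖ + f ‖y‖) * f₂ ‖x - y‖ := by
      have m1 : Measurable fun y : V => f₁ ‖y‖ * f₂ ‖x - y‖ := hf₁.mul (hsub x)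
      have m2 : Measurable fun y : V => f₁ ‖y‖ * f ‖x - y‖ := hf₁.mul (hsubf x)
      simp_rw [add_mul]
      rw [lintegral_add_left m1, ← h2, ← lintegral_congr h1, ← lintegral_add_left m2]
      refine lintegral_congr fun y => ?_
      rw [← add_mul, ← hsplit]
    rw [h3, ← integral_congr_ae (f := fun y : V => ((f₁ ‖y‖ + f ‖y‖) * f₂ ‖x - y‖).toReal)
      (ae_of_all _ fun y => ENNReal.toReal_mul)]
    have m3 : Measurable fun y : V => (f₁ ‖y‖ + f ‖y‖) * f₂ ‖x - y‖ := (hf₁.add hfm).mul (hsub x)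
    rw [integral_toReal m3.aemeasurable, ENNReal.ofReal_toReal]
    · refine ne_top_of_le_ne_top (ENNReal.mul_ne_top hgint hMt.ne)
        ((lintegral_mono fun y => ?_).trans (lintegral_mul_const _ (hf₁.add hfm)).le)
      exact mul_le_mul' le_rfl (hf₂M _)
    · filter_upwards [hg] with y hy
      exact ENNReal.mul_lt_top hy ((hf₂M _).trans_lt hMt)
  refine ContinuousAt.congr ?_ (heq.mono fun x hx => hx.symm)
  refine ENNReal.continuous_ofReal.continuousAt.comp ?_
  refine continuousAt_of_dominated (bound := fun y => (f₁ ‖y‖ + f ‖y‖).toReal * M.toReal) ?_ ?_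
    (hgi.mul_const _) ?_
  · exact Eventually.of_forall fun x =>
      ((hf₁.add hfm).ennreal_toReal.mul (hsub x).ennreal_toReal).aestronglyMeasurable
  · refine Eventually.of_forall fun x => ae_of_all _ fun y => ?_
    rw [Real.norm_of_nonneg (by positivity)]
    gcongr
    · exact hMt.ne
    · exact hf₂M _
  · -- The radii at which the bounded factor is discontinuous are `ε` and countably many others.
    have hcount : ({ε} ∪ {r | ¬ ContinuousAt f r}).Countable :=
      (countable_singleton ε).union hf.countable_not_continuousAt
    have hnull : volume (⋃ r ∈ ({ε} ∪ {r | ¬ ContinuousAt f r} : Set ℝ), Metric.sphere x₀ r) = 0 :=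
      (measure_biUnion_null_iff hcount).2 fun r _ => Measure.addHaar_sphere _ _ _
    filter_upwards [measure_eq_zero_iff_ae_notMem.1 hnull] with y hy
    simp only [mem_iUnion, not_exists] at hy
    have hr := hy ‖x₀ - y‖
    have hnot : ‖x₀ - y‖ ∉ ({ε} ∪ {r | ¬ ContinuousAt f r} : Set ℝ) := fun hmem =>
      hr hmem (by rw [mem_sphere_iff_norm, norm_sub_rev])
    simp only [mem_union, mem_singleton_iff, mem_ofPred_eq, not_or, not_not] at hnot
    refine continuousAt_const.mul ?_
    have hc₂ : ContinuousAt f₂ ‖x₀ - y‖ := by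
      rcases lt_or_gt_of_ne hnot.1 with h | h
      · refine (continuousAt_const (y := (0 : ℝ≥0∞))).congr ?_
        filter_upwards [Iio_mem_nhds h] with s hs
        have : ¬ ε ≤ s := not_le.2 hs
        simp [f₂, this]
      · refine hnot.2.congr ?_
        filter_upwards [Ioi_mem_nhds h] with s hs
        have : ε ≤ s := le_of_lt hs
        simp [f₂, this]
    have hcomp : ContinuousAt (fun x : V => f₂ ‖x - y‖) x₀ :=
      ContinuousAt.comp (f := fun x : V => ‖x - y‖) hc₂ (by fun_prop)
    exact (ENNReal.tendsto_toReal ((hf₂M _).trans_lt hMt).ne).comp hcomp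

/-- The density of the law at time `t` is continuous away from the origin, being the convolution
square of the density at time `t / 2`. -/
theorem IsLevyProfile.exists_continuous_density [Nontrivial V] {k : ℝ → ℝ≥0∞}
    (hk : IsLevyProfile V k) {t : ℝ} (ht : 0 < t) : ∃ q : ℝ → ℝ≥0∞, Antitone q ∧
      IsProbabilityMeasure (radialMeasure V q) ∧ (∀ r, 0 < r → ContinuousAt q r) ∧
      ∀ ξ : V, charFun (radialMeasure V q) ξ =
        Complex.exp ((-(t * (exponent k ξ).toReal) : ℝ) : ℂ) := by
  obtain ⟨q, hq, hp, hc⟩ := hk.exists_density ht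
  obtain ⟨f, hf, hfp, hfc⟩ := hk.exists_density (half_pos ht)
  refine ⟨q, hq, hp, fun r hr => ?_, hc⟩
  have hfm : Measurable fun y : V => f ‖y‖ := measurable_comp_norm hf.measurable
  have hqm : Measurable fun y : V => q ‖y‖ := measurable_comp_norm hq.measurable
  have hconv : radialMeasure V q = (radialMeasure V f).conv (radialMeasure V f) := by
    refine Measure.ext_of_charFun (funext fun ξ => ?_)
    rw [charFun_conv, hc, hfc, ← Complex.exp_add]
    congr 1
    push_cast
    ring
  rw [radialMeasure, radialMeasure, conv_withDensity_eq_lconvolution hfm hfm] at hconv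
  have hae : ∀ᵐ x : V, q ‖x‖ = ∫⁻ y : V, f ‖y‖ * f ‖x - y‖ := by
    have h1 : ∫⁻ x : V, q ‖x‖ ≠ ∞ := by
      have := measure_ne_top (radialMeasure V q) univ
      rwa [radialMeasure, withDensity_apply _ MeasurableSet.univ, setLIntegral_univ] at this
    have h2 := (withDensity_eq_iff hqm.aemeasurable
      (measurable_lconvolution _ hfm hfm).aemeasurable h1).1 hconv
    filter_upwards [h2] with x hx
    rw [hx, lconvolution_def]
    simp_rw [neg_add_eq_sub]
  obtain ⟨x₀, hx₀⟩ := exists_norm_eq V hr.le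
  have hx₀0 : x₀ ≠ 0 := by
    rintro rfl
    rw [norm_zero] at hx₀
    exact hr.ne hx₀
  rw [← hx₀]
  exact continuousAt_of_tendsto_nhds
    (tendsto_of_ae_eq hq hae hx₀0 (continuousAt_lintegral_mul_sub hf hx₀0))

end Law

/-! ### The running supremum of the exponent -/

/-- The running supremum `sup_{0 ≤ s ≤ r} ψ(s)`. -/
noncomputable def runningSup (ψ : ℝ → ℝ) (r : ℝ) : ℝ := sSup (ψ '' Icc 0 r)

/-- The generalized inverse `inf {s ≥ 0 : sup_{[0, s]} ψ ≥ u}` of the running supremum. -/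
noncomputable def runningSupInv (ψ : ℝ → ℝ) (u : ℝ) : ℝ := sInf {s | 0 ≤ s ∧ u ≤ runningSup ψ s}

/-- The properties of the radial profile of the exponent of an infinite isotropic unimodal Lévy
measure which enter the estimates; `K` measures the failure of monotonicity. -/
structure IsUnimodalExponent (K : ℝ) (ψ : ℝ → ℝ) : Prop where
  continuousOn : ContinuousOn ψ (Ici 0)
  zero : ψ 0 = 0
  pos : ∀ r, 0 < r → 0 < ψ r
  two_mul_le : ∀ r, 0 ≤ r → ψ (2 * r) ≤ 4 * ψ r
  almost_mono : ∀ s r, 0 ≤ s → s ≤ r → ψ s ≤ K * ψ r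
  unbounded : ∀ B, ∃ r, 0 ≤ r ∧ B ≤ ψ r

namespace IsUnimodalExponent

variable {K : ℝ} {ψ : ℝ → ℝ} (h : IsUnimodalExponent K ψ)

include h

theorem bddAbove (r : ℝ) : BddAbove (ψ '' Icc 0 r) := by
  refine ⟨K * ψ r, ?_⟩
  rintro _ ⟨s, hs, rfl⟩
  exact h.almost_mono s r hs.1 hs.2

theorem le_runningSup {s r : ℝ} (hs : 0 ≤ s) (hsr : s ≤ r) : ψ s ≤ runningSup ψ r :=
  le_csSup (h.bddAbove r) ⟨s, ⟨hs, hsr⟩, rfl⟩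

theorem runningSup_le {r : ℝ} (hr : 0 ≤ r) : runningSup ψ r ≤ K * ψ r := by
  refine csSup_le ⟨ψ 0, 0, ⟨le_rfl, hr⟩, rfl⟩ ?_
  rintro _ ⟨s, hs, rfl⟩
  exact h.almost_mono s r hs.1 hs.2

theorem runningSup_mono {r s : ℝ} (hr : 0 ≤ r) (hrs : r ≤ s) : runningSup ψ r ≤ runningSup ψ s :=
  csSup_le_csSup (h.bddAbove s) ⟨ψ 0, 0, ⟨le_rfl, hr⟩, rfl⟩
    (image_mono (Icc_subset_Icc_right hrs))

theorem nonneg {r : ℝ} (hr : 0 ≤ r) : 0 ≤ ψ r := by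
  rcases hr.eq_or_lt with rfl | hr
  · exact h.zero.ge
  · exact (h.pos r hr).le

theorem runningSup_nonneg {r : ℝ} (hr : 0 ≤ r) : 0 ≤ runningSup ψ r :=
  (h.nonneg hr).trans (h.le_runningSup hr le_rfl)

/-- At the generalized inverse the exponent itself attains the level, because it attains it there
for the first time. -/
theorem runningSupInv_spec {u : ℝ} (hu : 0 < u) :
    0 < runningSupInv ψ u ∧ ψ (runningSupInv ψ u) = u ∧ runningSup ψ (runningSupInv ψ u) = u := by
  let B : Set ℝ := {s | 0 ≤ s ∧ u ≤ ψ s}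
  have hBne : B.Nonempty := by
    obtain ⟨r, hr, hru⟩ := h.unbounded u
    exact ⟨r, hr, hru⟩
  have hBb : BddBelow B := ⟨0, fun s hs => hs.1⟩
  have hBcl : IsClosed B := by
    have := h.continuousOn.preimage_isClosed_of_isClosed isClosed_Ici (isClosed_Ici (a := u))
    exact this
  set s := sInf B with hs
  have hsB : s ∈ B := hBcl.csInf_mem hBne hBb
  have hs0 : 0 < s := by
    refine lt_of_le_of_ne hsB.1 fun h0 => ?_
    have := hsB.2
    rw [← h0, h.zero] at this
    linarith
  have hlt : ∀ r, 0 ≤ r → r < s → ψ r < u := by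
    intro r hr hrs
    by_contra hcon
    exact absurd (csInf_le hBb ⟨hr, not_lt.1 hcon⟩) (not_le.2 hrs)
  have hψs : ψ s = u := by
    refine le_antisymm ?_ hsB.2
    have hc : Tendsto ψ (𝓝[Ico 0 s] s) (𝓝 (ψ s)) :=
      (h.continuousOn s hs0.le).mono Ico_subset_Ici_self
    have : (𝓝[Ico 0 s] s).NeBot := by
      rw [← mem_closure_iff_nhdsWithin_neBot, closure_Ico hs0.ne]
      exact right_mem_Icc.2 hs0.le
    exact le_of_tendsto hc (by
      filter_upwards [self_mem_nhdsWithin] with r hr using (hlt r hr.1 hr.2).le)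
  have hsup : runningSup ψ s = u := by
    refine le_antisymm (csSup_le ⟨ψ 0, 0, ⟨le_rfl, hs0.le⟩, rfl⟩ ?_)
      (hψs ▸ h.le_runningSup hs0.le le_rfl)
    rintro _ ⟨r, hr, rfl⟩
    rcases hr.2.lt_or_eq with h1 | h1
    · exact (hlt r hr.1 h1).le
    · rw [h1, hψs]
  have hinv : runningSupInv ψ u = s := by
    refine IsLeast.csInf_eq ⟨⟨hs0.le, hsup.ge⟩, fun r hr => ?_⟩
    by_contra hcon
    push Not at hcon
    -- The supremum over `[0, r]` is attained, hence below `u` when `r < s`.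
    obtain ⟨x, hx, hmax⟩ := isCompact_Icc.exists_isMaxOn (nonempty_Icc.2 hr.1)
      (h.continuousOn.mono (Icc_subset_Ici_self : Icc 0 r ⊆ Ici 0))
    have h1 : runningSup ψ r ≤ ψ x := by
      refine csSup_le ⟨ψ 0, 0, ⟨le_rfl, hr.1⟩, rfl⟩ ?_
      rintro _ ⟨y, hy, rfl⟩
      exact hmax hy
    have := hlt x hx.1 (hx.2.trans_lt hcon)
    linarith [hr.2]
  rw [hinv]
  exact ⟨hs0, hψs, hsup⟩

theorem one_le_of_almost_mono : 1 ≤ K := by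
  have h1 := h.almost_mono 1 1 zero_le_one le_rfl
  have h2 := h.pos 1 one_pos
  by_contra hcon
  push Not at hcon
  nlinarith

theorem wlsc_le_one {α θ₀ C : ℝ} (hw : WLSC ψ α θ₀ C) : C ≤ 1 := by
  have h1 := hw.scaling 1 (θ₀ + 1) le_rfl (by linarith)
  rw [Real.one_rpow, mul_one, one_mul] at h1
  have h2 := h.pos (θ₀ + 1) (by linarith [hw.theta_nonneg])
  by_contra hcon
  push Not at hcon
  nlinarith

end IsUnimodalExponent

section Exponent

variable {V : Type*} [NormedAddCommGroup V] [InnerProductSpace ℝ V] [FiniteDimensional ℝ V]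
  [MeasurableSpace V] [BorelSpace V]

/-- The quasi-monotonicity constant of exponents on `V`. -/
noncomputable def monoConst (V : Type*) [NormedAddCommGroup V] [InnerProductSpace ℝ V] : ℝ :=
  400 * 4 ^ Module.finrank ℝ V

theorem IsLevyProfile.isUnimodalExponent [Nontrivial V] {k : ℝ → ℝ≥0∞} (hk : IsLevyProfile V k)
    {ψ : ℝ → ℝ} (hψ : ∀ ξ : V, (exponent k ξ).toReal = ψ ‖ξ‖) :
    IsUnimodalExponent (monoConst V) ψ := by
  obtain ⟨e, he⟩ := exists_norm_eq V (zero_le_one (α := ℝ))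
  have hnorm : ∀ r : ℝ, 0 ≤ r → ‖r • e‖ = r := fun r hr => by
    rw [norm_smul, he, mul_one, Real.norm_of_nonneg hr]
  have hψe : ∀ r : ℝ, 0 ≤ r → ψ r = (exponent k (r • e)).toReal := fun r hr => by
    rw [hψ, hnorm r hr]
  have he0 : e ≠ 0 := by
    rintro rfl
    simp at he
  refine ⟨?_, ?_, ?_, ?_, ?_, ?_⟩
  · have hc : Continuous fun r : ℝ => (exponent k (r • e)).toReal :=
      hk.continuous_exponent.comp (by fun_prop)
    exact hc.continuousOn.congr fun r hr => hψe r hr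
  · rw [hψe 0 le_rfl]
    simp [exponent]
  · intro r hr
    rw [hψe r hr.le]
    exact ENNReal.toReal_pos (hk.exponent_pos (smul_ne_zero hr.ne' he0)).ne'
      (hk.exponent_lt_top _).ne
  · intro r hr
    rw [hψe _ (by positivity), hψe r hr, mul_smul]
    have h1 := ENNReal.toReal_mono (ENNReal.mul_ne_top (by norm_num) (hk.exponent_lt_top _).ne)
      (exponent_two_smul_le k (r • e))
    rwa [ENNReal.toReal_mul, ENNReal.toReal_ofNat] at h1
  · intro s r hs hsr
    rw [hψe s hs, hψe r (hs.trans hsr)]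
    have h1 := ENNReal.toReal_mono (ENNReal.mul_ne_top ENNReal.ofReal_ne_top
      (hk.exponent_lt_top _).ne) (exponent_le_of_norm_le hk.antitone (ξ := r • e) (η := s • e)
        (by rw [hnorm s hs, hnorm r (hs.trans hsr)]; exact hsr))
    rwa [ENNReal.toReal_mul, ENNReal.toReal_ofReal (by positivity)] at h1
  · intro B
    have h1 := (hk.tendsto_exponent he0).eventually (lt_mem_nhds (ENNReal.ofReal_lt_top (r := B)))
    obtain ⟨n, hn⟩ := h1.exists
    refine ⟨n, Nat.cast_nonneg n, ?_⟩
    rw [hψe _ (Nat.cast_nonneg n)]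
    exact (ENNReal.ofReal_le_iff_le_toReal (hk.exponent_lt_top _).ne).1 hn.le

end Exponent

/-! ### Upper bounds for unimodal densities -/

section Density

variable {V : Type*} [NormedAddCommGroup V] [InnerProductSpace ℝ V] [FiniteDimensional ℝ V]
  [MeasurableSpace V] [BorelSpace V]

/-- The truncated second moment of a rotation invariant measure is controlled by that of its
projection onto a line. -/
theorem lintegral_min_norm_sq_le {k : ℝ → ℝ≥0∞} (hk : Measurable k) {ξ : V} {s : ℝ}
    (hξ : ‖ξ‖ = |s|) :
    ∫⁻ x, ENNReal.ofReal (min 1 (s ^ 2 * ‖x‖ ^ 2)) ∂(radialMeasure V k) ≤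
      Module.finrank ℝ V *
        ∫⁻ x, ENNReal.ofReal (min 1 (inner ℝ ξ x ^ 2)) ∂(radialMeasure V k) := by
  let b := stdOrthonormalBasis ℝ V
  have h1 : ∀ x : V, ENNReal.ofReal (min 1 (s ^ 2 * ‖x‖ ^ 2)) ≤
      ∑ i, ENNReal.ofReal (min 1 (inner ℝ (s • b i) x ^ 2)) := by
    intro x
    rw [← ENNReal.ofReal_sum_of_nonneg fun i _ => by positivity]
    refine ENNReal.ofReal_le_ofReal ?_
    have h2 : s ^ 2 * ‖x‖ ^ 2 = ∑ i, inner ℝ (s • b i) x ^ 2 := by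
      rw [← b.sum_sq_inner_right x, Finset.mul_sum]
      refine Finset.sum_congr rfl fun i _ => ?_
      rw [inner_smul_left, RCLike.conj_to_real, mul_pow]
    rw [h2]
    by_cases hall : ∀ i, inner ℝ (s • b i) x ^ 2 ≤ 1
    · refine (min_le_right _ _).trans (Finset.sum_le_sum fun i _ => ?_)
      rw [min_eq_right (hall i)]
    · push Not at hall
      obtain ⟨i, hi⟩ := hall
      refine (min_le_left _ _).trans ?_
      calc (1 : ℝ) = min 1 (inner ℝ (s • b i) x ^ 2) := (min_eq_left hi.le).symm
        _ ≤ _ := Finset.single_le_sum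
          (f := fun i => min 1 (inner ℝ (s • b i) x ^ 2)) (fun i _ => by positivity)
            (Finset.mem_univ i)
  calc ∫⁻ x, ENNReal.ofReal (min 1 (s ^ 2 * ‖x‖ ^ 2)) ∂(radialMeasure V k)
      ≤ ∫⁻ x, ∑ i, ENNReal.ofReal (min 1 (inner ℝ (s • b i) x ^ 2)) ∂(radialMeasure V k) :=
        lintegral_mono h1
    _ = ∑ i, ∫⁻ x, ENNReal.ofReal (min 1 (inner ℝ (s • b i) x ^ 2)) ∂(radialMeasure V k) :=
        lintegral_finsetSum _ fun i _ => by fun_prop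
    _ = ∑ _i : Fin (Module.finrank ℝ V),
        ∫⁻ x, ENNReal.ofReal (min 1 (inner ℝ ξ x ^ 2)) ∂(radialMeasure V k) := by
        refine Finset.sum_congr rfl fun i _ => ?_
        refine lintegral_inner_eq hk (g := fun u => ENNReal.ofReal (min 1 (u ^ 2))) (by fun_prop) ?_
        rw [norm_smul, b.norm_eq_one, mul_one, Real.norm_eq_abs, hξ]
    _ = _ := by simp

/-- The constant in the bound of truncated second moments by the exponent. -/
noncomputable def momentConst (V : Type*) [NormedAddCommGroup V] [InnerProductSpace ℝ V] : ℝ :=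
  Module.finrank ℝ V * (200 * 4 ^ Module.finrank ℝ V)

theorem momentConst_nonneg : 0 ≤ momentConst V := by
  unfold momentConst; positivity

/-- The volume of the unit ball of `V`. -/
noncomputable def unitBallVolume (V : Type*) [NormedAddCommGroup V] [InnerProductSpace ℝ V]
    [FiniteDimensional ℝ V] [MeasurableSpace V] [BorelSpace V] : ℝ :=
  volume.real (Metric.ball (0 : V) 1)

theorem unitBallVolume_pos : 0 < unitBallVolume V :=
  ENNReal.toReal_pos (Metric.measure_ball_pos volume _ one_pos).ne' measure_ball_lt_top.ne

theorem volume_ball_eq {r : ℝ} (hr : 0 < r) :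
    volume (Metric.ball (0 : V) r) =
      ENNReal.ofReal (unitBallVolume V * r ^ Module.finrank ℝ V) := by
  rw [Measure.addHaar_ball_of_pos _ _ hr, mul_comm, ENNReal.ofReal_mul unitBallVolume_pos.le,
    unitBallVolume, ofReal_measureReal]

variable {q : ℝ → ℝ≥0∞} {ψ : ℝ → ℝ} {t : ℝ}

theorem exponent_eq_of_charFun (hq : Antitone q) [IsProbabilityMeasure (radialMeasure V q)]
    (hc : ∀ ξ : V, charFun (radialMeasure V q) ξ = Complex.exp ((-(t * ψ ‖ξ‖) : ℝ) : ℂ)) (ξ : V) :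
    exponent q ξ = ENNReal.ofReal (1 - Real.exp (-(t * ψ ‖ξ‖))) := by
  have h1 := hc ξ
  rw [charFun_radialMeasure hq.measurable, probReal_univ, ← Complex.ofReal_exp,
    Complex.ofReal_inj] at h1
  have hfin : exponent q ξ ≠ ∞ := by
    refine ne_top_of_le_ne_top (b := ∫⁻ _, ENNReal.ofReal 2 ∂(radialMeasure V q)) (by simp)
      (lintegral_mono fun x => ENNReal.ofReal_le_ofReal ?_)
    linarith [Real.neg_one_le_cos (inner ℝ ξ x)]
  rw [← h1, sub_sub_cancel, ENNReal.ofReal_toReal hfin]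

/-- The truncated second moment of the law at time `t`. -/
theorem lintegral_min_le_of_charFun [Nontrivial V] (hq : Antitone q)
    [IsProbabilityMeasure (radialMeasure V q)]
    (hc : ∀ ξ : V, charFun (radialMeasure V q) ξ = Complex.exp ((-(t * ψ ‖ξ‖) : ℝ) : ℂ))
    {s : ℝ} (hs : 0 ≤ s) :
    ∫⁻ x, ENNReal.ofReal (min 1 (s ^ 2 * ‖x‖ ^ 2)) ∂(radialMeasure V q) ≤
      ENNReal.ofReal (momentConst V * (t * ψ s)) := by
  obtain ⟨ξ, hξ⟩ := exists_norm_eq V hs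
  refine (lintegral_min_norm_sq_le hq.measurable (hξ.trans (abs_of_nonneg hs).symm)).trans ?_
  have h1 := lintegral_min_one_sq_le hq ξ
  rw [exponent_eq_of_charFun hq hc, hξ, ← ENNReal.ofReal_mul (by positivity)] at h1
  refine (mul_le_mul_right h1 _).trans ?_
  rw [← ENNReal.ofReal_natCast, ← ENNReal.ofReal_mul (by positivity)]
  refine ENNReal.ofReal_le_ofReal ?_
  have h2 := Real.add_one_le_exp (-(t * ψ s))
  have h3 : 200 * 4 ^ Module.finrank ℝ V * (1 - Real.exp (-(t * ψ s))) ≤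
      200 * 4 ^ Module.finrank ℝ V * (t * ψ s) :=
    mul_le_mul_of_nonneg_left (by linarith) (by positivity)
  exact (mul_le_mul_of_nonneg_left h3 (Nat.cast_nonneg _)).trans_eq (by rw [momentConst]; ring)

theorem measureReal_norm_ge_le [Nontrivial V] (hq : Antitone q)
    [IsProbabilityMeasure (radialMeasure V q)]
    (hc : ∀ ξ : V, charFun (radialMeasure V q) ξ = Complex.exp ((-(t * ψ ‖ξ‖) : ℝ) : ℂ))
    {r : ℝ} (hr : 0 < r) (hnn : 0 ≤ t * ψ (1 / r)) :
    (radialMeasure V q).real {x | r ≤ ‖x‖} ≤ momentConst V * (t * ψ (1 / r)) := by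
  refine ENNReal.toReal_le_of_le_ofReal (mul_nonneg momentConst_nonneg hnn) ?_
  refine le_trans ?_ (lintegral_min_le_of_charFun hq hc (s := 1 / r) (by positivity))
  have hm : MeasurableSet {x : V | r ≤ ‖x‖} := measurableSet_le measurable_const measurable_norm
  rw [← lintegral_indicator_one hm]
  refine lintegral_mono fun x => ?_
  by_cases hx : r ≤ ‖x‖
  · have : 1 ≤ (1 / r) ^ 2 * ‖x‖ ^ 2 := by
      rw [← mul_pow]
      refine one_le_pow₀ ?_
      rw [one_div, inv_mul_eq_div, one_le_div hr]
      exact hx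
    rw [min_eq_left this]
    simp [indicator, hx]
  · simp [indicator, hx]

/-- A radially nonincreasing density at radius `r` is at most its average over an annulus with
outer radius `r`. -/
theorem density_mul_le (hq : Antitone q) [IsProbabilityMeasure (radialMeasure V q)] {r : ℝ}
    (hr : 0 < r) {a : ℝ} (ha0 : 0 < a) (ha : a < r) :
    (q r).toReal * (unitBallVolume V * (r ^ Module.finrank ℝ V - a ^ Module.finrank ℝ V)) ≤
      (radialMeasure V q).real {x | a ≤ ‖x‖} := by
  have hsub : Metric.ball (0 : V) a ⊆ Metric.ball 0 r := Metric.ball_subset_ball ha.le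
  have hpow : a ^ Module.finrank ℝ V ≤ r ^ Module.finrank ℝ V := by gcongr
  have hb := unitBallVolume_pos (V := V)
  have hvol : volume (Metric.ball (0 : V) r \ Metric.ball 0 a) = ENNReal.ofReal
      (unitBallVolume V * (r ^ Module.finrank ℝ V - a ^ Module.finrank ℝ V)) := by
    rw [measure_sdiff hsub measurableSet_ball.nullMeasurableSet measure_ball_lt_top.ne,
      volume_ball_eq hr, volume_ball_eq ha0, ← ENNReal.ofReal_sub _ (by positivity), mul_sub]
  have h1 : q r * volume (Metric.ball (0 : V) r \ Metric.ball 0 a) ≤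
      radialMeasure V q {x | a ≤ ‖x‖} := by
    calc q r * volume (Metric.ball (0 : V) r \ Metric.ball 0 a)
        ≤ radialMeasure V q (Metric.ball (0 : V) r \ Metric.ball 0 a) := by
          rw [radialMeasure, withDensity_apply _ (measurableSet_ball.diff measurableSet_ball),
            ← setLIntegral_const]
          refine setLIntegral_mono' (measurableSet_ball.diff measurableSet_ball) fun x hx => hq ?_
          have := hx.1
          rw [mem_ball_zero_iff] at this
          exact this.le
      _ ≤ _ := by
          refine measure_mono fun x hx => ?_
          have := hx.2
          rw [mem_ball_zero_iff, not_lt] at this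
          exact this
  have h2 := ENNReal.toReal_mono (measure_ne_top _ _) h1
  rwa [hvol, ENNReal.toReal_mul, ENNReal.toReal_ofReal
    (mul_nonneg hb.le (sub_nonneg.2 hpow))] at h2

/-- The general upper bound of a radially nonincreasing density. -/
theorem density_le (V : Type*) [NormedAddCommGroup V] [InnerProductSpace ℝ V]
    [FiniteDimensional ℝ V] [MeasurableSpace V] [BorelSpace V] [Nontrivial V] :
    ∃ c : ℝ, 0 < c ∧ ∀ (q : ℝ → ℝ≥0∞) (ψ : ℝ → ℝ) (K t : ℝ), Antitone q →
      IsProbabilityMeasure (radialMeasure V q) → IsUnimodalExponent K ψ → 0 < t →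
      (∀ ξ : V, charFun (radialMeasure V q) ξ = Complex.exp ((-(t * ψ ‖ξ‖) : ℝ) : ℂ)) →
      ∀ r, 0 < r → (q r).toReal ≤
        c * (min 1 (t * runningSup ψ (1 / r)) / r ^ Module.finrank ℝ V) := by
  set b := unitBallVolume V with hb
  have hb0 : 0 < b := unitBallVolume_pos
  set C := momentConst V with hC
  have hC0 : 0 ≤ C := momentConst_nonneg
  set n := Module.finrank ℝ V with hn
  have hn0 : n ≠ 0 := (Module.finrank_pos (R := ℝ) (M := V)).ne'
  refine ⟨(2 + 8 * C) / b, by positivity, ?_⟩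
  intro q ψ K t hq hp hψ ht hc r hr
  have hr2 : 0 < r / 2 := by positivity
  have h1 := density_mul_le (V := V) hq hr hr2 (by linarith)
  rw [← hb, ← hn] at h1
  have hpow : (r / 2) ^ n ≤ r ^ n / 2 := by
    rw [div_pow]
    gcongr
    exact le_self_pow₀ one_le_two hn0
  have hrn : 0 < r ^ n := by positivity
  set Q := (q r).toReal with hQ
  have hQ0 : 0 ≤ Q := ENNReal.toReal_nonneg
  have h2 : Q * (b * (r ^ n / 2)) ≤ (radialMeasure V q).real {x | r / 2 ≤ ‖x‖} := by
    refine le_trans ?_ h1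
    gcongr
    linarith
  have hψ0 : 0 ≤ ψ (1 / r) := hψ.nonneg (by positivity)
  have hs0 : ψ (1 / r) ≤ runningSup ψ (1 / r) := hψ.le_runningSup (by positivity) le_rfl
  have htail : (radialMeasure V q).real {x | r / 2 ≤ ‖x‖} ≤ 4 * C * (t * runningSup ψ (1 / r)) := by
    have h3 := hψ.two_mul_le (1 / r) (by positivity)
    have h4 : (2 : ℝ) * (1 / r) = 1 / (r / 2) := by field_simp
    rw [h4] at h3
    have h5 : 0 ≤ ψ (1 / (r / 2)) := hψ.nonneg (by positivity)
    refine (measureReal_norm_ge_le hq hc hr2 (by positivity)).trans ?_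
    calc C * (t * ψ (1 / (r / 2))) ≤ C * (t * (4 * runningSup ψ (1 / r))) := by
          gcongr; linarith
      _ = _ := by ring
  have hone : (radialMeasure V q).real {x | r / 2 ≤ ‖x‖} ≤ 1 := measureReal_le_one
  have hsup0 := hψ0.trans hs0
  have hmin : (radialMeasure V q).real {x | r / 2 ≤ ‖x‖} ≤
      (1 + 4 * C) * min 1 (t * runningSup ψ (1 / r)) := by
    have hts : 0 ≤ t * runningSup ψ (1 / r) := by positivity
    rcases min_cases 1 (t * runningSup ψ (1 / r)) with h | h <;> rw [h.1]
    · linarith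
    · nlinarith
  have h6 : Q * (b * (r ^ n / 2)) ≤ (1 + 4 * C) * min 1 (t * runningSup ψ (1 / r)) := h2.trans hmin
  rw [div_mul_div_comm, le_div_iff₀ (by positivity)]
  nlinarith

/-- The density is bounded by the integral of its Fourier transform. -/
theorem density_le_integral [Nontrivial V] (hq : Antitone q)
    [IsProbabilityMeasure (radialMeasure V q)]
    (hc : ∀ ξ : V, charFun (radialMeasure V q) ξ = Complex.exp ((-(t * ψ ‖ξ‖) : ℝ) : ℂ))
    {r : ℝ} (hr : 0 < r) (hcont : ContinuousAt q r)
    (hint : Integrable fun w : V => Real.exp (-(t * ψ (2 * Real.pi * ‖w‖)))) :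
    (q r).toReal ≤ ∫ w : V, Real.exp (-(t * ψ (2 * Real.pi * ‖w‖))) := by
  obtain ⟨x₀, hx₀⟩ := exists_norm_eq V hr.le
  let f : V → ℂ := fun v => ((q ‖v‖).toReal : ℂ)
  have hqm : Measurable fun x : V => q ‖x‖ := measurable_comp_norm hq.measurable
  have hf : Integrable f := by
    refine (integrable_toReal_of_lintegral_ne_top hqm.aemeasurable ?_).ofReal
    have := measure_ne_top (radialMeasure V q) univ
    rwa [radialMeasure, withDensity_apply _ MeasurableSet.univ, setLIntegral_univ] at this
  have hF : FourierTransform.fourier f =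
      fun w => ((Real.exp (-(t * ψ (2 * Real.pi * ‖w‖))) : ℝ) : ℂ) := by
    funext w
    rw [Real.fourier_eq]
    simp only [f]
    rw [fourier_eq_charFun hq.measurable (ae_lt_top_of_isFiniteMeasure hq.measurable), hc,
      norm_neg, norm_smul, Real.norm_of_nonneg (by positivity), Complex.ofReal_exp]
  have hfc : ContinuousAt f x₀ := by
    have h1 : ContinuousAt (fun v : V => q ‖v‖) x₀ :=
      ContinuousAt.comp (f := fun v : V => ‖v‖) (hx₀ ▸ hcont) (by fun_prop)
    have h2 : q ‖x₀‖ ≠ ∞ := by rw [hx₀]; exact (lt_top_of_isFiniteMeasure (V := V) hq hr).ne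
    exact Complex.continuous_ofReal.continuousAt.comp ((ENNReal.tendsto_toReal h2).comp h1)
  have hinv := hf.fourierInv_fourier_eq (hF ▸ hint.ofReal) hfc
  have h3 : ‖f x₀‖ = (q r).toReal := by
    simp only [f, hx₀]
    rw [Complex.norm_real, Real.norm_of_nonneg ENNReal.toReal_nonneg]
  rw [← h3, ← hinv, Real.fourierInv_eq, hF]
  refine (norm_integral_le_integral_norm _).trans (integral_mono_of_nonneg
    (ae_of_all _ fun _ => norm_nonneg _) hint (ae_of_all _ fun w => ?_))
  simp only [Circle.norm_smul]
  rw [Complex.norm_real, Real.norm_of_nonneg (Real.exp_nonneg _)]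

theorem integrable_exp_neg_norm_rpow [Nontrivial V] {α : ℝ} (hα : 0 < α) :
    Integrable fun x : V => Real.exp (-‖x‖ ^ α) := by
  rw [integrable_fun_norm_addHaar volume (f := fun y => Real.exp (-y ^ α))]
  have hn : 1 ≤ Module.finrank ℝ V := Module.finrank_pos (R := ℝ) (M := V)
  have h := integrableOn_rpow_mul_exp_neg_rpow (p := α)
    (s := ((Module.finrank ℝ V - 1 : ℕ) : ℝ)) (by
      have : (0 : ℝ) ≤ ((Module.finrank ℝ V - 1 : ℕ) : ℝ) := Nat.cast_nonneg _
      linarith) hα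
  simpa only [Real.rpow_natCast, smul_eq_mul] using h

/-- The on-diagonal upper bound under weak lower scaling: the inverse Fourier integral of
`exp(-tψ)` is of the order `s ^ n`, where `ψ(s) = 1 / t`. -/
theorem density_le_of_wlsc (V : Type*) [NormedAddCommGroup V] [InnerProductSpace ℝ V]
    [FiniteDimensional ℝ V] [MeasurableSpace V] [BorelSpace V] [Nontrivial V] (α : ℝ) :
    ∃ c : ℝ, 0 < c ∧ ∀ (q : ℝ → ℝ≥0∞) (ψ : ℝ → ℝ) (K t θ₀ C : ℝ), Antitone q →
      IsProbabilityMeasure (radialMeasure V q) → IsUnimodalExponent K ψ → 0 < t →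
      (∀ ξ : V, charFun (radialMeasure V q) ξ = Complex.exp ((-(t * ψ ‖ξ‖) : ℝ) : ℂ)) →
      WLSC ψ α θ₀ C → θ₀ ≤ runningSupInv ψ (1 / t) →
      ∀ r, 0 < r → ContinuousAt q r → (q r).toReal ≤
        c / C ^ ((Module.finrank ℝ V : ℝ) / α + 1) *
          runningSupInv ψ (1 / t) ^ Module.finrank ℝ V := by
  set n := Module.finrank ℝ V with hn
  set I : ℝ := ∫ x : V, Real.exp (-‖x‖ ^ α) with hI
  have hI0 : 0 ≤ I := integral_nonneg fun _ => Real.exp_nonneg _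
  refine ⟨Real.exp 1 * (I + 1), by positivity, ?_⟩
  intro q ψ K t θ₀ C hq hp hψ ht hc hw hθ r hr hcont
  obtain ⟨hs0, hψs, -⟩ := hψ.runningSupInv_spec (u := 1 / t) (by positivity)
  set s := runningSupInv ψ (1 / t) with hs
  have hα := hw.alpha_pos
  have hC0 := hw.const_pos
  have hC1 := hψ.wlsc_le_one hw
  set l : ℝ := C ^ (1 / α) / s with hl
  have hl0 : 0 < l := by positivity
  have hlα : ∀ y : ℝ, 0 ≤ y → (l * y) ^ α = C * (y / s) ^ α := by
    intro y hy
    have : l * y = C ^ (1 / α) * (y / s) := by rw [hl]; ring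
    rw [this, Real.mul_rpow (by positivity) (by positivity), ← Real.rpow_mul hC0.le,
      one_div_mul_cancel hα.ne', Real.rpow_one]
  have hpt : ∀ u : ℝ, 0 ≤ u → Real.exp (-(t * ψ u)) ≤ Real.exp 1 * Real.exp (-(l * u) ^ α) := by
    intro u hu
    rw [← Real.exp_add, Real.exp_le_exp, hlα u hu]
    rcases le_total u s with hus | hus
    · have h1 : (u / s) ^ α ≤ 1 := Real.rpow_le_one (by positivity) ((div_le_one hs0).2 hus) hα.le
      have h2 : 0 ≤ (u / s) ^ α := by positivity
      have h3 : 0 ≤ t * ψ u := mul_nonneg ht.le (hψ.nonneg hu)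
      nlinarith
    · have h1 := hw.scaling (u / s) s ((one_le_div hs0).2 hus) hθ
      rw [div_mul_cancel₀ _ hs0.ne', hψs] at h1
      have h2 : C * (u / s) ^ α ≤ t * ψ u := by
        calc C * (u / s) ^ α = t * (C * (u / s) ^ α * (1 / t)) := by field_simp
          _ ≤ t * ψ u := by gcongr
      linarith
  have hdom : ∀ w : V, Real.exp (-(t * ψ (2 * Real.pi * ‖w‖))) ≤
      Real.exp 1 * Real.exp (-‖l • w‖ ^ α) := by
    intro w
    refine (hpt _ (by positivity)).trans ?_
    rw [norm_smul, Real.norm_of_nonneg hl0.le]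
    have h1 : l * ‖w‖ ≤ l * (2 * Real.pi * ‖w‖) := by
      gcongr
      have := Real.pi_gt_three
      exact le_mul_of_one_le_left (norm_nonneg _) (by linarith)
    gcongr
  have hint1 : Integrable fun w : V => Real.exp 1 * Real.exp (-‖l • w‖ ^ α) :=
    ((integrable_comp_smul_iff volume (fun x : V => Real.exp (-‖x‖ ^ α)) hl0.ne').2
      (integrable_exp_neg_norm_rpow hα)).const_mul _
  have hmeas : AEStronglyMeasurable (fun w : V => Real.exp (-(t * ψ (2 * Real.pi * ‖w‖)))) := by
    refine Continuous.aestronglyMeasurable ?_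
    have h1 : Continuous fun w : V => ψ (2 * Real.pi * ‖w‖) :=
      hψ.continuousOn.comp_continuous (by fun_prop) fun w => by
        rw [mem_Ici]; positivity
    exact Real.continuous_exp.comp (h1.const_mul t).neg
  have hint : Integrable fun w : V => Real.exp (-(t * ψ (2 * Real.pi * ‖w‖))) := by
    refine hint1.mono' hmeas (ae_of_all _ fun w => ?_)
    rw [Real.norm_of_nonneg (Real.exp_nonneg _)]
    exact hdom w
  refine (density_le_integral hq hc hr hcont hint).trans ((integral_mono hint hint1 hdom).trans ?_)
  rw [integral_const_mul, Measure.integral_comp_smul volume (fun x : V => Real.exp (-‖x‖ ^ α)),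
    ← hI, ← hn, smul_eq_mul, abs_of_nonneg (by positivity)]
  have hln : (l ^ n)⁻¹ = s ^ n / C ^ ((n : ℝ) / α) := by
    rw [hl, div_pow, inv_div, ← Real.rpow_natCast (C ^ (1 / α)), ← Real.rpow_mul hC0.le]
    congr 2
    ring
  have hCC : C ^ ((n : ℝ) / α + 1) ≤ C ^ ((n : ℝ) / α) :=
    Real.rpow_le_rpow_of_exponent_ge hC0 hC1 (by linarith)
  rw [hln]
  calc Real.exp 1 * (s ^ n / C ^ ((n : ℝ) / α) * I)
      = Real.exp 1 * I / C ^ ((n : ℝ) / α) * s ^ n := by ring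
    _ ≤ Real.exp 1 * (I + 1) / C ^ ((n : ℝ) / α + 1) * s ^ n := by
        gcongr
        linarith

end Density

/-! ### Lower bounds for unimodal densities -/

section LowerBound

variable {V : Type*} [NormedAddCommGroup V] [InnerProductSpace ℝ V] [FiniteDimensional ℝ V]
  [MeasurableSpace V] [BorelSpace V]

variable {q : ℝ → ℝ≥0∞} {ψ : ℝ → ℝ} {t : ℝ}

/-- Splitting `1 - E cos ⟨ξ, X⟩`, `‖ξ‖ = 1 / r`, at the radius `δ r`: a lower bound of the tail up
to the contribution of the truncated second moment at scale `δ r`. -/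
theorem one_sub_exp_le [Nontrivial V] (hq : Antitone q) [IsProbabilityMeasure (radialMeasure V q)]
    (hc : ∀ ξ : V, charFun (radialMeasure V q) ξ = Complex.exp ((-(t * ψ ‖ξ‖) : ℝ) : ℂ))
    {r δ : ℝ} (hr : 0 < r) (hδ : 0 < δ) (hnn : 0 ≤ t * ψ (1 / (δ * r))) :
    1 - Real.exp (-(t * ψ (1 / r))) ≤ 2 * δ ^ 2 * (momentConst V * (t * ψ (1 / (δ * r)))) +
      2 * (radialMeasure V q).real {x | δ * r ≤ ‖x‖} := by
  obtain ⟨ξ, hξ⟩ := exists_norm_eq V (show 0 ≤ 1 / r by positivity)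
  have hm : MeasurableSet {x : V | δ * r ≤ ‖x‖} := measurableSet_le measurable_const measurable_norm
  have hC := momentConst_nonneg (V := V)
  have h1 := exponent_eq_of_charFun hq hc ξ
  rw [hξ] at h1
  have hpt : ∀ x : V, ENNReal.ofReal (1 - Real.cos (inner ℝ ξ x)) ≤
      ENNReal.ofReal (2 * δ ^ 2) * ENNReal.ofReal (min 1 ((1 / (δ * r)) ^ 2 * ‖x‖ ^ 2)) +
        ({x : V | δ * r ≤ ‖x‖}).indicator (fun _ => ENNReal.ofReal 2) x := by
    intro x
    by_cases hx : δ * r ≤ ‖x‖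
    · rw [indicator_of_mem (show x ∈ {x : V | δ * r ≤ ‖x‖} from hx)]
      refine le_add_left (ENNReal.ofReal_le_ofReal ?_)
      linarith [Real.neg_one_le_cos (inner ℝ ξ x)]
    · rw [indicator_of_notMem (show x ∉ {x : V | δ * r ≤ ‖x‖} from hx), add_zero,
        ← ENNReal.ofReal_mul (by positivity)]
      refine ENNReal.ofReal_le_ofReal ?_
      push Not at hx
      have h2 : (1 / (δ * r)) ^ 2 * ‖x‖ ^ 2 ≤ 1 := by
        rw [← mul_pow]
        refine pow_le_one₀ (by positivity) ?_
        rw [one_div, inv_mul_eq_div, div_le_one (by positivity)]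
        exact hx.le
      rw [min_eq_right h2]
      have h3 : inner ℝ ξ x ^ 2 ≤ (1 / r) ^ 2 * ‖x‖ ^ 2 := by
        rw [← mul_pow, ← sq_abs, ← hξ]
        gcongr
        exact abs_real_inner_le_norm ξ x
      have h4 : δ ^ 2 * ((1 / (δ * r)) ^ 2 * ‖x‖ ^ 2) = (1 / r) ^ 2 * ‖x‖ ^ 2 := by
        field_simp
      have h5 := one_sub_cos_le_two_mul_min (inner ℝ ξ x)
      have h6 := min_le_right 1 (inner ℝ ξ x ^ 2)
      rw [mul_assoc, h4]
      linarith
  have hnn2 : 0 ≤ (radialMeasure V q).real {x | δ * r ≤ ‖x‖} := measureReal_nonneg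
  have hmom : 0 ≤ momentConst V * (t * ψ (1 / (δ * r))) := mul_nonneg hC hnn
  rw [← ENNReal.ofReal_le_ofReal_iff (by positivity), ← h1]
  calc exponent q ξ ≤ ∫⁻ x, (ENNReal.ofReal (2 * δ ^ 2) *
          ENNReal.ofReal (min 1 ((1 / (δ * r)) ^ 2 * ‖x‖ ^ 2)) +
        ({x : V | δ * r ≤ ‖x‖}).indicator (fun _ => ENNReal.ofReal 2) x) ∂(radialMeasure V q) :=
        lintegral_mono hpt
    _ = ENNReal.ofReal (2 * δ ^ 2) *
          (∫⁻ x, ENNReal.ofReal (min 1 ((1 / (δ * r)) ^ 2 * ‖x‖ ^ 2)) ∂(radialMeasure V q)) +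
        ENNReal.ofReal 2 * radialMeasure V q {x | δ * r ≤ ‖x‖} := by
        rw [lintegral_add_left (by fun_prop), lintegral_const_mul _ (by fun_prop),
          lintegral_indicator hm, setLIntegral_const]
    _ ≤ ENNReal.ofReal (2 * δ ^ 2) * ENNReal.ofReal (momentConst V * (t * ψ (1 / (δ * r)))) +
        ENNReal.ofReal 2 * ENNReal.ofReal ((radialMeasure V q).real {x | δ * r ≤ ‖x‖}) := by
        rw [ofReal_measureReal]
        exact add_le_add_left (mul_le_mul_right
          (lintegral_min_le_of_charFun hq hc (by positivity)) _) _
    _ = _ := by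
        rw [← ENNReal.ofReal_mul (by positivity), ← ENNReal.ofReal_mul (by norm_num),
          ← ENNReal.ofReal_add (by positivity) (by positivity)]

/-- A radially nonincreasing density at radius `a` is at least its average over an annulus with
inner radius `a`. -/
theorem measureReal_sub_le (hq : Antitone q) [IsProbabilityMeasure (radialMeasure V q)] {a b : ℝ}
    (ha : 0 < a) (hb : 0 < b) :
    (radialMeasure V q).real {x | a ≤ ‖x‖} - (radialMeasure V q).real {x | b ≤ ‖x‖} ≤
      (q a).toReal * (unitBallVolume V * b ^ Module.finrank ℝ V) := by
  have hma : MeasurableSet {x : V | a ≤ ‖x‖} := measurableSet_le measurable_const measurable_norm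
  have hmb : MeasurableSet {x : V | b ≤ ‖x‖} := measurableSet_le measurable_const measurable_norm
  have h1 : radialMeasure V q ({x | a ≤ ‖x‖} \ {x | b ≤ ‖x‖}) ≤
      q a * volume (Metric.ball (0 : V) b) := by
    rw [radialMeasure, withDensity_apply _ (hma.diff hmb)]
    calc ∫⁻ x in {x : V | a ≤ ‖x‖} \ {x | b ≤ ‖x‖}, q ‖x‖
        ≤ ∫⁻ _ in {x : V | a ≤ ‖x‖} \ {x | b ≤ ‖x‖}, q a :=
          setLIntegral_mono' (hma.diff hmb) fun x hx => hq hx.1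
      _ = q a * volume ({x : V | a ≤ ‖x‖} \ {x | b ≤ ‖x‖}) := setLIntegral_const _ _
      _ ≤ _ := by
          gcongr
          intro x hx
          rw [mem_ball_zero_iff]
          exact not_le.1 hx.2
  have hqa : q a ≠ ∞ := (lt_top_of_isFiniteMeasure (V := V) hq ha).ne
  have hpos := unitBallVolume_pos (V := V)
  have h2 := ENNReal.toReal_mono (ENNReal.mul_ne_top hqa measure_ball_lt_top.ne) h1
  rw [ENNReal.toReal_mul, volume_ball_eq hb, ENNReal.toReal_ofReal (by positivity)] at h2
  refine le_trans ?_ h2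
  exact le_measureReal_sdiff

theorem exists_scales {α β C₁ C₂ M : ℝ} (hα : 0 < α) (hβ : β < 2) (hC₁ : 0 < C₁) :
    ∃ δ A : ℝ, 0 < δ ∧ δ ≤ 1 ∧ 1 ≤ A ∧
      2 * δ ^ 2 * (M * (C₂ * (1 / δ) ^ β)) ≤ 1 / 4 ∧ M ≤ C₁ * A ^ α / 16 := by
  have h1 : Tendsto (fun δ : ℝ => 2 * M * C₂ * δ ^ (2 - β)) (𝓝[>] 0) (𝓝 0) := by
    have : Tendsto (fun δ : ℝ => δ ^ (2 - β)) (𝓝[>] 0) (𝓝 ((0 : ℝ) ^ (2 - β))) :=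
      ((Real.continuousAt_rpow_const 0 (2 - β) (Or.inr (by linarith))).tendsto).mono_left
        nhdsWithin_le_nhds
    rw [Real.zero_rpow (by linarith)] at this
    simpa using this.const_mul (2 * M * C₂)
  have h2 : Tendsto (fun A : ℝ => C₁ / 16 * A ^ α) atTop atTop :=
    (tendsto_rpow_atTop hα).const_mul_atTop (by positivity)
  obtain ⟨δ, ⟨hδ, hδ0, hδ1⟩⟩ := ((h1.eventually (gt_mem_nhds (show (0 : ℝ) < 1 / 4 by norm_num))).and
    (Ioo_mem_nhdsGT one_pos)).exists
  obtain ⟨A, hA, hA1⟩ := ((h2.eventually_ge_atTop M).and (eventually_ge_atTop 1)).exists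
  refine ⟨δ, A, hδ0, hδ1.le, hA1, ?_, by linarith⟩
  refine le_trans (le_of_eq ?_) hδ.le
  rw [one_div, Real.inv_rpow hδ0.le, Real.rpow_sub hδ0, Real.rpow_two]
  ring

/-- The lower bound of the density at radius `δ r` in terms of the exponent at `1 / r`, for small
times: most of the mass `P(‖X‖ ≥ δ r)` lies within the annulus of outer radius `A r`. -/
theorem le_density_of_scaling (V : Type*) [NormedAddCommGroup V] [InnerProductSpace ℝ V]
    [FiniteDimensional ℝ V] [MeasurableSpace V] [BorelSpace V] [Nontrivial V] {α β C₁ C₂ : ℝ}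
    (hα : 0 < α) (hβ : β < 2) (hC₁ : 0 < C₁) :
    ∃ δ A c : ℝ, 0 < δ ∧ δ ≤ 1 ∧ 1 ≤ A ∧ 0 < c ∧
      ∀ (q : ℝ → ℝ≥0∞) (ψ : ℝ → ℝ) (K t θ₀ : ℝ), Antitone q →
      IsProbabilityMeasure (radialMeasure V q) → IsUnimodalExponent K ψ → 0 < t →
      (∀ ξ : V, charFun (radialMeasure V q) ξ = Complex.exp ((-(t * ψ ‖ξ‖) : ℝ) : ℂ)) →
      WLSC ψ α θ₀ C₁ → WUSC ψ β θ₀ C₂ → ∀ r, 0 < r → θ₀ ≤ 1 / (A * r) → t * ψ (1 / r) ≤ 1 →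
      c * (t * ψ (1 / r)) / r ^ Module.finrank ℝ V ≤ (q (δ * r)).toReal := by
  set b := unitBallVolume V with hb
  have hb0 : 0 < b := unitBallVolume_pos
  set M := momentConst V with hM
  have hM0 : 0 ≤ M := momentConst_nonneg
  set n := Module.finrank ℝ V with hn
  obtain ⟨δ, A, hδ0, hδ1, hA, h1, h2⟩ := exists_scales (C₂ := C₂) (M := M) hα hβ hC₁
  have hA0 : 0 < A := by linarith
  refine ⟨δ, A, 1 / (16 * (b * A ^ n)), hδ0, hδ1, hA, by positivity, ?_⟩
  intro q ψ K t θ₀ hq hp hψ ht hc hL hU r hr hθ hx1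
  set x := t * ψ (1 / r) with hx
  have hψr : 0 < ψ (1 / r) := hψ.pos _ (by positivity)
  have hx0 : 0 < x := by positivity
  have hψδ : 0 < ψ (1 / (δ * r)) := hψ.pos _ (by positivity)
  have hψA : 0 < ψ (1 / (A * r)) := hψ.pos _ (by positivity)
  have hθr : θ₀ ≤ 1 / r := by
    refine hθ.trans ?_
    gcongr
    exact le_mul_of_one_le_left hr.le hA
  have hup : t * ψ (1 / (δ * r)) ≤ C₂ * (1 / δ) ^ β * x := by
    have h3 := hU.scaling (1 / δ) (1 / r) (one_le_one_div hδ0 hδ1) hθr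
    have h4 : 1 / δ * (1 / r) = 1 / (δ * r) := by field_simp
    rw [h4] at h3
    calc t * ψ (1 / (δ * r)) ≤ t * (C₂ * (1 / δ) ^ β * ψ (1 / r)) := by gcongr
      _ = _ := by rw [hx]; ring
  have hlow : C₁ * A ^ α * (t * ψ (1 / (A * r))) ≤ x := by
    have h3 := hL.scaling A (1 / (A * r)) hA hθ
    have h4 : A * (1 / (A * r)) = 1 / r := by field_simp
    rw [h4] at h3
    calc C₁ * A ^ α * (t * ψ (1 / (A * r))) = t * (C₁ * A ^ α * ψ (1 / (A * r))) := by ring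
      _ ≤ _ := by rw [hx]; gcongr
  have htail : x / 8 ≤ (radialMeasure V q).real {y | δ * r ≤ ‖y‖} := by
    have h3 := one_sub_exp_le (V := V) hq hc hr hδ0 (by positivity)
    rw [← hx, ← hM] at h3
    have h4 : x / 2 ≤ 1 - Real.exp (-x) := by
      have h5 : 1 + x ≤ Real.exp x := by linarith [Real.add_one_le_exp x]
      have h6 : Real.exp (-x) ≤ 1 / (1 + x) := by
        rw [Real.exp_neg, one_div]; gcongr
      have h7 : 1 / (1 + x) ≤ 1 - x / 2 := by
        rw [div_le_iff₀ (by positivity)]; nlinarith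
      linarith
    have h5 : 2 * δ ^ 2 * (M * (t * ψ (1 / (δ * r)))) ≤ x / 4 := by
      calc 2 * δ ^ 2 * (M * (t * ψ (1 / (δ * r))))
          ≤ 2 * δ ^ 2 * (M * (C₂ * (1 / δ) ^ β * x)) := by gcongr
        _ = 2 * δ ^ 2 * (M * (C₂ * (1 / δ) ^ β)) * x := by ring
        _ ≤ 1 / 4 * x := by gcongr
        _ = x / 4 := by ring
    linarith
  have hfar : (radialMeasure V q).real {y | A * r ≤ ‖y‖} ≤ x / 16 := by
    refine (measureReal_norm_ge_le (V := V) hq hc (by positivity) (by positivity)).trans ?_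
    rw [← hM]
    calc M * (t * ψ (1 / (A * r))) ≤ C₁ * A ^ α / 16 * (t * ψ (1 / (A * r))) := by gcongr
      _ = C₁ * A ^ α * (t * ψ (1 / (A * r))) / 16 := by ring
      _ ≤ x / 16 := by gcongr
  have h3 := measureReal_sub_le (V := V) hq (show 0 < δ * r by positivity)
    (show 0 < A * r by positivity)
  rw [← hb, ← hn, mul_pow] at h3
  have h4 : x / 16 ≤ (q (δ * r)).toReal * (b * (A ^ n * r ^ n)) := by linarith
  rw [div_le_iff₀ (by positivity), one_div_mul_eq_div, div_le_iff₀ (by positivity)]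
  linarith

/-- The two-regime lower bound of the density under weak lower and upper scaling. -/
theorem le_density (V : Type*) [NormedAddCommGroup V] [InnerProductSpace ℝ V]
    [FiniteDimensional ℝ V] [MeasurableSpace V] [BorelSpace V] [Nontrivial V] (K : ℝ)
    {α β C₁ C₂ : ℝ} (hα : 0 < α) (hβ : β < 2) (hC₁ : 0 < C₁) (hC₂ : 0 < C₂) :
    ∃ c r₀ : ℝ, 0 < c ∧ 0 < r₀ ∧
      ∀ (q : ℝ → ℝ≥0∞) (ψ : ℝ → ℝ) (t θ₀ : ℝ), Antitone q →
      IsProbabilityMeasure (radialMeasure V q) → IsUnimodalExponent K ψ → 0 < t →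
      (∀ ξ : V, charFun (radialMeasure V q) ξ = Complex.exp ((-(t * ψ ‖ξ‖) : ℝ) : ℂ)) →
      WLSC ψ α θ₀ C₁ → WUSC ψ β θ₀ C₂ → ∀ r, 0 < r →
      (θ₀ = 0 ∨ (t * runningSup ψ (θ₀ / r₀) ≤ 1 ∧ r < r₀ / θ₀)) →
      c * min (runningSupInv ψ (1 / t) ^ Module.finrank ℝ V)
        (t * runningSup ψ (1 / r) / r ^ Module.finrank ℝ V) ≤ (q r).toReal := by
  obtain ⟨δ, A, c, hδ0, hδ1, hA, hc0, hmain⟩ := le_density_of_scaling V (C₂ := C₂) hα hβ hC₁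
  set n := Module.finrank ℝ V with hn
  have hA0 : 0 < A := by linarith
  -- The second bound on `r₀` forces `A θ₀ ≤ ψ⁻(1 / t)`, see `hsA` below.
  obtain ⟨r₀, hr₀, hr₀A, hr₀K⟩ : ∃ r₀ : ℝ, 0 < r₀ ∧ r₀ ≤ δ / A ∧ K * (A * r₀) ^ α < C₁ := by
    have h1 : Tendsto (fun r : ℝ => K * (A * r) ^ α) (𝓝[>] 0) (𝓝 0) := by
      have h2 : ContinuousAt (fun r : ℝ => K * (A * r) ^ α) 0 := by
        refine ContinuousAt.mul continuousAt_const (ContinuousAt.rpow_const ?_ (Or.inr hα.le))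
        fun_prop
      have h3 := h2.tendsto
      simp only [mul_zero, Real.zero_rpow hα.ne'] at h3
      exact h3.mono_left nhdsWithin_le_nhds
    obtain ⟨r, h2, h3⟩ := ((h1.eventually (gt_mem_nhds hC₁)).and
      (Ioc_mem_nhdsGT (show 0 < δ / A by positivity))).exists
    exact ⟨r, h3.1, h3.2, h2⟩
  have hAr₀ : A * r₀ ≤ 1 := by
    rw [le_div_iff₀ hA0] at hr₀A
    linarith
  set K' := max K 1 with hK'
  have hK'0 : 0 < K' := lt_max_of_lt_right one_pos
  refine ⟨min c (c * δ ^ n / (K' * (C₂ * (1 / δ) ^ β))), r₀, by positivity, hr₀, ?_⟩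
  intro q ψ t θ₀ hq hp hψ ht hc hL hU r hr hcase
  have hθ0 := hL.theta_nonneg
  obtain ⟨hs0, hψs, hsup⟩ := hψ.runningSupInv_spec (u := 1 / t) (by positivity)
  set s := runningSupInv ψ (1 / t) with hs
  have htt : t * (1 / t) = 1 := by field_simp
  have hsA : A * θ₀ ≤ s := by
    rcases hcase with h0 | ⟨h1, -⟩
    · rw [h0, mul_zero]; exact hs0.le
    by_contra hcon
    push Not at hcon
    have hAθ : 0 ≤ A * θ₀ := by positivity
    have h2 : 1 / t ≤ K * ψ (A * θ₀) := by
      rw [← hsup]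
      exact (hψ.runningSup_mono hs0.le hcon.le).trans (hψ.runningSup_le hAθ)
    have h3 := hL.scaling (1 / (A * r₀)) (A * θ₀) (one_le_one_div (by positivity) hAr₀)
      (le_mul_of_one_le_left hθ0 hA)
    have h4 : 1 / (A * r₀) * (A * θ₀) = θ₀ / r₀ := by field_simp
    rw [h4, one_div, Real.inv_rpow (by positivity)] at h3
    have h5 : ψ (θ₀ / r₀) ≤ 1 / t := by
      rw [le_div_iff₀ ht, mul_comm]
      exact le_trans (by gcongr; exact hψ.le_runningSup (by positivity) le_rfl) h1
    have h6 : C₁ * ψ (A * θ₀) ≤ (A * r₀) ^ α * (1 / t) := by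
      have h7 := h3.trans h5
      have h8 : 0 < (A * r₀) ^ α := by positivity
      calc C₁ * ψ (A * θ₀) = (A * r₀) ^ α * (C₁ * ((A * r₀) ^ α)⁻¹ * ψ (A * θ₀)) := by field_simp
        _ ≤ _ := by gcongr
    have hK1 := hψ.one_le_of_almost_mono
    have h9 : C₁ * (1 / t) ≤ K * (A * r₀) ^ α * (1 / t) := by
      calc C₁ * (1 / t) ≤ C₁ * (K * ψ (A * θ₀)) := by gcongr
        _ = K * (C₁ * ψ (A * θ₀)) := by ring
        _ ≤ K * ((A * r₀) ^ α * (1 / t)) := by gcongr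
        _ = _ := by ring
    have h10 : 0 < 1 / t := by positivity
    exact absurd (le_of_mul_le_mul_right h9 h10) (not_le.2 hr₀K)
  have hqfin : ∀ a, 0 < a → q a ≠ ∞ := fun a ha => (lt_top_of_isFiniteMeasure (V := V) hq ha).ne
  have hsup0 : 0 ≤ runningSup ψ (1 / r) := hψ.runningSup_nonneg (by positivity)
  have hmin0 : 0 ≤ min (s ^ n) (t * runningSup ψ (1 / r) / r ^ n) :=
    le_min (by positivity) (by positivity)
  rcases le_or_gt r (δ / s) with hrs | hrs
  · -- Near the origin the density is at least its value at `δ / s`.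
    have h1 := hmain q ψ K t θ₀ hq hp hψ ht hc hL hU (1 / s) (by positivity) (by
      rw [mul_one_div, one_div_div, le_div_iff₀ hA0, mul_comm]; exact hsA) (by
      rw [one_div_one_div, hψs, htt])
    rw [one_div_one_div, hψs, htt, mul_one, mul_one_div, one_div, inv_pow, div_inv_eq_mul] at h1
    calc _ ≤ c * s ^ n := mul_le_mul (min_le_left _ _) (min_le_left _ _) hmin0 hc0.le
      _ ≤ _ := h1.trans (ENNReal.toReal_mono (hqfin r hr) (hq hrs))
  · have hδr : δ / r < s := by
      rw [div_lt_iff₀ hr]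
      rw [div_lt_iff₀ hs0] at hrs
      linarith
    have hinv : 1 / (r / δ) = δ / r := by rw [one_div_div]
    have hθA : θ₀ ≤ 1 / (A * (r / δ)) := by
      rcases hcase with h0 | ⟨-, h1⟩
      · rw [h0]; positivity
      · rcases hθ0.eq_or_lt with h0 | h0
        · rw [← h0]; positivity
        rw [lt_div_iff₀ h0] at h1
        have h2 : 1 / (A * (r / δ)) = δ / A / r := by field_simp
        rw [h2, le_div_iff₀ hr]
        linarith
    have h1 := hmain q ψ K t θ₀ hq hp hψ ht hc hL hU (r / δ) (by positivity) hθA (by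
      rw [hinv]
      calc t * ψ (δ / r) ≤ t * runningSup ψ s := by
            gcongr
            exact hψ.le_runningSup (by positivity) hδr.le
        _ = 1 := by rw [hsup, htt])
    rw [hinv, mul_div_cancel₀ _ hδ0.ne'] at h1
    have h2 : runningSup ψ (1 / r) ≤ K' * (C₂ * (1 / δ) ^ β) * ψ (δ / r) := by
      have h3 := hU.scaling (1 / δ) (δ / r) (one_le_one_div hδ0 hδ1) (by
        refine hθA.trans ?_
        rw [← hinv]
        gcongr
        exact le_mul_of_one_le_left (by positivity) hA)
      have h4 : 1 / δ * (δ / r) = 1 / r := by field_simp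
      rw [h4] at h3
      have h5 : 0 < ψ (1 / r) := hψ.pos _ (by positivity)
      calc runningSup ψ (1 / r) ≤ K * ψ (1 / r) := hψ.runningSup_le (by positivity)
        _ ≤ K' * ψ (1 / r) := by gcongr; exact le_max_left _ _
        _ ≤ K' * (C₂ * (1 / δ) ^ β * ψ (δ / r)) := by gcongr
        _ = _ := by ring
    set D := K' * (C₂ * (1 / δ) ^ β) with hD
    have hD0 : 0 < D := by positivity
    calc _ ≤ c * δ ^ n / D * (t * runningSup ψ (1 / r) / r ^ n) :=
          mul_le_mul (min_le_right _ _) (min_le_right _ _) hmin0 (by positivity)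
      _ ≤ c * δ ^ n / D * (t * (D * ψ (δ / r)) / r ^ n) := by gcongr
      _ = c * (t * ψ (δ / r)) / (r / δ) ^ n := by rw [div_pow]; field_simp
      _ ≤ _ := h1

end LowerBound

/-! ### Projection from dimension `d + 2` to dimension `d` -/

section Projection

/-- The space `ℝ^d × ℂ` of dimension `d + 2`, with the Euclidean norm. -/
abbrev ExtE (d : ℕ) : Type := WithLp 2 (E d × ℂ)

theorem finrank_extE (d : ℕ) : Module.finrank ℝ (ExtE d) = d + 2 := by
  rw [(WithLp.linearEquiv 2 ℝ (E d × ℂ)).finrank_eq]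
  simp

/-- The integral of the radial function with profile `g` over the affine plane at distance `a`
from the origin, in polar coordinates: `2π ∫_a^∞ ρ g(ρ) dρ`. -/
noncomputable def planeIntegral (g : ℝ → ℝ≥0∞) (a : ℝ) : ℝ≥0∞ :=
  ENNReal.ofReal (2 * Real.pi) * ∫⁻ ρ in Ioi a, ENNReal.ofReal ρ * g ρ

theorem planeIntegral_antitone (g : ℝ → ℝ≥0∞) : Antitone (planeIntegral g) := by
  intro a b hab
  exact mul_le_mul_right (lintegral_mono_set (Ioi_subset_Ioi hab)) _

theorem lintegral_Ioi_sqrt_add_sq (g : ℝ → ℝ≥0∞) {a : ℝ} (ha : 0 ≤ a) :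
    ∫⁻ s in Ioi (0 : ℝ), ENNReal.ofReal s * g (√(a ^ 2 + s ^ 2)) =
      ∫⁻ ρ in Ioi a, ENNReal.ofReal ρ * g ρ := by
  have himg : (fun s : ℝ => √(a ^ 2 + s ^ 2)) '' Ioi 0 = Ioi a := by
    ext ρ
    simp only [mem_image, mem_Ioi]
    constructor
    · rintro ⟨s, hs, rfl⟩
      exact Real.lt_sqrt_of_sq_lt (by nlinarith)
    · intro hρ
      have h1 : 0 < ρ ^ 2 - a ^ 2 := by nlinarith
      refine ⟨√(ρ ^ 2 - a ^ 2), Real.sqrt_pos.2 h1, ?_⟩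
      rw [Real.sq_sqrt h1.le, add_sub_cancel, Real.sqrt_sq (ha.trans hρ.le)]
  have hderiv : ∀ s ∈ Ioi (0 : ℝ), HasDerivWithinAt (fun s : ℝ => √(a ^ 2 + s ^ 2))
      (s / √(a ^ 2 + s ^ 2)) (Ioi 0) s := by
    intro s hs
    have hs0 : 0 < s := hs
    have h1 : HasDerivAt (fun s : ℝ => a ^ 2 + s ^ 2) (2 * s) s := by
      simpa using (hasDerivAt_pow 2 s).const_add (a ^ 2)
    have h2 := h1.sqrt (by positivity)
    rw [mul_div_mul_left _ _ (two_ne_zero' ℝ)] at h2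
    exact h2.hasDerivWithinAt
  have hinj : InjOn (fun s : ℝ => √(a ^ 2 + s ^ 2)) (Ioi 0) := by
    intro s hs u hu h
    have hs0 : 0 < s := hs
    have hu0 : 0 < u := hu
    dsimp only at h
    rw [Real.sqrt_inj (by positivity) (by positivity), add_right_inj] at h
    exact (pow_left_inj₀ hs0.le hu0.le two_ne_zero).1 h
  rw [← himg, lintegral_image_eq_lintegral_abs_deriv_mul measurableSet_Ioi hderiv hinj]
  refine setLIntegral_congr_fun measurableSet_Ioi fun s hs => ?_
  have hs0 : 0 < s := hs
  rw [← mul_assoc, ← ENNReal.ofReal_mul (by positivity), abs_of_nonneg (by positivity),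
    div_mul_cancel₀ _ (by positivity)]

theorem lintegral_complex_eq_planeIntegral {g : ℝ → ℝ≥0∞} (hg : Measurable g) {a : ℝ}
    (ha : 0 ≤ a) : ∫⁻ z : ℂ, g (√(a ^ 2 + ‖z‖ ^ 2)) = planeIntegral g a := by
  rw [← Complex.lintegral_comp_polarCoord_symm, polarCoord_target]
  simp only [Complex.norm_polarCoord_symm, sq_abs, smul_eq_mul]
  rw [Measure.volume_eq_prod, setLIntegral_prod _ (by fun_prop)]
  simp only [setLIntegral_const, Real.volume_Ioo]
  rw [lintegral_mul_const _ (by fun_prop), lintegral_Ioi_sqrt_add_sq g ha, planeIntegral, mul_comm]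
  congr 2
  ring

/-- Projecting the rotation invariant measure with profile `g` from dimension `d + 2` to
dimension `d` gives the rotation invariant measure whose profile is the integral of `g` over
planes. -/
theorem map_fst_radialMeasure (d : ℕ) {g : ℝ → ℝ≥0∞} (hg : Measurable g) :
    (radialMeasure (ExtE d) g).map (fun x : ExtE d => x.ofLp.1) =
      radialMeasure (E d) (planeIntegral g) := by
  have hfst : Measurable fun x : ExtE d => x.ofLp.1 := by fun_prop
  have hmp := WithLp.volume_preserving_ofLp (U := E d) (V := ℂ)
  refine Measure.ext_of_lintegral _ fun F hF => ?_
  have hF' : Measurable fun x : ExtE d => F x.ofLp.1 := hF.comp hfst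
  rw [lintegral_map hF hfst, lintegral_radialMeasure hg hF',
    lintegral_radialMeasure (planeIntegral_antitone g).measurable hF]
  have h1 : ∀ x : ExtE d, g ‖x‖ * F x.ofLp.1 =
      (fun y : E d × ℂ => g (√(‖y.1‖ ^ 2 + ‖y.2‖ ^ 2)) * F y.1) x.ofLp := by
    intro x
    rw [WithLp.prod_norm_eq_of_L2]
    rfl
  simp_rw [h1]
  rw [hmp.lintegral_comp (f := fun y : E d × ℂ => g (√(‖y.1‖ ^ 2 + ‖y.2‖ ^ 2)) * F y.1)
    (by fun_prop), Measure.volume_eq_prod, lintegral_prod _ (by fun_prop)]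
  refine lintegral_congr fun x => ?_
  dsimp only
  rw [lintegral_mul_const _ (by fun_prop), lintegral_complex_eq_planeIntegral hg (norm_nonneg _)]

end Projection

section Profile

/-- The Lévy density in dimension `d + 2`, namely `-ν'(r) / (2πr)`, extended by `∞` to `r ≤ 0`
so that it is monotone on the whole line. -/
noncomputable def liftedProfile (ν' : ℝ → ℝ) (r : ℝ) : ℝ≥0∞ :=
  if r ≤ 0 then ∞ else ENNReal.ofReal ((2 * Real.pi)⁻¹ * (-ν' r / r))

theorem liftedProfile_antitone {ν' : ℝ → ℝ} (h : AntitoneOn (fun r => -ν' r / r) (Ioi 0)) :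
    Antitone (liftedProfile ν') := by
  intro r s hrs
  by_cases hr : r ≤ 0
  · simp [liftedProfile, hr]
  · have hs : ¬ s ≤ 0 := by linarith
    simp only [liftedProfile, hr, hs, if_false]
    refine ENNReal.ofReal_le_ofReal (mul_le_mul_of_nonneg_left ?_ (by positivity))
    exact h (not_le.1 hr) (not_le.1 hs) hrs

/-- The derivative is nonpositive: otherwise the monotonicity of `-ν'(r) / r` would keep it bounded
away from zero near infinity. -/
theorem deriv_nonpos_of_antitoneOn {ν' : ℝ → ℝ} (h : AntitoneOn (fun r => -ν' r / r) (Ioi 0))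
    (hint : ∀ r, 0 < r → IntegrableOn ν' (Ioi r)) {r : ℝ} (hr : 0 < r) : ν' r ≤ 0 := by
  by_contra hcon
  push Not at hcon
  have h1 : ∀ s ∈ Ioi r, ν' r ≤ ν' s := by
    intro s hs
    have hs0 : 0 < s := hr.trans hs
    have h2 := h (show r ∈ Ioi (0 : ℝ) from hr) (show s ∈ Ioi (0 : ℝ) from hs0) (le_of_lt hs)
    dsimp only at h2
    rw [div_le_div_iff₀ hs0 hr] at h2
    have h3 : r ≤ s := le_of_lt hs
    nlinarith
  have h2 : IntegrableOn (fun _ : ℝ => ν' r) (Ioi r) := by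
    refine (hint r hr).mono' (by fun_prop) ?_
    filter_upwards [ae_restrict_mem measurableSet_Ioi] with s hs
    rw [Real.norm_of_nonneg hcon.le]
    exact h1 s hs
  rw [integrableOn_const_iff] at h2
  simp [hcon.ne'] at h2

theorem planeIntegral_liftedProfile {ν ν' : ℝ → ℝ}
    (h : AntitoneOn (fun r => -ν' r / r) (Ioi 0))
    (hν : ∀ r, 0 < r → IntegrableOn ν' (Ioi r) ∧ ν r = -∫ ρ in Ioi r, ν' ρ) {a : ℝ} (ha : 0 < a) :
    planeIntegral (liftedProfile ν') a = ENNReal.ofReal (ν a) := by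
  have hnp : ∀ r, 0 < r → ν' r ≤ 0 := fun r hr =>
    deriv_nonpos_of_antitoneOn h (fun s hs => (hν s hs).1) hr
  have hneg : IntegrableOn (fun ρ => -ν' ρ) (Ioi a) := (hν a ha).1.neg
  rw [planeIntegral, ← lintegral_const_mul _ (by
    have := (liftedProfile_antitone h).measurable
    fun_prop), (hν a ha).2, ← integral_neg, ofReal_integral_eq_lintegral_ofReal hneg]
  · refine setLIntegral_congr_fun measurableSet_Ioi fun ρ hρ => ?_
    have hρ0 : 0 < ρ := ha.trans hρ
    have := hnp ρ hρ0
    simp only [liftedProfile, not_le.2 hρ0, if_false]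
    rw [← ENNReal.ofReal_mul hρ0.le, ← ENNReal.ofReal_mul (by positivity)]
    congr 1
    field_simp
  · filter_upwards [ae_restrict_mem measurableSet_Ioi] with ρ hρ
    exact neg_nonneg.2 (hnp ρ (ha.trans hρ))

variable {d : ℕ} [NeZero d] {ν ν' : ℝ → ℝ}

theorem ae_norm_pos {V : Type*} [NormedAddCommGroup V] [InnerProductSpace ℝ V]
    [FiniteDimensional ℝ V] [MeasurableSpace V] [BorelSpace V] [Nontrivial V] :
    ∀ᵐ x : V, 0 < ‖x‖ := by
  have : ∀ᵐ x : V, x ≠ 0 := by simp [ae_iff]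
  filter_upwards [this] with x hx using norm_pos_iff.2 hx

theorem levyMeasure_eq_map_fst (h : AntitoneOn (fun r => -ν' r / r) (Ioi 0))
    (hν : ∀ r, 0 < r → IntegrableOn ν' (Ioi r) ∧ ν r = -∫ ρ in Ioi r, ν' ρ) :
    levyMeasure d ν =
      (radialMeasure (ExtE d) (liftedProfile ν')).map (fun x : ExtE d => x.ofLp.1) := by
  rw [map_fst_radialMeasure d (liftedProfile_antitone h).measurable]
  refine withDensity_congr_ae ?_
  filter_upwards [ae_norm_pos] with x hx
  exact (planeIntegral_liftedProfile h hν hx).symm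

/-- The lifted profile defines an infinite Lévy measure in dimension `d + 2`, whose exponent has
the same radial profile as the exponent in dimension `d`. -/
theorem isLevyProfile_liftedProfile (h : AntitoneOn (fun r => -ν' r / r) (Ioi 0))
    (hν : ∀ r, 0 < r → IntegrableOn ν' (Ioi r) ∧ ν r = -∫ ρ in Ioi r, ν' ρ)
    (hmom : ∫⁻ x, ENNReal.ofReal (min 1 (‖x‖ ^ 2)) ∂(levyMeasure d ν) < ∞)
    (hinf : levyMeasure d ν univ = ∞) : IsLevyProfile (ExtE d) (liftedProfile ν') := by
  have hk := liftedProfile_antitone h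
  have hfst : Measurable fun x : ExtE d => x.ofLp.1 := by fun_prop
  have hmap := levyMeasure_eq_map_fst (d := d) h hν
  refine ⟨hk, ?_, ?_⟩
  · let e : ExtE d := WithLp.toLp 2 (EuclideanSpace.single 0 1, 0)
    have he : ‖e‖ = |(1 : ℝ)| := by
      rw [WithLp.prod_norm_eq_of_L2]
      simp [e]
    have h1 := lintegral_min_norm_sq_le hk.measurable he
    simp only [one_pow, one_mul] at h1
    refine h1.trans_lt (ENNReal.mul_lt_top (ENNReal.natCast_lt_top _) ?_)
    refine lt_of_le_of_lt ?_ hmom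
    rw [hmap, lintegral_map (by fun_prop) hfst]
    refine lintegral_mono fun x => ENNReal.ofReal_le_ofReal (min_le_min_left _ ?_)
    rw [WithLp.prod_inner_apply]
    simp only [e, inner_zero_left, add_zero]
    rw [← sq_abs]
    gcongr
    refine (abs_real_inner_le_norm _ _).trans ?_
    simp
  · rw [hmap, Measure.map_apply hfst MeasurableSet.univ] at hinf
    simpa using hinf

theorem exponent_liftedProfile (h : AntitoneOn (fun r => -ν' r / r) (Ioi 0))
    (hν : ∀ r, 0 < r → IntegrableOn ν' (Ioi r) ∧ ν r = -∫ ρ in Ioi r, ν' ρ) (η : E d) {ξ : ExtE d}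
    (hξ : ‖ξ‖ = ‖η‖) : (exponent (liftedProfile ν') ξ).toReal = levyExponent d ν η := by
  have hfst : Measurable fun x : ExtE d => x.ofLp.1 := by fun_prop
  let ξ' : ExtE d := WithLp.toLp 2 (η, 0)
  have hξ' : ‖ξ‖ = ‖ξ'‖ := by
    rw [hξ, WithLp.prod_norm_eq_of_L2]
    simp [ξ']
  rw [exponent_congr (liftedProfile_antitone h).measurable hξ', ← integral_one_sub_cos_eq,
    levyExponent, levyMeasure_eq_map_fst h hν,
    integral_map hfst.aemeasurable (by fun_prop)]
  refine integral_congr_ae (ae_of_all _ fun x => ?_)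
  simp [ξ', WithLp.prod_inner_apply]

theorem exponent_liftedProfile_eq_psi (h : AntitoneOn (fun r => -ν' r / r) (Ioi 0))
    (hν : ∀ r, 0 < r → IntegrableOn ν' (Ioi r) ∧ ν r = -∫ ρ in Ioi r, ν' ρ) (ξ : ExtE d) :
    (exponent (liftedProfile ν') ξ).toReal = psi d ν ‖ξ‖ :=
  exponent_liftedProfile h hν _ (by simp)

theorem levyExponent_eq_psi (h : AntitoneOn (fun r => -ν' r / r) (Ioi 0))
    (hν : ∀ r, 0 < r → IntegrableOn ν' (Ioi r) ∧ ν r = -∫ ρ in Ioi r, ν' ρ) (η : E d) :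
    levyExponent d ν η = psi d ν ‖η‖ := by
  let ξ : ExtE d := WithLp.toLp 2 (η, 0)
  have hξ : ‖ξ‖ = ‖η‖ := by
    rw [WithLp.prod_norm_eq_of_L2]
    simp [ξ]
  rw [← exponent_liftedProfile h hν η hξ, exponent_liftedProfile_eq_psi h hν, hξ]

end Profile

/-! ### The transition density and its derivative -/

section Transition

theorem planeIntegral_lt_top {d : ℕ} [NeZero d] {q : ℝ → ℝ≥0∞} (hq : Antitone q)
    [IsProbabilityMeasure (radialMeasure (ExtE d) q)] {r : ℝ} (hr : 0 < r) :
    planeIntegral q r < ∞ := by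
  have hfst : Measurable fun x : ExtE d => x.ofLp.1 := by fun_prop
  have : IsFiniteMeasure (radialMeasure (E d) (planeIntegral q)) := by
    rw [← map_fst_radialMeasure d hq.measurable]
    infer_instance
  exact lt_top_of_isFiniteMeasure (V := E d) (planeIntegral_antitone q) hr

/-- The fundamental theorem of calculus for integrals over planes. -/
theorem hasDerivAt_planeIntegral {q : ℝ → ℝ≥0∞} (hq : Antitone q)
    (hfin : ∀ r, 0 < r → planeIntegral q r < ∞) {r : ℝ} (hr : 0 < r) (hqr : q r < ∞)
    (hcont : ContinuousAt q r) :
    HasDerivAt (fun s => (planeIntegral q s).toReal) (-(2 * Real.pi * r * (q r).toReal)) r := by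
  let G : ℝ → ℝ := fun ρ => ρ * (q ρ).toReal
  have hqm := hq.measurable
  have hmeas : Measurable fun ρ => ENNReal.ofReal ρ * q ρ := by fun_prop
  have hlt : ∀ a, 0 < a → ∫⁻ ρ in Ioi a, ENNReal.ofReal ρ * q ρ ≠ ∞ := by
    intro a ha htop
    have h1 := hfin a ha
    rw [planeIntegral, htop, ENNReal.mul_top (by simp [Real.pi_pos])] at h1
    exact h1.ne rfl
  have hG : ∀ a, 0 < a → ∀ ρ ∈ Ioi a, (ENNReal.ofReal ρ * q ρ).toReal = G ρ := by
    intro a ha ρ hρ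
    rw [ENNReal.toReal_mul, ENNReal.toReal_ofReal (ha.trans hρ).le]
  have hGint : ∀ a, 0 < a → IntegrableOn G (Ioi a) := fun a ha =>
    (integrable_toReal_of_lintegral_ne_top hmeas.aemeasurable (hlt a ha)).congr
      ((ae_restrict_mem measurableSet_Ioi).mono fun ρ hρ => hG a ha ρ hρ)
  have hQ : ∀ a, 0 < a → (planeIntegral q a).toReal = 2 * Real.pi * ∫ ρ in Ioi a, G ρ := by
    intro a ha
    rw [planeIntegral, ENNReal.toReal_mul, ENNReal.toReal_ofReal (by positivity),
      ← integral_toReal hmeas.aemeasurable (ae_lt_top hmeas (hlt a ha))]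
    rw [setIntegral_congr_fun measurableSet_Ioi (hG a ha)]
  have hr2 : 0 < r / 2 := by linarith
  have hloc : (fun s => (planeIntegral q s).toReal) =ᶠ[𝓝 r] fun s =>
      2 * Real.pi * ((∫ ρ in Ioi (r / 2), G ρ) - ∫ ρ in (r / 2)..s, G ρ) := by
    filter_upwards [Ioi_mem_nhds hr] with s hs
    rw [hQ s hs, ← intervalIntegral.integral_Ioi_sub_Ioi' (hGint _ hr2) (hGint s hs)]
    ring
  have hGm : Measurable G := by fun_prop
  have hGc : ContinuousAt G r :=
    continuousAt_id.mul ((ENNReal.tendsto_toReal hqr.ne).comp hcont)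
  have hint : IntervalIntegrable G volume (r / 2) r := by
    rw [intervalIntegrable_iff_integrableOn_Ioc_of_le (by linarith)]
    exact (hGint _ hr2).mono_set Ioc_subset_Ioi_self
  have h1 := intervalIntegral.integral_hasDerivAt_right hint
    hGm.stronglyMeasurable.stronglyMeasurableAtFilter hGc
  refine HasDerivAt.congr_of_eventuallyEq ?_ hloc
  refine ((h1.const_sub (∫ ρ in Ioi (r / 2), G ρ)).const_mul (2 * Real.pi)).congr_deriv ?_
  simp only [G]
  ring

variable {d : ℕ} [NeZero d] {Ω : Type*} [MeasurableSpace Ω] {P : Measure Ω}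
  [IsProbabilityMeasure P] {X : ℝ≥0 → Ω → E d} {ν : ℝ → ℝ}

theorem AssumptionsA.isUnimodalExponent (h : AssumptionsA X P ν) :
    IsUnimodalExponent (monoConst (ExtE d)) (psi d ν) := by
  obtain ⟨ν', hν, hanti⟩ := h.h1.derivative
  exact (isLevyProfile_liftedProfile hanti hν h.h0.finite_moment h.h0.infinite).isUnimodalExponent
    (exponent_liftedProfile_eq_psi hanti hν)

/-- The law of `X t` is the projection of an isotropic unimodal law in dimension `d + 2` whose
exponent has the same radial profile. -/
theorem AssumptionsA.exists_lifted_density (h : AssumptionsA X P ν) {t : ℝ≥0} (ht : 0 < t) :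
    ∃ q : ℝ → ℝ≥0∞, Antitone q ∧ IsProbabilityMeasure (radialMeasure (ExtE d) q) ∧
      (∀ r, 0 < r → ContinuousAt q r) ∧
      (∀ ξ : ExtE d, charFun (radialMeasure (ExtE d) q) ξ =
        Complex.exp ((-(t * psi d ν ‖ξ‖) : ℝ) : ℂ)) ∧
      P.map (X t) = radialMeasure (E d) (planeIntegral q) := by
  obtain ⟨ν', hν, hanti⟩ := h.h1.derivative
  obtain ⟨q, hq, hp, hcont, hc⟩ := (isLevyProfile_liftedProfile hanti hν h.h0.finite_moment
    h.h0.infinite).exists_continuous_density (t := t) (by exact_mod_cast ht)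
  simp_rw [exponent_liftedProfile_eq_psi hanti hν] at hc
  refine ⟨q, hq, hp, hcont, hc, ?_⟩
  have hfst : Measurable fun x : ExtE d => x.ofLp.1 := by fun_prop
  have : IsProbabilityMeasure (P.map (X t)) :=
    Measure.isProbabilityMeasure_map (h.h0.levy.measurable t).aemeasurable
  rw [← map_fst_radialMeasure d hq.measurable]
  refine Measure.ext_of_charFun (funext fun η => ?_)
  let ξ : ExtE d := WithLp.toLp 2 (η, 0)
  have hξ : ‖ξ‖ = ‖η‖ := by
    rw [WithLp.prod_norm_eq_of_L2]
    simp [ξ]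
  have h1 : charFun ((radialMeasure (ExtE d) q).map fun x : ExtE d => x.ofLp.1) η =
      charFun (radialMeasure (ExtE d) q) ξ := by
    rw [charFun_apply, charFun_apply, integral_map hfst.aemeasurable (by fun_prop)]
    simp [ξ, WithLp.prod_inner_apply]
  rw [h1, hc, h.h0.charFun_eq, levyExponent_eq_psi hanti hν, hξ, Complex.ofReal_neg]

theorem AssumptionsA.exists_isTransitionDensity (h : AssumptionsA X P ν) :
    ∃ p : ℝ≥0 → ℝ → ℝ, IsTransitionDensity X P p := by
  choose! q hq hp hcont hc hmap using fun (t : ℝ≥0) (ht : 0 < t) => h.exists_lifted_density ht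
  refine ⟨fun t r => (planeIntegral (q t) r).toReal, fun t ht => ⟨fun _ _ => ENNReal.toReal_nonneg,
    fun r hr s _ hrs => ?_, ?_⟩⟩
  · have := hp t ht
    exact ENNReal.toReal_mono (planeIntegral_lt_top (d := d) (hq t ht) hr).ne
      (planeIntegral_antitone _ hrs)
  · have := hp t ht
    rw [hmap t ht]
    refine withDensity_congr_ae ?_
    filter_upwards [ae_norm_pos] with x hx
    rw [ENNReal.ofReal_toReal (planeIntegral_lt_top (d := d) (hq t ht) hx).ne]

/-- A monotone profile of the law of `X t` agrees almost everywhere with the integrals of the lifted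
density over planes; as these depend continuously on the radius, the two agree at every `r > 0`. -/
theorem IsTransitionDensity.eq_planeIntegral {p : ℝ≥0 → ℝ → ℝ} (hpX : IsTransitionDensity X P p)
    {t : ℝ≥0} (ht : 0 < t) {q : ℝ → ℝ≥0∞} (hq : Antitone q)
    [IsProbabilityMeasure (radialMeasure (ExtE d) q)] (hcont : ∀ r, 0 < r → ContinuousAt q r)
    (hmap : P.map (X t) = radialMeasure (E d) (planeIntegral q)) {r : ℝ} (hr : 0 < r) :
    p t r = (planeIntegral q r).toReal := by
  obtain ⟨hp0, hpa, hpm⟩ := hpX t ht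
  let g : ℝ → ℝ≥0∞ := fun s => if s ≤ 0 then ∞ else ENNReal.ofReal (p t s)
  have hg : Antitone g := by
    intro s u hsu
    by_cases hs : s ≤ 0
    · simp [g, hs]
    · have hu : ¬ u ≤ 0 := by linarith
      simp only [g, hs, hu, if_false]
      exact ENNReal.ofReal_le_ofReal (hpa (not_le.1 hs) (not_le.1 hu) hsu)
  have hgpos : ∀ s, 0 < s → g s = ENNReal.ofReal (p t s) := fun s hs => by
    simp [g, not_le.2 hs]
  have hfin : ∀ s, 0 < s → planeIntegral q s < ∞ := fun s hs => planeIntegral_lt_top (d := d) hq hs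
  have hQm : Measurable fun x : E d => planeIntegral q ‖x‖ :=
    measurable_comp_norm (planeIntegral_antitone q).measurable
  have hae : ∀ᵐ x : E d, g ‖x‖ = planeIntegral q ‖x‖ := by
    have h1 : radialMeasure (E d) g = radialMeasure (E d) (planeIntegral q) := by
      rw [← hmap, hpm]
      refine withDensity_congr_ae ?_
      filter_upwards [ae_norm_pos] with x hx using hgpos _ hx
    have hne : ∫⁻ x : E d, g ‖x‖ ≠ ∞ := by
      have : IsFiniteMeasure (radialMeasure (E d) g) := by
        rw [h1, ← map_fst_radialMeasure d hq.measurable]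
        infer_instance
      have := measure_ne_top (radialMeasure (E d) g) univ
      rwa [radialMeasure, withDensity_apply _ MeasurableSet.univ, setLIntegral_univ] at this
    exact (withDensity_eq_iff (measurable_comp_norm hg.measurable).aemeasurable hQm.aemeasurable
      hne).1 h1
  have hQc : ContinuousAt (planeIntegral q) r := by
    have h1 := (hasDerivAt_planeIntegral hq hfin hr
      (lt_top_of_isFiniteMeasure (V := ExtE d) hq hr) (hcont r hr)).continuousAt
    refine (ENNReal.continuous_ofReal.continuousAt.comp h1).congr ?_
    filter_upwards [Ioi_mem_nhds hr] with s hs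
    exact ENNReal.ofReal_toReal (hfin s hs).ne
  obtain ⟨x₀, hx₀⟩ := exists_norm_eq (E d) hr.le
  have hx₀0 : x₀ ≠ 0 := by
    rintro rfl
    rw [norm_zero] at hx₀
    exact hr.ne hx₀
  have hcomp : ContinuousAt (fun x : E d => planeIntegral q ‖x‖) x₀ :=
    ContinuousAt.comp (f := fun x : E d => ‖x‖) (g := planeIntegral q) (by rwa [hx₀])
      continuous_norm.continuousAt
  have hlim := tendsto_of_ae_eq hg hae hx₀0 hcomp
  rw [hx₀] at hlim
  rw [← eq_of_tendsto_nhds hlim, hgpos r hr, ENNReal.toReal_ofReal (hp0 r hr)]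

theorem IsTransitionDensity.hasDerivAt {p : ℝ≥0 → ℝ → ℝ} (hpX : IsTransitionDensity X P p)
    {t : ℝ≥0} (ht : 0 < t) {q : ℝ → ℝ≥0∞} (hq : Antitone q)
    [IsProbabilityMeasure (radialMeasure (ExtE d) q)] (hcont : ∀ r, 0 < r → ContinuousAt q r)
    (hmap : P.map (X t) = radialMeasure (E d) (planeIntegral q)) {r : ℝ} (hr : 0 < r) :
    HasDerivAt (p t) (-(2 * Real.pi * r * (q r).toReal)) r := by
  refine (hasDerivAt_planeIntegral hq (fun s hs => planeIntegral_lt_top (d := d) hq hs) hr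
    (lt_top_of_isFiniteMeasure (V := ExtE d) hq hr) (hcont r hr)).congr_of_eventuallyEq ?_
  filter_upwards [Ioi_mem_nhds hr] with s hs
  exact hpX.eq_planeIntegral ht hq hcont hmap hs

/-- The derivative of the transition density is `-2πr` times the density in dimension `d + 2`. -/
theorem AssumptionsA.exists_abs_deriv_eq (h : AssumptionsA X P ν) {p : ℝ≥0 → ℝ → ℝ}
    (hpX : IsTransitionDensity X P p) {t : ℝ≥0} (ht : 0 < t) :
    ∃ q : ℝ → ℝ≥0∞, Antitone q ∧ IsProbabilityMeasure (radialMeasure (ExtE d) q) ∧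
      (∀ r, 0 < r → ContinuousAt q r) ∧
      (∀ ξ : ExtE d, charFun (radialMeasure (ExtE d) q) ξ =
        Complex.exp ((-(t * psi d ν ‖ξ‖) : ℝ) : ℂ)) ∧
      ∀ r, 0 < r → DifferentiableAt ℝ (p t) r ∧
        |deriv (p t) r| = 2 * Real.pi * r * (q r).toReal := by
  obtain ⟨q, hq, hp, hcont, hc, hmap⟩ := h.exists_lifted_density ht
  refine ⟨q, hq, hp, hcont, hc, fun r hr => ?_⟩
  have h1 := hpX.hasDerivAt ht hq hcont hmap hr
  refine ⟨h1.differentiableAt, ?_⟩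
  rw [h1.deriv, abs_neg, abs_of_nonneg (by positivity)]

end Transition

end LevyGradient

theorem corollary1p6 (d : ℕ) [NeZero d] :
    -- the radial nonincreasing transition density exists
    (∀ (Ω : Type u) [MeasurableSpace Ω] (P : Measure Ω) [IsProbabilityMeasure P]
      (X : ℝ≥0 → Ω → E d) (ν : ℝ → ℝ), AssumptionsA X P ν →
        ∃ p : ℝ≥0 → ℝ → ℝ, IsTransitionDensity X P p) ∧
    -- differentiability and the general upper bound
    (∃ c : ℝ, 0 < c ∧
      ∀ (Ω : Type u) [MeasurableSpace Ω] (P : Measure Ω) [IsProbabilityMeasure P]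
        (X : ℝ≥0 → Ω → E d) (ν : ℝ → ℝ) (p : ℝ≥0 → ℝ → ℝ),
        AssumptionsA X P ν → IsTransitionDensity X P p →
        ∀ (t : ℝ≥0) (r : ℝ), 0 < t → 0 < r →
          DifferentiableAt ℝ (p t) r ∧
          |deriv (p t) r| ≤ c * (min 1 (t * psiStar d ν (1 / r)) / r ^ (d + 1))) ∧
    -- the upper bound under weak lower scaling
    (∀ α : ℝ, ∃ c : ℝ, 0 < c ∧
      ∀ (Ω : Type u) [MeasurableSpace Ω] (P : Measure Ω) [IsProbabilityMeasure P]
        (X : ℝ≥0 → Ω → E d) (ν : ℝ → ℝ) (p : ℝ≥0 → ℝ → ℝ) (θ₀ C : ℝ),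
        AssumptionsA X P ν → IsTransitionDensity X P p → WLSC (psi d ν) α θ₀ C →
        ∀ (t : ℝ≥0) (r : ℝ), 0 < t → 0 < r →
          (θ₀ = 0 ∨ t * psiStar d ν θ₀ ≤ 1 / Real.pi ^ 2) →
          |deriv (p t) r| ≤ c * (r / C ^ (((d : ℝ) + 2) / α + 1)) *
            min (psiInv d ν (1 / t) ^ (d + 2)) (t * psiStar d ν (1 / r) / r ^ (d + 2))) ∧
    -- the lower bound under weak lower and weak upper scaling
    (∀ α β C₁ C₂ : ℝ, ∃ c r₀ : ℝ, 0 < c ∧ 0 < r₀ ∧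
      ∀ (Ω : Type u) [MeasurableSpace Ω] (P : Measure Ω) [IsProbabilityMeasure P]
        (X : ℝ≥0 → Ω → E d) (ν : ℝ → ℝ) (p : ℝ≥0 → ℝ → ℝ) (θ₀ : ℝ),
        AssumptionsA X P ν → IsTransitionDensity X P p →
        WLSC (psi d ν) α θ₀ C₁ → WUSC (psi d ν) β θ₀ C₂ →
        ∀ (t : ℝ≥0) (r : ℝ), 0 < t → 0 < r →
          (θ₀ = 0 ∨ (t * psiStar d ν (θ₀ / r₀) ≤ 1 ∧ r < r₀ / θ₀)) →
          c * r * min (psiInv d ν (1 / t) ^ (d + 2)) (t * psiStar d ν (1 / r) / r ^ (d + 2))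
            ≤ |deriv (p t) r|) := by
  refine ⟨fun Ω _ P _ X ν h => h.exists_isTransitionDensity, ?_, fun α => ?_, fun α β C₁ C₂ => ?_⟩
  · obtain ⟨c, hc0, hc⟩ := density_le (ExtE d)
    refine ⟨2 * Real.pi * c, by positivity, fun Ω _ P _ X ν p h hp t r ht hr => ?_⟩
    obtain ⟨q, hq, hprob, -, hchar, hderiv⟩ := h.exists_abs_deriv_eq hp ht
    refine ⟨(hderiv r hr).1, ?_⟩
    rw [(hderiv r hr).2]
    have h1 := hc q (psi d ν) _ t hq hprob h.isUnimodalExponent (by exact_mod_cast ht) hchar r hr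
    rw [finrank_extE] at h1
    calc 2 * Real.pi * r * (q r).toReal
        ≤ 2 * Real.pi * r *
          (c * (min 1 (t * runningSup (psi d ν) (1 / r)) / r ^ (d + 2))) := by gcongr
      _ = 2 * Real.pi * c * (min 1 (t * runningSup (psi d ν) (1 / r)) / r ^ (d + 1)) := by
          field_simp
          ring
  · obtain ⟨c₁, hc₁, hb₁⟩ := density_le (ExtE d)
    obtain ⟨c₂, hc₂, hb₂⟩ := density_le_of_wlsc (ExtE d) α
    refine ⟨2 * Real.pi * (c₁ + c₂), by positivity,
      fun Ω _ P _ X ν p θ₀ C h hp hw t r ht hr hθ => ?_⟩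
    obtain ⟨q, hq, hprob, hcont, hchar, hderiv⟩ := h.exists_abs_deriv_eq hp ht
    have hψ := h.isUnimodalExponent
    have ht0 : (0 : ℝ) < t := by exact_mod_cast ht
    have hC := hw.const_pos
    have hα := hw.alpha_pos
    obtain ⟨hs0, -, hs⟩ := hψ.runningSupInv_spec (one_div_pos.2 ht0)
    set s := runningSupInv (psi d ν) (1 / t) with hsdef
    -- The level `1 / t` of `ψ*` lies above `ψ*(θ₀)`.
    have hθs : θ₀ ≤ s := by
      rcases hθ with rfl | hθ
      · exact hs0.le
      · by_contra hcon
        push Not at hcon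
        have h1 : 1 / (t : ℝ) ≤ psiStar d ν θ₀ := hs ▸ hψ.runningSup_mono hs0.le hcon.le
        have h2 : 1 ≤ t * psiStar d ν θ₀ := by
          rw [div_le_iff₀ ht0] at h1
          linarith
        have h3 : 1 / Real.pi ^ 2 < 1 := by
          rw [div_lt_one (by positivity)]
          nlinarith [Real.pi_gt_three]
        linarith
    have h1 := hb₁ q (psi d ν) _ t hq hprob hψ ht0 hchar r hr
    have h2 := hb₂ q (psi d ν) _ t θ₀ C hq hprob hψ ht0 hchar hw hθs r hr (hcont r hr)
    rw [finrank_extE] at h1 h2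
    push_cast at h2
    set D := C ^ (((d : ℝ) + 2) / α + 1) with hD
    have hD0 : 0 < D := Real.rpow_pos_of_pos hC _
    have hD1 : D ≤ 1 := Real.rpow_le_one hC.le (hψ.wlsc_le_one hw) (by positivity)
    have hsup : 0 ≤ runningSup (psi d ν) (1 / r) := hψ.runningSup_nonneg (by positivity)
    have hkey : (q r).toReal ≤ (c₁ + c₂) / D *
        min (s ^ (d + 2)) (t * runningSup (psi d ν) (1 / r) / r ^ (d + 2)) := by
      rw [mul_min_of_nonneg _ _ (by positivity)]
      refine le_min (h2.trans ?_) (h1.trans ?_)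
      · gcongr
        linarith
      · refine mul_le_mul ?_ (div_le_div_of_nonneg_right (min_le_right _ _) (by positivity))
          (by positivity) (by positivity)
        rw [le_div_iff₀ hD0]
        nlinarith
    rw [(hderiv r hr).2]
    calc 2 * Real.pi * r * (q r).toReal
        ≤ 2 * Real.pi * r * ((c₁ + c₂) / D *
          min (s ^ (d + 2)) (t * runningSup (psi d ν) (1 / r) / r ^ (d + 2))) := by gcongr
      _ = 2 * Real.pi * (c₁ + c₂) * (r / D) *
          min (s ^ (d + 2)) (t * runningSup (psi d ν) (1 / r) / r ^ (d + 2)) := by ring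
  · by_cases hpar : 0 < α ∧ β < 2 ∧ 0 < C₁ ∧ 0 < C₂
    · obtain ⟨hα, hβ, hC₁, hC₂⟩ := hpar
      obtain ⟨c, r₀, hc, hr₀, hb⟩ := le_density (ExtE d) (monoConst (ExtE d)) hα hβ hC₁ hC₂
      refine ⟨2 * Real.pi * c, r₀, by positivity, hr₀,
        fun Ω _ P _ X ν p θ₀ h hp hw hu t r ht hr hθ => ?_⟩
      obtain ⟨q, hq, hprob, -, hchar, hderiv⟩ := h.exists_abs_deriv_eq hp ht
      have h1 := hb q (psi d ν) t θ₀ hq hprob h.isUnimodalExponent (by exact_mod_cast ht) hchar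
        hw hu r hr hθ
      rw [finrank_extE] at h1
      rw [(hderiv r hr).2]
      have h2 := mul_le_mul_of_nonneg_left h1 (show 0 ≤ 2 * Real.pi * r by positivity)
      refine le_trans (le_of_eq ?_) h2
      change 2 * Real.pi * c * r * min (runningSupInv (psi d ν) (1 / t) ^ (d + 2))
        (t * runningSup (psi d ν) (1 / r) / r ^ (d + 2)) = _
      ring
    · -- For other parameters the scaling conditions cannot hold.
      exact ⟨1, 1, one_pos, one_pos, fun Ω _ P _ X ν p θ₀ h hp hw hu => absurd
        ⟨hw.alpha_pos, hu.alpha_lt, hw.const_pos, hu.const_pos⟩ hpar⟩
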